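/- **Setting.** Let $d\ge 2$ and let $\mathcal P^{d}=\{x\in\mathbb R_{\ge 0}^{d+1}:\sum_l x_l=1\}$ be the $d$-dimensional probability simplex. An agent has $N$ actions; action $i$ has an outcome distribution $p_i^*\in\mathcal P^{d}$ (unknown) and a cost $c_i\in\mathbb R$ (known). To a contract $x\in\mathbb R^{d+1}$ the agent answers with a best response $a^*(x)\in\arg\max_i\{\langle x,p_i^*\rangle-c_i\}$, ties being broken arbitrarily. Let $\mathcal V_i=\{x\in\mathcal P^{d}:\langle x,p_i^*-p_j^*\rangle\ge c_i-c_j\ \forall j\ne i\}$. Assume, for some $\varsigma\in(0,1]$ and $\theta>0$, that $$\mathrm{Vol}^{d}(\mathcal V_i)\ge\varsigma\,\mathrm{Vol}^{d}(\mathcal P^{d})\ \text{ for all } i,\qquad |c_i-c_j|\ge\theta\ \text{ for all } i\neq j.$$ **Algorithm** (parameters $T\in\mathbb N$, $c_d>0$, $\varepsilon>0$). In each of $T$ independent samples draw $z_1,z_2$ independently and uniformly from $\mathcal P^{d}$ and let $\ell$ be the intersection of $\mathcal P^{d}$ with the line through them. By binary search on $\ell$ find all segments $[x_k,y_k]$ with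 $\|x_k-y_k\|_\infty\le\varepsilon$ that contain a switching point (pieces whose endpoints have equal responses are dropped), and memorize $x_k,y_k$ with their responses. Around each midpoint $(x_k+y_k)/2$ place a randomly oriented regular $d$-dimensional simplex with edge length $\sqrt2\,c_d$, parallel to $\mathcal P^d$ (any law of the orientations is allowed); play its $d+1$ vertices; on every edge whose endpoints have different responses, find by binary search a segment $[u,w]$ with $\|u-w\|_\infty\le\varepsilon$ that contains a switching point, and memorize $u,w$ with their responses. Each played contract is one round. Let $\mathcal S$ be the set of tuples of outcome distributions $(p_1,\dots,p_N)\in(\mathcal P^d)^N$ with $\langle w,p_{a^*(w)}-p_{a'}\rangle\ge c_{a^*(w)}-c_{a'}$ for all memorized $(w,a^*(w))$ and all $a'\ne a^*(w)$, and $\langle\mathbf 1,p_i-p_j\rangle=0$ for all $i,j$. **Detection probability.** Let $\sigma_d:[0,1]\to[0,1]$ be the pointwise largest function such that $\mathbb P(\ell\cap e\ne\emptyset)\ge\sigma_d\big(\mathrm{Vol}^{d-1}(e)/\mathrm{Vol}^{d-1}(\mathcal P^{d-1})\big)$ for every convex $e\subset\mathcal P^{d}$ contained in a $(d-1)$-dimensional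 affine subspace. **(a)** There is an absolute constant $K>0$ such that the following holds. Suppose that $$\xi_d^2:=\frac{c_d^2}{d^2}-\frac{d\varepsilon^2}{8}>0,\qquad \tau_d:=\Big(\frac{\varsigma^2}{3d}\Big)^{d}-d^2\Big(1+\frac{4}{d\varsigma}\Big)(c_d+\varepsilon)>0 .$$ Then $T$ samples take almost surely at most $K\,T N d^2\log(1/\varepsilon)$ rounds, and with probability at least $1-Ne^{-T\sigma_d(\tau_d)}$ every $(p_1,\dots,p_N)\in\mathcal S$ satisfies, for all $i,j$, $$\big\|(p_i-p_j)-(p_i^*-p_j^*)\big\|_2\le\frac{2(N-1)\sqrt d\,\varepsilon}{\xi_d^{\,d-1}\,\theta}.$$ **(b)** There is an absolute constant $K>0$ such that for all $d\ge2$, $N$, $\varsigma\in(0,1]$, $\theta>0$ and every target accuracy $\eta\in(0,1)$ there are $c_d,\varepsilon>0$, satisfying the two conditions of (a), with the following property. For every number $n$ of rounds there is a $T$ such that, for every instance satisfying the assumptions, the algorithm with parameters $T,c_d,\varepsilon$ takes almost surely at most $n$ rounds, and $$\big\|(p_i-p_j)-(p_i^*-p_j^*)\big\|_2<\eta\quad\text{for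 all } (p_1,\dots,p_N)\in\mathcal S \text{ and all } i,j$$ holds with probability at least $$1-N\exp\!\left(-\frac{n\,\sigma_d\big((\varsigma^2/(6d))^{d}\big)}{K\,N d^4\log\!\big(N\varsigma^{-2}\eta^{-1}\theta^{-1}\big)}\right).$$ -/

import Mathlib

open MeasureTheory ProbabilityTheory

noncomputable section

namespace SimplexSearch

/-- `ℝⁿ` with the Euclidean norm. -/
abbrev Vec (n : ℕ) : Type := EuclideanSpace ℝ (Fin n)

/-- The probability simplex in `ℝⁿ`. It has dimension `n - 1`, so that the `d`-dimensional
probability simplex is `probSimplex (d + 1)`. -/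
def probSimplex (n : ℕ) : Set (Vec n) :=
  {x | (∀ l, 0 ≤ x l) ∧ ∑ l, x l = 1}

/-! ### The agent -/

/-- The best-response region of action `i` in the `d`-dimensional simplex of contracts. -/
def region {d N : ℕ} (p : Fin N → Vec (d + 1)) (cost : Fin N → ℝ) (i : Fin N) :
    Set (Vec (d + 1)) :=
  {x | x ∈ probSimplex (d + 1) ∧ ∀ j, j ≠ i → cost i - cost j ≤ inner ℝ x (p i - p j)}

/-- `p` and `cost` are the outcome distributions and costs of the actions, every best-response
region fills at least the fraction `ς` of the simplex, and two costs differ by at least `θ`.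
Volumes are Hausdorff measures; only their ratios matter. -/
structure IsInstance {d N : ℕ} (ς θ : ℝ) (p : Fin N → Vec (d + 1)) (cost : Fin N → ℝ) :
    Prop where
  distribution : ∀ i, p i ∈ probSimplex (d + 1)
  volume : ∀ i, ENNReal.ofReal ς * μH[(d : ℝ)] (probSimplex (d + 1)) ≤ μH[(d : ℝ)] (region p cost i)
  gap : ∀ i j, i < j → θ ≤ |cost i - cost j|

/-- `a` answers every contract with a best response; ties are broken arbitrarily. -/
def IsBestResponse {d N : ℕ} (p : Fin N → Vec (d + 1)) (cost : Fin N → ℝ)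
    (a : Vec (d + 1) → Fin N) : Prop :=
  ∀ x j, cost (a x) - cost j ≤ inner ℝ x (p (a x) - p j)

/-! ### Random lines and the surface detection probability -/

/-- The uniform distribution on the `d`-dimensional probability simplex. -/
def uniformSimplex (d : ℕ) : Measure (Vec (d + 1)) :=
  ProbabilityTheory.cond μH[(d : ℝ)] (probSimplex (d + 1))

/-- The joint law of two independent uniform points of the simplex. -/
def lineLaw (d : ℕ) : Measure (Vec (d + 1) × Vec (d + 1)) :=
  (uniformSimplex d).prod (uniformSimplex d)

/-- The part inside the simplex of the line through the two points of `z`. -/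
def chord {d : ℕ} (z : Vec (d + 1) × Vec (d + 1)) : Set (Vec (d + 1)) :=
  (line[ℝ, z.1, z.2] : Set (Vec (d + 1))) ∩ probSimplex (d + 1)

/-- One endpoint of `chord z`. -/
def chordStart {d : ℕ} (z : Vec (d + 1) × Vec (d + 1)) : Vec (d + 1) :=
  AffineMap.lineMap z.1 z.2
    (sInf {s : ℝ | AffineMap.lineMap z.1 z.2 s ∈ probSimplex (d + 1)})

/-- The other endpoint of `chord z`. -/
def chordEnd {d : ℕ} (z : Vec (d + 1) × Vec (d + 1)) : Vec (d + 1) :=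
  AffineMap.lineMap z.1 z.2
    (sSup {s : ℝ | AffineMap.lineMap z.1 z.2 s ∈ probSimplex (d + 1)})

/-- `e` is a convex subset of the `d`-dimensional simplex that lies on a `(d-1)`-dimensional
affine subspace. -/
def IsConvexSurface (d : ℕ) (e : Set (Vec (d + 1))) : Prop :=
  Convex ℝ e ∧ e ⊆ probSimplex (d + 1) ∧
    ∃ H : AffineSubspace ℝ (Vec (d + 1)), Module.finrank ℝ H.direction = d - 1 ∧ e ⊆ H

/-- The `(d-1)`-dimensional volume of `e`, divided by that of the `(d-1)`-dimensional
probability simplex. -/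
def surfaceRatio (d : ℕ) (e : Set (Vec (d + 1))) : ℝ :=
  (μH[(d : ℝ) - 1] e / μH[(d : ℝ) - 1] (probSimplex d)).toReal

/-- The surface detection probability function: the pointwise largest `[0, 1]`-valued function
`σ` such that a random line meets every convex surface `e` with probability at least
`σ (surfaceRatio d e)`. -/
def surfaceDetection (d : ℕ) (v : ℝ) : ℝ :=
  sSup {s : ℝ | 0 ≤ s ∧ s ≤ 1 ∧ ∀ e, IsConvexSurface d e → surfaceRatio d e = v →
    s ≤ (lineLaw d).real {z | (chord z ∩ e).Nonempty}}

/-! ### The search algorithm -/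

/-- The number of halvings that bring the segment from `x` to `y` to length at most `ε` in the
supremum norm. -/
def halvings {n : ℕ} (ε : ℝ) (x y : Vec n) : ℕ :=
  Nat.clog 2 ⌈‖WithLp.ofLp (x - y)‖ / ε⌉₊

variable {d N : ℕ}

/-- Binary search, with `k` rounds of halving, for all switching points on the segment from `x`
to `y`. A piece whose endpoints have the same response contains no switching point (regions are
convex) and is dropped. -/
def searchAll (a : Vec (d + 1) → Fin N) :
    ℕ → Vec (d + 1) → Vec (d + 1) → List (Vec (d + 1) × Vec (d + 1))
  | 0, x, y => if a x = a y then [] else [(x, y)]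
  | k + 1, x, y => if a x = a y then [] else
      searchAll a k x (midpoint ℝ x y) ++ searchAll a k (midpoint ℝ x y) y

/-- The number of contracts played by `searchAll`, those at `x` and `y` not counted. -/
def searchAllRounds (a : Vec (d + 1) → Fin N) : ℕ → Vec (d + 1) → Vec (d + 1) → ℕ
  | 0, _, _ => 0
  | k + 1, x, y => if a x = a y then 0 else
      1 + searchAllRounds a k x (midpoint ℝ x y) + searchAllRounds a k (midpoint ℝ x y) y

/-- Binary search for one switching point between `x` and `y`, where the responses differ. It
plays `k` contracts, one for each halving. -/
def searchOne (a : Vec (d + 1) → Fin N) :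
    ℕ → Vec (d + 1) → Vec (d + 1) → Vec (d + 1) × Vec (d + 1)
  | 0, x, y => (x, y)
  | k + 1, x, y => if a (midpoint ℝ x y) = a x then searchOne a k (midpoint ℝ x y) y
      else searchOne a k x (midpoint ℝ x y)

/-- The segments containing a switching point that are found on the line through `z`. -/
def segments (a : Vec (d + 1) → Fin N) (ε : ℝ) (z : Vec (d + 1) × Vec (d + 1)) :
    List (Vec (d + 1) × Vec (d + 1)) :=
  searchAll a (halvings ε (chordStart z) (chordEnd z)) (chordStart z) (chordEnd z)

/-- A regular `d`-dimensional simplex with edge length `√2 c`, parallel to the probability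
simplex and centered at the origin, given by its vertices. -/
def IsCenteredSimplex (c : ℝ) (v : Fin (d + 1) → Vec (d + 1)) : Prop :=
  (∀ r, ∑ l, v r l = 0) ∧ ∑ r, v r = 0 ∧ ∀ r s, r ≠ s → dist (v r) (v s) = √2 * c

/-- The vertices of the simplex placed around the midpoint of a segment `s`. -/
def vertex (v : Fin (d + 1) → Vec (d + 1)) (s : Vec (d + 1) × Vec (d + 1)) (r : Fin (d + 1)) :
    Vec (d + 1) :=
  midpoint ℝ s.1 s.2 + v r

/-- The result of the binary search on the edge from `x` to `y`. -/
def edgeSearch (a : Vec (d + 1) → Fin N) (ε : ℝ) (x y : Vec (d + 1)) :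
    Vec (d + 1) × Vec (d + 1) :=
  searchOne a (halvings ε x y) x y

/-- The contracts memorized in one sample with line `z`, where `F k` is the shape of the simplex
placed around the `k`-th segment found on the line. -/
def samplePoints (a : Vec (d + 1) → Fin N) (ε : ℝ) (z : Vec (d + 1) × Vec (d + 1))
    (F : ℕ → Fin (d + 1) → Vec (d + 1)) : Set (Vec (d + 1)) :=
  {w | ∃ (k : ℕ) (s : Vec (d + 1) × Vec (d + 1)), (segments a ε z)[k]? = some s ∧
    (w = s.1 ∨ w = s.2 ∨ ∃ r r' : Fin (d + 1), r < r' ∧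
      a (vertex (F k) s r) ≠ a (vertex (F k) s r') ∧
      (w = (edgeSearch a ε (vertex (F k) s r) (vertex (F k) s r')).1 ∨
        w = (edgeSearch a ε (vertex (F k) s r) (vertex (F k) s r')).2))}

/-- The number of contracts played in one sample: the endpoints of the line and the binary search
on it, and for every segment found the vertices of the simplex and the binary searches on the
edges whose endpoints have different responses. -/
def sampleRounds (a : Vec (d + 1) → Fin N) (ε : ℝ) (z : Vec (d + 1) × Vec (d + 1))
    (F : ℕ → Fin (d + 1) → Vec (d + 1)) : ℕ :=
  2 + searchAllRounds a (halvings ε (chordStart z) (chordEnd z)) (chordStart z) (chordEnd z) +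
    ∑ k : Fin (segments a ε z).length, ((d + 1) + ∑ r : Fin (d + 1), ∑ r' : Fin (d + 1),
      if r < r' ∧ a (vertex (F k) ((segments a ε z).get k) r) ≠
          a (vertex (F k) ((segments a ε z).get k) r') then
        halvings ε (vertex (F k) ((segments a ε z).get k) r)
          (vertex (F k) ((segments a ε z).get k) r')
      else 0)

/-- The memory after the samples with lines `z t` and simplex shapes `F t`: the memorized contracts
with their responses. -/
def memory {T : ℕ} (a : Vec (d + 1) → Fin N) (ε : ℝ) (z : Fin T → Vec (d + 1) × Vec (d + 1))
    (F : Fin T → ℕ → Fin (d + 1) → Vec (d + 1)) : Set (Vec (d + 1) × Fin N) :=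
  {m | ∃ t, m.1 ∈ samplePoints a ε (z t) (F t) ∧ m.2 = a m.1}

/-- The total number of contracts played. -/
def rounds {T : ℕ} (a : Vec (d + 1) → Fin N) (ε : ℝ) (z : Fin T → Vec (d + 1) × Vec (d + 1))
    (F : Fin T → ℕ → Fin (d + 1) → Vec (d + 1)) : ℕ :=
  ∑ t, sampleRounds a ε (z t) (F t)

/-- The tuples of outcome distributions that are consistent with the memory. -/
def feasible (cost : Fin N → ℝ) (M : Set (Vec (d + 1) × Fin N)) : Set (Fin N → Vec (d + 1)) :=
  {q | (∀ i, q i ∈ probSimplex (d + 1)) ∧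
    (∀ m ∈ M, ∀ j, j ≠ m.2 → cost m.2 - cost j ≤ inner ℝ m.1 (q m.2 - q j)) ∧
    ∀ i j, ∑ l, (q i - q j) l = 0}

/-- The random input of a run with `T` samples: the lines `Z t` are independent, each drawn through
two independent uniform points, and the simplex shapes `F t k` are drawn in any way whatsoever
(their orientations may depend on everything else). -/
structure IsRandomInput {T : ℕ} {Ω : Type*} [MeasurableSpace Ω] (μ : Measure Ω) (c : ℝ)
    (Z : Fin T → Ω → Vec (d + 1) × Vec (d + 1))
    (F : Fin T → ℕ → Ω → Fin (d + 1) → Vec (d + 1)) : Prop where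
  law : ∀ t, HasLaw (Z t) (lineLaw d) μ
  indep : iIndepFun Z μ
  shape : ∀ t k ω, IsCenteredSimplex c (F t k ω)

/-! ### The constants -/

/-- `ξ_d²`. -/
def xiSq (d : ℕ) (c ε : ℝ) : ℝ := c ^ 2 / d ^ 2 - d * ε ^ 2 / 8

/-- `ξ_d`. -/
def xi (d : ℕ) (c ε : ℝ) : ℝ := √(xiSq d c ε)

/-- `τ_d`. -/
def tau (d : ℕ) (ς c ε : ℝ) : ℝ :=
  (ς ^ 2 / (3 * d)) ^ d - d ^ 2 * (1 + 4 / (d * ς)) * (c + ε)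

end SimplexSearch

end

open SimplexSearch

open MeasureTheory ProbabilityTheory
open SimplexSearch
open scoped ENNReal NNReal

/-! ### The hyperplane of the simplex: isometric coordinates and Fubini's theorem. -/

namespace SimplexSearch

/-! The regions of two actions i and j meet on the hyperplane ⟨x, p_i − p_j⟩ = c_i − c_j, whose
right-hand side is known. To learn p_i − p_j it suffices to locate this hyperplane around a single
point, precisely in all directions; as |c_i − c_j| ≥ θ, the length of the normal is then determined
as well.

Detection. A boundary point is good if every third action loses there by a margin that keeps it from
being played within distance √d (c + ε) (`goodSurface`, `response_of_near`). Split the actions into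
I and its complement. Two random points lie in regions of different sides with probability at least
|I| |Iᶜ| ς², and the segment between them crosses one of |I| |Iᶜ| boundaries, either in its good
part or in a strip close to a third region (`exists_mem_crossSet`). Strips are rarely crossed:
boundaries are transversal to each other, since otherwise one of three regions would be squeezed
into a slab too thin for its volume (`IsInstance.strip_transversal`). As the probability of crossing
a surface is at most a constant times its area (`lineLaw_crossSet_le_area`), some boundary between
the two sides has a good part of relative area at least (ς²/(3d))^d
(`IsInstance.exists_goodSurface_area`). This holds for every split, so the graph of pairs with a
large good surface is connected and has a spanning tree. By independence T lines all miss a given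
surface with probability at most exp(−Tσ), and a union bound over the tree gives the failure
probability.

Recovery. If a line meets the good surface of i and j, binary search finds a short segment around
the meeting point, and the regular simplex placed there only sees the responses i and j
(`exists_located`). For every feasible tuple the hyperplane of i and j has the same constant term,
separates the same vertices and crosses the same short pieces of the edges. Hence the two affine
functions have almost proportional values at the vertices. The vertices form a tight frame, so the
normals are almost proportional, and the common constant term, bounded away from 0, forces the
factor to be close to 1 (`norm_sub_le_of_located`). This error is of order d^(3/2) ε/(cθ). For d ≥ 3
it is better than claimed, because ξ^(d−1) ≤ (c/d)² and c is tiny. For d = 2 the claim has the same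
dependence on c with a smaller constant, and a separate plane computation is needed
(`norm_sub_le_of_located_two`). Along a path of the tree at most N − 1 errors add up.

Rounds. The responses on a line form contiguous blocks, so a line yields at most N − 1 segments
(`length_searchAll_le`), and every binary search takes O(log(1/ε)) rounds.

For (b) the simplices are taken so small that τ stays positive, and ε so small that the error linear
in ε/c, summed over a path, is below η; then log(1/ε) is at most 6d² times the logarithm in the
claim. -/

/-- The vector all of whose coordinates are `1`. -/
noncomputable def ones (n : ℕ) : Vec n := WithLp.toLp 2 fun _ => 1

@[simp] lemma ones_apply (n : ℕ) (l : Fin n) : ones n l = 1 := rfl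

lemma inner_eq_sum {n : ℕ} (x y : Vec n) : inner ℝ x y = ∑ l, x l * y l := by
  simp [PiLp.inner_apply, mul_comm]

lemma inner_ones {n : ℕ} (x : Vec n) : inner ℝ (ones n) x = ∑ l, x l := by
  simp [inner_eq_sum]

lemma ones_ne_zero (d : ℕ) : ones (d + 1) ≠ 0 := by
  intro h
  have := congrArg (fun x : Vec (d + 1) => x 0) h
  simp at this

/-- The vectors with coordinate sum zero. -/
noncomputable def sumZero (n : ℕ) : Submodule ℝ (Vec n) := (ℝ ∙ ones n)ᗮ

lemma mem_sumZero {n : ℕ} {x : Vec n} : x ∈ sumZero n ↔ ∑ l, x l = 0 := by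
  rw [sumZero, Submodule.mem_orthogonal_singleton_iff_inner_right, inner_ones]

lemma finrank_sumZero (d : ℕ) : Module.finrank ℝ (sumZero (d + 1)) = d := by
  have : Fact (Module.finrank ℝ (Vec (d + 1)) = d + 1) := ⟨by simp⟩
  exact Submodule.finrank_orthogonal_span_singleton (ones_ne_zero d)

/-- The vectors with coordinate sum zero orthogonal to `v`. -/
noncomputable def sumZeroOrtho {n : ℕ} (v : Vec n) : Submodule ℝ (Vec n) :=
  (Submodule.span ℝ (Set.range ![ones n, v]))ᗮ

lemma mem_sumZeroOrtho {n : ℕ} {v x : Vec n} :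
    x ∈ sumZeroOrtho v ↔ ∑ l, x l = 0 ∧ inner ℝ x v = 0 := by
  rw [sumZeroOrtho, Submodule.mem_orthogonal]
  constructor
  · intro h
    refine ⟨?_, ?_⟩
    · rw [← inner_ones]; exact h _ (Submodule.subset_span ⟨0, rfl⟩)
    · rw [real_inner_comm]; exact h _ (Submodule.subset_span ⟨1, rfl⟩)
  · rintro ⟨h1, h2⟩ u hu
    induction hu using Submodule.span_induction with
    | mem x hx =>
      obtain ⟨i, rfl⟩ := hx
      fin_cases i
      · simpa [inner_ones] using h1
      · simpa [real_inner_comm] using h2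
    | zero => simp
    | add a b _ _ ha hb => rw [inner_add_left, ha, hb, add_zero]
    | smul c a _ ha => rw [inner_smul_left, ha, mul_zero]

lemma finrank_sumZeroOrtho {d : ℕ} {v : Vec (d + 1)} (hv : ∑ l, v l = 0) (hv0 : v ≠ 0) :
    Module.finrank ℝ (sumZeroOrtho v) = d - 1 := by
  have hli : LinearIndependent ℝ ![ones (d + 1), v] := by
    apply linearIndependent_of_ne_zero_of_inner_eq_zero (𝕜 := ℝ)
    · intro i; fin_cases i
      · exact ones_ne_zero d
      · exact hv0
    · intro i j hij
      fin_cases i <;> fin_cases j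
      · simp at hij
      · simpa [inner_ones] using hv
      · change inner ℝ v (ones (d + 1)) = 0
        rw [real_inner_comm, inner_ones, hv]
      · simp at hij
  have h1 := finrank_span_eq_card hli
  have h2 := Submodule.finrank_add_finrank_orthogonal
    (Submodule.span ℝ (Set.range ![ones (d + 1), v]))
  rw [h1] at h2
  simp at h2
  rw [sumZeroOrtho]; omega

lemma isometry_const_add_coe {n : ℕ} (U : Submodule ℝ (Vec n)) (x₀ : Vec n) :
    Isometry fun w : U => x₀ + (w : Vec n) := by
  intro a b
  simp only [edist_add_left]
  rfl

lemma image_const_add_coe {n : ℕ} {U : Submodule ℝ (Vec n)} {x₀ : Vec n} {A : Set (Vec n)}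
    (hA : ∀ x ∈ A, x - x₀ ∈ U) :
    (fun w : U => x₀ + (w : Vec n)) '' ((fun w : U => x₀ + (w : Vec n)) ⁻¹' A) = A := by
  rw [Set.image_preimage_eq_iff]
  intro x hx
  exact ⟨⟨x - x₀, hA x hx⟩, by simp⟩

lemma volume_lt_top_of_isBounded {n k : ℕ} {U : Submodule ℝ (Vec n)}
    (hU : Module.finrank ℝ U = k) {x₀ : Vec n} {A : Set (Vec n)} (hA : ∀ x ∈ A, x - x₀ ∈ U)
    (hb : Bornology.IsBounded A) : μHE[k] A < ∞ := by
  rw [← image_const_add_coe hA, (isometry_const_add_coe U x₀).euclideanHausdorffMeasure_image]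
  subst hU
  apply Bornology.IsBounded.measure_lt_top
  exact (isometry_const_add_coe U x₀).antilipschitz.isBounded_preimage hb

/-- The center of the simplex. -/
noncomputable def center (d : ℕ) : Vec (d + 1) := ((d : ℝ) + 1)⁻¹ • ones (d + 1)

@[simp] lemma center_apply (d : ℕ) (l : Fin (d + 1)) : center d l = ((d : ℝ) + 1)⁻¹ := by
  simp [center]

lemma sum_center (d : ℕ) : ∑ l, center d l = 1 := by
  simp; field_simp

lemma inner_center {d : ℕ} (v : Vec (d + 1)) :
    inner ℝ (center d) v = ((d : ℝ) + 1)⁻¹ * ∑ l, v l := by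
  simp [center, inner_smul_left, inner_ones]

/-- Fubini's theorem for the `d`-dimensional volume on the hyperplane of the simplex. -/
lemma volume_eq_lintegral_slices {d : ℕ} {A : Set (Vec (d + 1))}
    (hA : MeasurableSet A) (hA1 : ∀ x ∈ A, ∑ l, x l = 1) {v : Vec (d + 1)} (hv : ∑ l, v l = 0)
    (hv1 : ‖v‖ = 1) :
    μHE[d] A = ∫⁻ s : ℝ, μHE[d - 1] (A ∩ {x | inner ℝ x v = s}) := by
  have hmem : ∀ x ∈ A, x - center d ∈ sumZero (d + 1) := by
    intro x hx
    rw [mem_sumZero]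
    have := hA1 x hx
    have h2 := sum_center d
    simp only [PiLp.sub_apply, Finset.sum_sub_distrib, this, h2, sub_self]
  -- The center is orthogonal to `v`, so translation by it turns the slices of the linear space at
  -- level `s` into the slices of the affine hyperplane at the same level.
  let ι : sumZero (d + 1) → Vec (d + 1) := fun w => center d + (w : Vec (d + 1))
  have hι : Isometry ι := isometry_const_add_coe _ _
  let w : sumZero (d + 1) := ⟨v, mem_sumZero.2 hv⟩
  have hw : w ≠ 0 := by
    intro h
    have : v = 0 := congrArg Subtype.val h
    simp [this] at hv1
  have key := EuclideanGeometry.euclideanHausdorffMeasure_eq_lintegral (P := sumZero (d + 1))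
    (V := sumZero (d + 1)) 0 hw (t := ι ⁻¹' A) (hι.continuous.measurable hA)
  rw [finrank_sumZero] at key
  have hwn : ‖w‖ₑ = 1 := by
    rw [← ofReal_norm]
    have : ‖w‖ = 1 := hv1
    simp [this]
  rw [hwn, one_mul] at key
  rw [← image_const_add_coe hmem, hι.euclideanHausdorffMeasure_image]
  rw [key]
  congr 1 with s
  rw [image_const_add_coe hmem]
  rw [← hι.euclideanHausdorffMeasure_image]
  congr 1
  ext x
  simp only [Set.mem_image, Set.mem_inter_iff, Set.mem_preimage, SetLike.mem_coe,
    AffineSubspace.mem_mk', Set.mem_ofPred_eq]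
  have hvv : inner ℝ v v = (1 : ℝ) := by rw [real_inner_self_eq_norm_sq, hv1]; norm_num
  have hcv : inner ℝ (center d) v = (0 : ℝ) := by rw [inner_center, hv, mul_zero]
  constructor
  · rintro ⟨u, ⟨huA, hu⟩, rfl⟩
    refine ⟨huA, ?_⟩
    rw [Submodule.mem_orthogonal_singleton_iff_inner_left] at hu
    have hu' : inner ℝ ((u : Vec (d + 1)) - (s • v + 0)) v = (0 : ℝ) := hu
    rw [add_zero, inner_sub_left, inner_smul_left, hvv] at hu'
    simp only [ι]
    rw [inner_add_left, hcv]
    simp at hu'; linarith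
  · rintro ⟨hxA, hx⟩
    refine ⟨⟨x - center d, hmem x hxA⟩, ⟨by simpa [ι] using hxA, ?_⟩, by simp [ι]⟩
    rw [Submodule.mem_orthogonal_singleton_iff_inner_left]
    change inner ℝ ((x - center d) - (s • v + 0)) v = (0 : ℝ)
    rw [add_zero, inner_sub_left, inner_sub_left, inner_smul_left, hvv, hcv, hx]
    simp

end SimplexSearch

/-! ### Volume of the probability simplex and of its subsets. -/

namespace SimplexSearch

lemma convex_probSimplex (n : ℕ) : Convex ℝ (probSimplex n) := by
  intro x hx y hy a b ha hb hab
  refine ⟨fun l => ?_, ?_⟩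
  · have := hx.1 l; have := hy.1 l
    simp only [PiLp.add_apply, PiLp.smul_apply, smul_eq_mul]; positivity
  · simp only [PiLp.add_apply, PiLp.smul_apply, smul_eq_mul, Finset.sum_add_distrib,
      ← Finset.mul_sum, hx.2, hy.2]
    linarith

lemma isClosed_probSimplex (n : ℕ) : IsClosed (probSimplex n) := by
  have : probSimplex n = (⋂ l, {x : Vec n | 0 ≤ x l}) ∩ {x | ∑ l, x l = 1} := by
    ext x; simp [probSimplex]
  rw [this]
  refine (isClosed_iInter fun l => isClosed_le continuous_const (by fun_prop)).inter
    (isClosed_eq (by fun_prop) continuous_const)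

lemma le_one_of_mem_probSimplex {n : ℕ} {x : Vec n} (hx : x ∈ probSimplex n) (l : Fin n) :
    x l ≤ 1 := by
  rw [← hx.2]
  exact Finset.single_le_sum (f := fun l => x l) (fun l _ => hx.1 l) (Finset.mem_univ l)

lemma norm_sq_eq_sum {n : ℕ} (x : Vec n) : ‖x‖ ^ 2 = ∑ l, x l ^ 2 := by
  rw [← real_inner_self_eq_norm_sq, inner_eq_sum]; simp [pow_two]

lemma norm_le_one_of_mem_probSimplex {n : ℕ} {x : Vec n} (hx : x ∈ probSimplex n) : ‖x‖ ≤ 1 := by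
  have h : ‖x‖ ^ 2 ≤ 1 := by
    rw [norm_sq_eq_sum, ← hx.2]
    refine Finset.sum_le_sum fun l _ => ?_
    have := hx.1 l; have := le_one_of_mem_probSimplex hx l
    nlinarith
  nlinarith [norm_nonneg x]

lemma inner_nonneg_of_mem_probSimplex {n : ℕ} {x y : Vec n} (hx : x ∈ probSimplex n)
    (hy : y ∈ probSimplex n) : 0 ≤ (inner ℝ x y : ℝ) := by
  rw [inner_eq_sum]
  exact Finset.sum_nonneg fun l _ => mul_nonneg (hx.1 l) (hy.1 l)

lemma norm_sub_le_sqrt_two {n : ℕ} {x y : Vec n} (hx : x ∈ probSimplex n)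
    (hy : y ∈ probSimplex n) : ‖x - y‖ ≤ √2 := by
  apply Real.le_sqrt_of_sq_le
  rw [norm_sub_sq_real]
  have h1 := norm_le_one_of_mem_probSimplex hx
  have h2 := norm_le_one_of_mem_probSimplex hy
  have h3 := inner_nonneg_of_mem_probSimplex hx hy
  nlinarith [norm_nonneg x, norm_nonneg y]

lemma isBounded_probSimplex (n : ℕ) : Bornology.IsBounded (probSimplex n) :=
  (Metric.isBounded_closedBall (x := (0 : Vec n)) (r := 1)).subset fun x hx => by
    simpa using norm_le_one_of_mem_probSimplex hx

lemma abs_apply_le_norm {n : ℕ} (x : Vec n) (l : Fin n) : |x l| ≤ ‖x‖ := by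
  have := PiLp.norm_apply_le x l
  simpa using this

lemma sub_mem_sumZero {d : ℕ} {x y : Vec (d + 1)} (hx : ∑ l, x l = 1) (hy : ∑ l, y l = 1) :
    x - y ∈ sumZero (d + 1) := by
  rw [mem_sumZero]; simp [Finset.sum_sub_distrib, hx, hy]

lemma volume_probSimplex_lt_top (d : ℕ) : μHE[d] (probSimplex (d + 1)) < ∞ :=
  volume_lt_top_of_isBounded (finrank_sumZero d) (x₀ := center d)
    (fun _ hx => sub_mem_sumZero hx.2 (sum_center d)) (isBounded_probSimplex _)

lemma volume_probSimplex_pos (d : ℕ) : 0 < μHE[d] (probSimplex (d + 1)) := by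
  rw [← image_const_add_coe (A := probSimplex (d + 1))
      (fun x hx => sub_mem_sumZero (d := d) hx.2 (sum_center d)),
    (isometry_const_add_coe _ (center d)).euclideanHausdorffMeasure_image]
  have hsub : Metric.ball (0 : sumZero (d + 1)) ((d : ℝ) + 1)⁻¹ ⊆
      (fun w : sumZero (d + 1) => center d + (w : Vec (d + 1))) ⁻¹' probSimplex (d + 1) := by
    intro w hw
    rw [mem_ball_zero_iff] at hw
    refine ⟨fun l => ?_, ?_⟩
    · have h1 := abs_apply_le_norm (w : Vec (d + 1)) l
      have h2 : ‖(w : Vec (d + 1))‖ < ((d : ℝ) + 1)⁻¹ := hw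
      have h3 := neg_abs_le ((w : Vec (d + 1)) l)
      simp only [PiLp.add_apply, center_apply]; linarith
    · have := mem_sumZero.1 w.2
      have h2 := sum_center d
      simp only [PiLp.add_apply, Finset.sum_add_distrib, this, h2, add_zero]
  have hfr := finrank_sumZero d
  have : 0 < (μHE[Module.finrank ℝ (sumZero (d + 1))] : Measure (sumZero (d + 1)))
      (Metric.ball 0 ((d : ℝ) + 1)⁻¹) := Metric.measure_ball_pos _ _ (by positivity)
  rw [hfr] at this
  exact this.trans_le (measure_mono hsub)

/-- The Euclidean normalization, in which Fubini's theorem carries no constant, differs from the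
plain Hausdorff measure by a factor that depends on the dimension `k` only and so cancels in every
ratio. -/
lemma exists_volume_eq_smul (k : ℕ) : ∃ κ : ℝ≥0, κ ≠ 0 ∧ ∀ n,
    ∀ A : Set (Vec n), μHE[k] A = κ * μH[(k : ℝ)] A :=
  ⟨_, Measure.addHaarScalarFactor_volume_hausdorffMeasure_ne_zero k, fun n A => by
    rw [Measure.euclideanHausdorffMeasure_def, Measure.smul_apply, ENNReal.smul_def, smul_eq_mul]⟩

lemma uniformSimplex_apply {d : ℕ} (A : Set (Vec (d + 1))) :
    uniformSimplex d A = μHE[d] (probSimplex (d + 1) ∩ A) / μHE[d] (probSimplex (d + 1)) := by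
  obtain ⟨κ, hκ, h⟩ := exists_volume_eq_smul d
  rw [uniformSimplex, cond_apply (isClosed_probSimplex _).measurableSet, h, h,
    ENNReal.mul_div_mul_left _ _ (by simpa using hκ) (by simp), ENNReal.div_eq_inv_mul]

instance (d : ℕ) : IsProbabilityMeasure (uniformSimplex d) := by
  refine ⟨?_⟩
  rw [uniformSimplex_apply, Set.inter_univ,
    ENNReal.div_self (volume_probSimplex_pos d).ne' (volume_probSimplex_lt_top d).ne]

instance (d : ℕ) : IsProbabilityMeasure (lineLaw d) := by
  unfold lineLaw; infer_instance

lemma surfaceRatio_eq {d : ℕ} (hd : 1 ≤ d) (e : Set (Vec (d + 1))) :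
    surfaceRatio d e = (μHE[d - 1] e / μHE[d - 1] (probSimplex d)).toReal := by
  obtain ⟨κ, hκ, h⟩ := exists_volume_eq_smul (d - 1)
  have hc : (d : ℝ) - 1 = ((d - 1 : ℕ) : ℝ) := by push_cast [hd]; ring
  rw [surfaceRatio, h, h, ENNReal.mul_div_mul_left _ _ (by simpa using hκ) (by simp), hc]

/-- The measure of a subset of the simplex whose intersections with the lines in one direction
are short. -/
lemma volume_le_of_fibers {d : ℕ} (hd : 1 ≤ d) {A : Set (Vec (d + 1))} (hA : MeasurableSet A)
    (hAP : A ⊆ probSimplex (d + 1)) {t : Vec (d + 1)} (ht : ∑ l, t l = 0) (ht1 : ‖t‖ = 1) {w : ℝ}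
    (hw : 0 < w) (hfib : ∀ x ∈ A, ∀ s : ℝ, x + s • t ∈ A → |s| ≤ w) :
    μHE[d] A ≤ ENNReal.ofReal (w * (2 * d * √(d + 1))) * μHE[d] (probSimplex (d + 1)) := by
  have hd0 : (0 : ℝ) < d := by exact_mod_cast hd
  have hd1 : (1 : ℝ) ≤ d := by exact_mod_cast hd
  -- Shrunken copies of `A`, shifted along `t`, are packed disjointly into the simplex. Room for
  -- them comes from the segment from t⁻/S to t⁺/S, which lies in the simplex, is parallel to `t`
  -- and has length 1/S.
  set S : ℝ := ∑ l, max (t l) 0 with hS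
  have hS' : ∑ l, max (-t l) 0 = S := by
    have : ∑ l, (max (t l) 0 - max (-t l) 0) = 0 := by
      rw [← ht]; refine Finset.sum_congr rfl fun l _ => ?_
      rcases le_total 0 (t l) with h | h
      · rw [max_eq_left h, max_eq_right (by linarith)]; ring
      · rw [max_eq_right h, max_eq_left (by linarith)]; ring
    rw [Finset.sum_sub_distrib] at this; linarith
  have h2S : 2 * S = ∑ l, |t l| := by
    have : ∑ l, (max (t l) 0 + max (-t l) 0) = ∑ l, |t l| := by
      refine Finset.sum_congr rfl fun l _ => ?_
      rcases le_total 0 (t l) with h | h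
      · rw [max_eq_left h, max_eq_right (by linarith), abs_of_nonneg h]; ring
      · rw [max_eq_right h, max_eq_left (by linarith), abs_of_nonpos h]; ring
    rw [Finset.sum_add_distrib, hS'] at this; linarith
  have hSle : 2 * S ≤ √(d + 1) := by
    rw [h2S]
    apply Real.le_sqrt_of_sq_le
    have := sq_sum_le_card_mul_sum_sq (s := (Finset.univ : Finset (Fin (d + 1))))
      (f := fun l => |t l|)
    simp only [sq_abs, Finset.card_univ, Fintype.card_fin] at this
    rw [← norm_sq_eq_sum, ht1] at this
    push_cast at this; linarith
  have hSpos : 0 < S := by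
    have h0 : 0 ≤ ∑ l, |t l| := Finset.sum_nonneg fun l _ => abs_nonneg _
    rcases h0.lt_or_eq with h | h
    · linarith
    · exfalso
      have h3 := (Finset.sum_eq_zero_iff_of_nonneg (fun l _ => abs_nonneg (t l))).1 h.symm
      have : t = 0 := by ext l; simpa using h3 l (Finset.mem_univ l)
      simp [this] at ht1
  -- Shrinking by 1 − λ with λ = 1/(2d) costs at most half of the volume and leaves room λ/S for
  -- shifts.
  set lam : ℝ := 1 / (2 * d) with hlam
  have hlam0 : 0 < lam := by positivity
  have hlam1 : lam ≤ 1 / 2 := by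
    rw [hlam]; apply one_div_le_one_div_of_le <;> linarith
  have hpow : 1 / 2 ≤ (1 - lam) ^ d := by
    have := one_add_mul_le_pow (a := -lam) (by linarith) d
    have h2 : (d : ℝ) * -lam = -(1 / 2) := by rw [hlam]; field_simp
    rw [h2] at this
    rw [sub_eq_add_neg]; linarith
  set K : ℕ := ⌊lam / (S * w)⌋₊ with hK
  let tm : Vec (d + 1) := WithLp.toLp 2 fun l => max (-t l) 0 / S
  let pt : ℕ → Vec (d + 1) := fun k => tm + (k * w / lam) • t
  have hpt : ∀ k ≤ K, pt k ∈ probSimplex (d + 1) := by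
    intro k hk
    have h1 : (k : ℝ) ≤ lam / (S * w) := by
      refine le_trans (by exact_mod_cast hk) (Nat.floor_le (by positivity))
    have h2 : k * w / lam ≤ 1 / S := by
      rw [le_div_iff₀ (by positivity)] at h1
      rw [div_le_div_iff₀ hlam0 hSpos]; linarith
    refine ⟨fun l => ?_, ?_⟩
    · simp only [pt, tm, PiLp.add_apply, PiLp.smul_apply, smul_eq_mul]
      rcases le_total 0 (t l) with h | h
      · positivity
      · rw [max_eq_left (by linarith)]
        have : -(1 / S) * (-t l) ≤ -(k * w / lam) * (-t l) :=
          mul_le_mul_of_nonneg_right (by linarith) (by linarith)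
        have h3 : -t l / S = 1 / S * -t l := by ring
        rw [h3]; linarith
    · simp only [pt, tm, PiLp.add_apply, PiLp.smul_apply, smul_eq_mul, Finset.sum_add_distrib,
        ← Finset.mul_sum, ht, ← Finset.sum_div, hS', mul_zero, add_zero]
      exact div_self hSpos.ne'
  -- `B k` is the set (1 − λ) A + λ `pt k`. Consecutive copies are shifted by `w`, whereas their
  -- fibers have length at most (1 − λ) `w`; this makes them disjoint.
  let B : ℕ → Set (Vec (d + 1)) := fun k => AffineMap.homothety (pt k) (1 - lam)⁻¹ ⁻¹' A
  have h1lam : 0 < 1 - lam := by linarith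
  have hBmeas : ∀ k, MeasurableSet (B k) := fun k =>
    (AffineMap.homothety_continuous (pt k) (1 - lam)⁻¹).measurable hA
  have hBvol : ∀ k, μHE[d] (B k) = ENNReal.ofReal ((1 - lam) ^ d) * μHE[d] A := by
    intro k
    rw [euclideanHausdorffMeasure_homothety_preimage d _ (by positivity), ENNReal.smul_def,
      smul_eq_mul]
    congr 1
    rw [nnnorm_inv, inv_inv, ENNReal.ofReal]
    congr 1
    ext
    rw [Real.coe_toNNReal _ (by positivity)]
    simp [abs_of_pos h1lam]
  have hBsub : ∀ k ≤ K, B k ⊆ probSimplex (d + 1) := by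
    intro k hk x hx
    have hx' : AffineMap.homothety (pt k) (1 - lam)⁻¹ x ∈ A := hx
    have h := convex_probSimplex _ (hAP hx') (hpt k hk) h1lam.le hlam0.le (by ring)
    convert h using 1
    simp only [AffineMap.homothety_apply, vsub_eq_sub, vadd_eq_add, smul_add, smul_smul]
    rw [mul_inv_cancel₀ h1lam.ne', one_smul]
    module
  have hBdisj : Set.PairwiseDisjoint (↑(Finset.range (K + 1))) B := by
    intro k _ k' _ hkk'
    rw [Function.onFun, Set.disjoint_left]
    intro x hx hx'
    have h1 : AffineMap.homothety (pt k) (1 - lam)⁻¹ x ∈ A := hx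
    have h2 : AffineMap.homothety (pt k') (1 - lam)⁻¹ x ∈ A := hx'
    have h3 : AffineMap.homothety (pt k') (1 - lam)⁻¹ x =
        AffineMap.homothety (pt k) (1 - lam)⁻¹ x + (((k : ℝ) - k') * w / (1 - lam)) • t := by
      simp only [AffineMap.homothety_apply, vsub_eq_sub, vadd_eq_add, pt]
      ext l
      simp only [PiLp.add_apply, PiLp.smul_apply, PiLp.sub_apply, smul_eq_mul]
      field_simp
      ring
    rw [h3] at h2
    have h4 := hfib _ h1 _ h2
    rw [abs_div, abs_mul, abs_of_pos hw, abs_of_pos h1lam, div_le_iff₀ h1lam] at h4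
    have h5 : (1 : ℝ) ≤ |(k : ℝ) - k'| := by
      have : (1 : ℤ) ≤ |(k : ℤ) - k'| := Int.one_le_abs (by omega)
      exact_mod_cast this
    nlinarith
  have hsum : (K + 1 : ℕ) * (ENNReal.ofReal ((1 - lam) ^ d) * μHE[d] A) ≤
      μHE[d] (probSimplex (d + 1)) := by
    calc (K + 1 : ℕ) * (ENNReal.ofReal ((1 - lam) ^ d) * μHE[d] A)
        = ∑ k ∈ Finset.range (K + 1), μHE[d] (B k) := by
          simp only [hBvol, Finset.sum_const, Finset.card_range, nsmul_eq_mul]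
      _ = μHE[d] (⋃ k ∈ Finset.range (K + 1), B k) :=
          (measure_biUnion_finset hBdisj fun k _ => hBmeas k).symm
      _ ≤ _ := measure_mono (Set.iUnion₂_subset fun k hk =>
          hBsub k (by rw [Finset.mem_range] at hk; omega))
  have hfac : 1 ≤ w * (2 * d * √(d + 1)) * ((K + 1 : ℕ) * (1 - lam) ^ d) := by
    have h1 : lam / (S * w) ≤ (K + 1 : ℕ) := by
      push_cast; exact (Nat.lt_floor_add_one _).le
    calc (1 : ℝ) = w * (2 * d * (2 * S)) * (lam / (S * w) * (1 / 2)) := by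
          rw [hlam]; field_simp
      _ ≤ _ := by gcongr
  calc μHE[d] A = ENNReal.ofReal 1 * μHE[d] A := by simp
    _ ≤ ENNReal.ofReal (w * (2 * d * √(d + 1)) * ((K + 1 : ℕ) * (1 - lam) ^ d)) * μHE[d] A := by
        gcongr
    _ = ENNReal.ofReal (w * (2 * d * √(d + 1))) *
          ((K + 1 : ℕ) * (ENNReal.ofReal ((1 - lam) ^ d) * μHE[d] A)) := by
        rw [ENNReal.ofReal_mul (p := w * (2 * d * √(d + 1))) (by positivity),
          ENNReal.ofReal_mul (p := ((K + 1 : ℕ) : ℝ)) (by positivity), ENNReal.ofReal_natCast]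
        ring
    _ ≤ _ := by gcongr

end SimplexSearch

/-! ### Null level sets, facets and cones. -/

namespace SimplexSearch

lemma measurable_inner_right {n : ℕ} (v : Vec n) : Measurable fun x : Vec n => (inner ℝ x v : ℝ) :=
  (continuous_id.inner continuous_const).measurable

/-- Slicing along `u` itself, the set meets a single slice, and one level is a null set of ℝ. -/
lemma uniformSimplex_level {d : ℕ} {u : Vec (d + 1)} (hu : ∑ l, u l = 0) (hu0 : u ≠ 0) (b : ℝ) :
    uniformSimplex d {x | inner ℝ x u = b} = 0 := by
  rw [uniformSimplex_apply, ENNReal.div_eq_zero_iff]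
  left
  have hn : 0 < ‖u‖ := norm_pos_iff.2 hu0
  set v := ‖u‖⁻¹ • u with hv
  have hv0 : ∑ l, v l = 0 := by
    simp only [hv, PiLp.smul_apply, smul_eq_mul, ← Finset.mul_sum, hu, mul_zero]
  have hv1 : ‖v‖ = 1 := by
    rw [hv, norm_smul, norm_inv, norm_norm, inv_mul_cancel₀ hn.ne']
  have hmeas : MeasurableSet {x : Vec (d + 1) | (inner ℝ x u : ℝ) = b} :=
    measurableSet_eq_fun (measurable_inner_right u) measurable_const
  rw [volume_eq_lintegral_slices ((isClosed_probSimplex _).measurableSet.inter hmeas)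
    (fun x hx => hx.1.2) hv0 hv1, ← lintegral_zero (μ := (volume : Measure ℝ))]
  apply lintegral_congr_ae
  have : ∀ᵐ s : ℝ, s ≠ ‖u‖⁻¹ * b := by simp [ae_iff]
  filter_upwards [this] with s hs
  convert measure_empty (μ := μHE[d - 1])
  ext x
  simp only [Set.mem_inter_iff, Set.mem_ofPred_eq, Set.mem_empty_iff_false, iff_false]
  rintro ⟨⟨_, h1⟩, h2⟩
  rw [hv, inner_smul_right, h1] at h2
  exact hs h2.symm

/-- The embedding of the simplex as the facet of a simplex of one dimension more. -/
noncomputable def facetEmb (n : ℕ) (x : Vec n) : Vec (n + 1) :=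
  WithLp.toLp 2 (Fin.cons 0 x : Fin (n + 1) → ℝ)

@[simp] lemma facetEmb_zero (n : ℕ) (x : Vec n) : facetEmb n x 0 = 0 := rfl
@[simp] lemma facetEmb_succ (n : ℕ) (x : Vec n) (l : Fin n) : facetEmb n x l.succ = x l := rfl

lemma isometry_facetEmb (n : ℕ) : Isometry (facetEmb n) := by
  apply Isometry.of_dist_eq
  intro x y
  simp [EuclideanSpace.dist_eq, Fin.sum_univ_succ]

/-- The volume of a facet is at most a multiple of the volume of the simplex. -/
lemma volume_facet_le {d : ℕ} (hd : 1 ≤ d) :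
    μHE[d - 1] (probSimplex d) ≤ ENNReal.ofReal (4 * d) * μHE[d] (probSimplex (d + 1)) := by
  have hd0 : (0 : ℝ) < d := by exact_mod_cast hd
  have hd1 : (1 : ℝ) ≤ d := by exact_mod_cast hd
  set F := μHE[d - 1] (probSimplex d) with hF
  let a : Vec (d + 1) := EuclideanSpace.single 0 1
  have ha : a ∈ probSimplex (d + 1) := by
    refine ⟨fun l => ?_, ?_⟩
    · by_cases h : l = 0 <;> simp [a, h]
    · simp [a]
  -- `r` is the reciprocal of the distance from the vertex `a` to the center, which makes `v` a unit
  -- vector.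
  set r : ℝ := √((d + 1) / d) with hr
  have hr1 : 1 ≤ r := by
    rw [hr, Real.one_le_sqrt, one_le_div hd0]; linarith
  have hr0 : 0 < r := by linarith
  have hrsq : r ^ 2 = (d + 1) / d := Real.sq_sqrt (by positivity)
  let v : Vec (d + 1) := r • (a - center d)
  have hv : ∑ l, v l = 0 := by
    have h1 := ha.2
    have h2 := sum_center d
    simp only [v, PiLp.smul_apply, PiLp.sub_apply, smul_eq_mul, ← Finset.mul_sum,
      Finset.sum_sub_distrib, h1, h2]
    ring
  have hinner : ∀ x : Vec (d + 1), ∑ l, x l = 1 →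
      inner ℝ x v = r * (x 0 - ((d : ℝ) + 1)⁻¹) := by
    intro x hx
    have : inner ℝ x a = x 0 := by simp [a, EuclideanSpace.inner_single_right]
    simp only [v]
    rw [inner_smul_right, inner_sub_right, this, real_inner_comm, inner_center, hx, mul_one]
  have hv1 : ‖v‖ = 1 := by
    have h1 : ‖a - center d‖ ^ 2 = d / (d + 1) := by
      rw [← real_inner_self_eq_norm_sq, inner_sub_left, inner_sub_right, inner_sub_right]
      have h2 : inner ℝ a a = (1 : ℝ) := by simp [a]
      have h3 : inner ℝ a (center d) = ((d : ℝ) + 1)⁻¹ := by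
        rw [real_inner_comm, inner_center, ha.2, mul_one]
      have h4 : inner ℝ (center d) a = ((d : ℝ) + 1)⁻¹ := by rw [inner_center, ha.2, mul_one]
      have h5 : inner ℝ (center d) (center d) = ((d : ℝ) + 1)⁻¹ := by
        rw [inner_center, sum_center, mul_one]
      rw [h2, h3, h4, h5]; field_simp; ring
    have h2 : ‖v‖ ^ 2 = 1 := by
      simp only [v]
      rw [norm_smul, mul_pow, h1, Real.norm_of_nonneg hr0.le, hrsq]; field_simp
    nlinarith [norm_nonneg v]
  rw [volume_eq_lintegral_slices (isClosed_probSimplex _).measurableSet (fun x hx => hx.2) hv hv1]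
  -- The slice at relative height η contains the facet shrunk by 1 − η towards the vertex `a`. For η
  -- ≤ 1/(2d) Bernoulli's inequality leaves at least half of the facet, and these levels form an
  -- interval of length at least 1/(2d) because `r ≥ 1`.
  set I : Set ℝ := Set.Icc (-(r * ((d : ℝ) + 1)⁻¹)) (-(r * ((d : ℝ) + 1)⁻¹) + r / (2 * d)) with hI
  have hslice : ∀ s ∈ I, ENNReal.ofReal (1 / 2) * F ≤
      μHE[d - 1] (probSimplex (d + 1) ∩ {x | inner ℝ x v = s}) := by
    intro s hs
    set η : ℝ := s / r + ((d : ℝ) + 1)⁻¹ with hη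
    have hη0 : 0 ≤ η := by
      have := hs.1
      rw [hη, ← sub_neg_eq_add, sub_nonneg, le_div_iff₀ hr0]; linarith
    have hη1 : η ≤ 1 / (2 * d) := by
      have := hs.2
      rw [hη, ← sub_neg_eq_add, sub_le_iff_le_add, div_le_iff₀ hr0]
      have h3 : (1 / (2 * (d : ℝ)) + -((d : ℝ) + 1)⁻¹) * r = -(r * ((d : ℝ) + 1)⁻¹) + r / (2 * d) := by
        ring
      linarith
    have hη2 : η ≤ 1 / 2 := hη1.trans (one_div_le_one_div_of_le (by norm_num) (by linarith))
    have hsη : s = r * (η - ((d : ℝ) + 1)⁻¹) := by rw [hη]; field_simp; ring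
    have hsub : AffineMap.homothety a (1 - η) '' (facetEmb d '' probSimplex d) ⊆
        probSimplex (d + 1) ∩ {x | inner ℝ x v = s} := by
      rintro _ ⟨_, ⟨x, hx, rfl⟩, rfl⟩
      have hfx : facetEmb d x ∈ probSimplex (d + 1) := by
        refine ⟨fun l => ?_, ?_⟩
        · refine Fin.cases ?_ (fun l => ?_) l
          · simp
          · simpa using hx.1 l
        · simp [Fin.sum_univ_succ, hx.2]
      have hmem : AffineMap.homothety a (1 - η) (facetEmb d x) ∈ probSimplex (d + 1) := by
        have := convex_probSimplex _ hfx ha (by linarith : (0 : ℝ) ≤ 1 - η) hη0 (by ring)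
        convert this using 1
        simp only [AffineMap.homothety_apply, vsub_eq_sub, vadd_eq_add]
        module
      refine ⟨hmem, ?_⟩
      change inner ℝ _ v = s
      rw [hinner _ hmem.2, hsη]
      congr 2
      simp [AffineMap.homothety_apply, a]
    refine le_trans ?_ (measure_mono hsub)
    rw [euclideanHausdorffMeasure_homothety_image _ _ (by linarith),
      (isometry_facetEmb d).euclideanHausdorffMeasure_image, ENNReal.smul_def, smul_eq_mul]
    gcongr
    rw [ENNReal.ofReal]
    norm_cast
    rw [← NNReal.coe_le_coe, Real.coe_toNNReal _ (by norm_num)]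
    push_cast
    rw [Real.norm_of_nonneg (by linarith)]
    have h1 := one_add_mul_le_pow (a := -η) (by linarith) (d - 1)
    have h2 : ((d - 1 : ℕ) : ℝ) * η ≤ 1 / 2 := by
      calc ((d - 1 : ℕ) : ℝ) * η ≤ d * (1 / (2 * d)) := by
            gcongr; omega
        _ = 1 / 2 := by field_simp
    rw [sub_eq_add_neg]; linarith
  calc F = ENNReal.ofReal (4 * d) * (ENNReal.ofReal (1 / 2) * F * ENNReal.ofReal (1 / (2 * d))) := by
        have : ENNReal.ofReal (4 * d) * (ENNReal.ofReal (1 / 2) * F * ENNReal.ofReal (1 / (2 * d)))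
          = ENNReal.ofReal (4 * d * (1 / 2) * (1 / (2 * d))) * F := by
          rw [ENNReal.ofReal_mul (p := 4 * d * (1 / 2)) (by positivity),
            ENNReal.ofReal_mul (p := 4 * d) (by positivity)]
          ring
        rw [this]
        have h2 : 4 * (d : ℝ) * (1 / 2) * (1 / (2 * d)) = 1 := by field_simp; norm_num
        rw [h2]; simp
    _ ≤ ENNReal.ofReal (4 * d) * ∫⁻ s in I, ENNReal.ofReal (1 / 2) * F := by
        rw [setLIntegral_const, hI, Real.volume_Icc]
        gcongr
        rw [add_sub_cancel_left]
        gcongr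
    _ ≤ ENNReal.ofReal (4 * d) * ∫⁻ s in I, μHE[d - 1] (probSimplex (d + 1) ∩
          {x | inner ℝ x v = s}) := by
        gcongr 1
        exact setLIntegral_mono' measurableSet_Icc hslice
    _ ≤ _ := by
        gcongr 1
        exact setLIntegral_le_lintegral _ _

/-- The point where the line through `y` and `x` crosses the level `b` of `inner · v`. -/
noncomputable def crossing {n : ℕ} (v : Vec n) (b : ℝ) (y x : Vec n) : Vec n :=
  AffineMap.lineMap y x ((b - inner ℝ y v) / (inner ℝ x v - inner ℝ y v))

lemma measurable_crossing {n : ℕ} (v : Vec n) (b : ℝ) :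
    Measurable fun z : Vec n × Vec n => crossing v b z.1 z.2 := by
  unfold crossing
  simp only [AffineMap.lineMap_apply_module']
  have h1 : Measurable fun z : Vec n × Vec n => (inner ℝ z.1 v : ℝ) :=
    (measurable_inner_right v).comp measurable_fst
  have h2 : Measurable fun z : Vec n × Vec n => (inner ℝ z.2 v : ℝ) :=
    (measurable_inner_right v).comp measurable_snd
  exact (((measurable_const.sub h1).div (h2.sub h1)).smul
    (measurable_snd.sub measurable_fst)).add measurable_fst

lemma measurable_crossing_right {n : ℕ} (v : Vec n) (b : ℝ) (y : Vec n) :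
    Measurable fun x : Vec n => crossing v b y x := by
  unfold crossing
  simp only [AffineMap.lineMap_apply_module']
  exact ((measurable_const.div ((measurable_inner_right v).sub_const _)).smul
    (measurable_id.sub_const y)).add_const y

/-- The volume of the part of a cone behind a surface that is no higher than the part in front
of the surface. -/
lemma volume_cone_le {d : ℕ} {v : Vec (d + 1)} (hv : ∑ l, v l = 0) (hv1 : ‖v‖ = 1) {b : ℝ}
    {y : Vec (d + 1)} (hyb : inner ℝ y v ≠ b)
    {e : Set (Vec (d + 1))} (he : MeasurableSet e) :
    μHE[d] {x | x ∈ probSimplex (d + 1) ∧ 1 ≤ (inner ℝ x v - inner ℝ y v) / (b - inner ℝ y v) ∧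
        (inner ℝ x v - inner ℝ y v) / (b - inner ℝ y v) ≤ 2 ∧ crossing v b y x ∈ e} ≤
      ENNReal.ofReal (|b - inner ℝ y v| * 2 ^ (d - 1)) * μHE[d - 1] e := by
  set h := b - inner ℝ y v with hh
  have hh0 : h ≠ 0 := sub_ne_zero.2 hyb.symm
  set X := {x | x ∈ probSimplex (d + 1) ∧ 1 ≤ (inner ℝ x v - inner ℝ y v) / h ∧
        (inner ℝ x v - inner ℝ y v) / h ≤ 2 ∧ crossing v b y x ∈ e} with hX
  have hXm : MeasurableSet X := by
    have h1 : Measurable fun x : Vec (d + 1) => (inner ℝ x v - inner ℝ y v) / h :=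
      ((measurable_inner_right v).sub_const _).div_const _
    have h2 : Measurable fun x : Vec (d + 1) => crossing v b y x :=
      measurable_crossing_right v b y
    have m1 : MeasurableSet {x : Vec (d + 1) | 1 ≤ (inner ℝ x v - inner ℝ y v) / h} :=
      h1 measurableSet_Ici
    have m2 : MeasurableSet {x : Vec (d + 1) | (inner ℝ x v - inner ℝ y v) / h ≤ 2} :=
      h1 measurableSet_Iic
    have m3 : MeasurableSet {x : Vec (d + 1) | crossing v b y x ∈ e} := h2 he
    have m0 : MeasurableSet {x : Vec (d + 1) | x ∈ probSimplex (d + 1)} :=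
      (isClosed_probSimplex _).measurableSet
    exact m0.inter (m1.inter (m2.inter m3))
  rw [volume_eq_lintegral_slices hXm (fun x hx => hx.1.2) hv hv1]
  -- Seen from `y`, the slice at level `s` is part of the image of `e` under the homothety of ratio
  -- `τ`. Since `τ ≤ 2`, the area grows by at most 2^(d−1), and the levels with `τ` in [1, 2] form
  -- an interval of length |h|.
  have hslice : ∀ s, μHE[d - 1] (X ∩ {x | inner ℝ x v = s}) ≤
      Set.indicator (Set.uIcc b (b + h)) (fun _ => ENNReal.ofReal (2 ^ (d - 1)) * μHE[d - 1] e) s := by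
    intro s
    set τ := (s - inner ℝ y v) / h with hτ
    by_cases hs : 1 ≤ τ ∧ τ ≤ 2
    · have hmem : s ∈ Set.uIcc b (b + h) := by
        have hs' : s = b + (τ - 1) * h := by rw [hτ, hh]; field_simp; ring
        rw [Set.mem_uIcc, hs']
        rcases le_total 0 h with h0 | h0
        · left; constructor <;> nlinarith
        · right; constructor <;> nlinarith
      rw [Set.indicator_of_mem hmem]
      have hsub : X ∩ {x | inner ℝ x v = s} ⊆ AffineMap.homothety y τ '' e := by
        rintro x ⟨⟨_, _, _, hx⟩, hxs⟩
        refine ⟨_, hx, ?_⟩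
        have hxs' : inner ℝ x v = s := hxs
        have hne : s - inner ℝ y v ≠ 0 := by
          intro h0; rw [hτ, h0, zero_div] at hs; linarith
        rw [crossing, hxs', AffineMap.homothety_apply, AffineMap.lineMap_apply_module']
        simp only [vsub_eq_sub, vadd_eq_add, add_sub_cancel_right, smul_smul]
        rw [← hh, hτ, div_mul_div_cancel₀ hh0, div_self hne, one_smul, sub_add_cancel]
      refine (measure_mono hsub).trans ?_
      rw [euclideanHausdorffMeasure_homothety_image _ _ (by linarith), ENNReal.smul_def, smul_eq_mul]
      gcongr
      rw [ENNReal.ofReal]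
      norm_cast
      rw [← NNReal.coe_le_coe, Real.coe_toNNReal _ (by positivity)]
      push_cast
      rw [Real.norm_of_nonneg (by linarith)]
      exact pow_le_pow_left₀ (by linarith) hs.2 _
    · have : X ∩ {x | inner ℝ x v = s} = ∅ := by
        ext x
        simp only [Set.mem_inter_iff, Set.mem_ofPred_eq, Set.mem_empty_iff_false, iff_false]
        rintro ⟨⟨_, h1, h2, _⟩, h3⟩
        rw [h3] at h1 h2
        exact hs ⟨h1, h2⟩
      rw [this]; simp
  refine (lintegral_mono hslice).trans ?_
  rw [lintegral_indicator measurableSet_uIcc, setLIntegral_const, Real.volume_interval,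
    add_sub_cancel_left, ENNReal.ofReal_mul (abs_nonneg _)]
  rw [mul_comm, mul_assoc]

end SimplexSearch

/-! ### Advantages of actions and best-response regions. -/

namespace SimplexSearch

variable {d N : ℕ}

/-- The advantage of action `i` over action `j` at a contract. -/
noncomputable def adv (p : Fin N → Vec (d + 1)) (cost : Fin N → ℝ) (i j : Fin N) (x : Vec (d + 1)) :
    ℝ :=
  inner ℝ x (p i - p j) - (cost i - cost j)

lemma adv_swap (p : Fin N → Vec (d + 1)) (cost : Fin N → ℝ) (i j : Fin N) (x : Vec (d + 1)) :
    adv p cost j i x = -adv p cost i j x := by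
  simp only [adv, inner_sub_right]; ring

lemma adv_add (p : Fin N → Vec (d + 1)) (cost : Fin N → ℝ) (i j k : Fin N) (x : Vec (d + 1)) :
    adv p cost i j x + adv p cost j k x = adv p cost i k x := by
  simp only [adv, inner_sub_right]; ring

@[simp] lemma adv_self (p : Fin N → Vec (d + 1)) (cost : Fin N → ℝ) (i : Fin N)
    (x : Vec (d + 1)) : adv p cost i i x = 0 := by
  simp [adv]

lemma adv_lineMap (p : Fin N → Vec (d + 1)) (cost : Fin N → ℝ) (i j : Fin N) (x y : Vec (d + 1))
    (s : ℝ) : adv p cost i j (AffineMap.lineMap x y s) =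
      (1 - s) * adv p cost i j x + s * adv p cost i j y := by
  simp only [adv, AffineMap.lineMap_apply_module, inner_add_left, inner_smul_left]
  simp; ring

lemma adv_sub (p : Fin N → Vec (d + 1)) (cost : Fin N → ℝ) (i j : Fin N) (x y : Vec (d + 1)) :
    adv p cost i j x - adv p cost i j y = inner ℝ (x - y) (p i - p j) := by
  simp only [adv, inner_sub_left]; ring

lemma continuous_adv (p : Fin N → Vec (d + 1)) (cost : Fin N → ℝ) (i j : Fin N) :
    Continuous (adv p cost i j) :=
  (continuous_id.inner continuous_const).sub continuous_const

lemma mem_region_iff {p : Fin N → Vec (d + 1)} {cost : Fin N → ℝ} {i : Fin N} {x : Vec (d + 1)} :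
    x ∈ region p cost i ↔ x ∈ probSimplex (d + 1) ∧ ∀ j, 0 ≤ adv p cost i j x := by
  constructor
  · rintro ⟨h1, h2⟩
    refine ⟨h1, fun j => ?_⟩
    by_cases h : j = i
    · subst h; simp
    · have := h2 j h; simp only [adv]; linarith
  · rintro ⟨h1, h2⟩
    refine ⟨h1, fun j _ => ?_⟩
    have := h2 j; simp only [adv] at this; linarith

lemma IsBestResponse.adv_nonneg {p : Fin N → Vec (d + 1)} {cost : Fin N → ℝ}
    {a : Vec (d + 1) → Fin N} (ha : IsBestResponse p cost a) (x : Vec (d + 1)) (j : Fin N) :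
    0 ≤ adv p cost (a x) j x := by
  have := ha x j; simp only [adv]; linarith

lemma isClosed_region (p : Fin N → Vec (d + 1)) (cost : Fin N → ℝ) (i : Fin N) :
    IsClosed (region p cost i) := by
  have : region p cost i = probSimplex (d + 1) ∩ ⋂ j, {x | 0 ≤ adv p cost i j x} := by
    ext x; simp [mem_region_iff]
  rw [this]
  exact (isClosed_probSimplex _).inter
    (isClosed_iInter fun j => isClosed_le continuous_const (continuous_adv p cost i j))

/-- The fraction of the simplex filled by a region. -/
lemma IsInstance.le_uniformSimplex {ς θ : ℝ} {p : Fin N → Vec (d + 1)} {cost : Fin N → ℝ}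
    (h : IsInstance ς θ p cost) (i : Fin N) :
    ENNReal.ofReal ς ≤ uniformSimplex d (region p cost i) := by
  have h1 := h.volume i
  obtain ⟨κ, hκ, hs⟩ := exists_volume_eq_smul d
  rw [uniformSimplex_apply, ENNReal.le_div_iff_mul_le (Or.inl (volume_probSimplex_pos d).ne')
    (Or.inl (volume_probSimplex_lt_top d).ne), Set.inter_eq_right.2 (fun x hx => hx.1), hs, hs,
    mul_left_comm]
  gcongr

lemma IsInstance.region_nonempty {ς θ : ℝ} {p : Fin N → Vec (d + 1)} {cost : Fin N → ℝ}
    (h : IsInstance ς θ p cost) (hς : 0 < ς) (i : Fin N) : (region p cost i).Nonempty := by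
  by_contra hne
  rw [Set.not_nonempty_iff_eq_empty] at hne
  have := h.le_uniformSimplex i
  rw [hne, measure_empty] at this
  simp at this; linarith

lemma IsInstance.abs_cost_sub {ς θ : ℝ} {p : Fin N → Vec (d + 1)} {cost : Fin N → ℝ}
    (h : IsInstance ς θ p cost) {i j : Fin N} (hij : i ≠ j) : θ ≤ |cost i - cost j| := by
  rcases lt_or_gt_of_ne hij with h1 | h1
  · exact h.gap i j h1
  · rw [abs_sub_comm]; exact h.gap j i h1

lemma IsInstance.sum_sub {ς θ : ℝ} {p : Fin N → Vec (d + 1)} {cost : Fin N → ℝ}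
    (h : IsInstance ς θ p cost) (i j : Fin N) : ∑ l, (p i - p j) l = 0 := by
  simp [Finset.sum_sub_distrib, (h.distribution i).2, (h.distribution j).2]

/-- With equal distributions the cheaper action would win everywhere. Both regions are nonempty, so
the costs would be equal too, against the gap `θ`. -/
lemma IsInstance.sub_ne_zero {ς θ : ℝ} {p : Fin N → Vec (d + 1)} {cost : Fin N → ℝ}
    (h : IsInstance ς θ p cost) (hς : 0 < ς) (hθ : 0 < θ) {i j : Fin N} (hij : i ≠ j) :
    p i - p j ≠ 0 := by
  intro h0
  obtain ⟨x, hx⟩ := h.region_nonempty hς i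
  obtain ⟨y, hy⟩ := h.region_nonempty hς j
  have h1 := (mem_region_iff.1 hx).2 j
  have h2 := (mem_region_iff.1 hy).2 i
  rw [adv_swap] at h2
  simp only [adv, h0, inner_zero_right] at h1 h2
  have h3 := h.abs_cost_sub hij
  have h4 : cost i - cost j = 0 := by linarith
  rw [h4, abs_zero] at h3; linarith

lemma IsInstance.uniformSimplex_adv_eq_zero {ς θ : ℝ} {p : Fin N → Vec (d + 1)}
    {cost : Fin N → ℝ} (h : IsInstance ς θ p cost) (hς : 0 < ς) (hθ : 0 < θ) {i j : Fin N}
    (hij : i ≠ j) : ∀ᵐ x ∂uniformSimplex d, adv p cost i j x ≠ 0 := by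
  have h0 := uniformSimplex_level (h.sum_sub i j) (h.sub_ne_zero hς hθ hij) (cost i - cost j)
  rw [ae_iff]
  convert h0 using 2
  ext x
  simp only [adv, ne_eq, not_not, Set.mem_ofPred_eq, sub_eq_zero]

lemma ae_mem_probSimplex (d : ℕ) : ∀ᵐ x ∂uniformSimplex d, x ∈ probSimplex (d + 1) := by
  rw [ae_iff, uniformSimplex_apply]
  have : probSimplex (d + 1) ∩ {x | x ∉ probSimplex (d + 1)} = ∅ := by
    ext x; simp
  rw [this]; simp

/-- On the simplex a coordinate is, up to a constant, the pairing with a nonzero vector of sum zero,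
so that its zero set is a level set and null. -/
lemma ae_pos (hd : 1 ≤ d) : ∀ᵐ x ∂uniformSimplex d, ∀ l, 0 < x l := by
  rw [ae_all_iff]
  intro l
  have hne : EuclideanSpace.single l (1 : ℝ) - center d ≠ 0 := by
    intro h0
    have h1 := congrArg (fun x : Vec (d + 1) => x l) h0
    have hd0 : (1 : ℝ) ≤ d := by exact_mod_cast hd
    simp only [PiLp.sub_apply, center_apply, PiLp.zero_apply, PiLp.single_apply,
      if_true] at h1
    have h2 : ((d : ℝ) + 1)⁻¹ < 1 := inv_lt_one_of_one_lt₀ (by linarith)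
    linarith
  have h0 := uniformSimplex_level (d := d) (u := EuclideanSpace.single l (1 : ℝ) - center d)
    (by simp [Finset.sum_sub_distrib]; field_simp; simp) hne (-((d : ℝ) + 1)⁻¹)
  have h1 : ∀ᵐ x ∂uniformSimplex d,
      inner ℝ x (EuclideanSpace.single l (1 : ℝ) - center d) ≠ -((d : ℝ) + 1)⁻¹ := by
    rw [ae_iff]; simpa using h0
  filter_upwards [h1, ae_mem_probSimplex d] with x hx hxP
  refine lt_of_le_of_ne (hxP.1 l) fun h2 => hx ?_
  rw [inner_sub_right, EuclideanSpace.inner_single_right, real_inner_comm, inner_center, hxP.2]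
  simp [← h2]

/-- The contracts to which `i` is the unique best response. -/
def strictRegion (p : Fin N → Vec (d + 1)) (cost : Fin N → ℝ) (i : Fin N) : Set (Vec (d + 1)) :=
  {x | x ∈ probSimplex (d + 1) ∧ ∀ j, j ≠ i → 0 < adv p cost i j x}

lemma measurableSet_strictRegion (p : Fin N → Vec (d + 1)) (cost : Fin N → ℝ) (i : Fin N) :
    MeasurableSet (strictRegion p cost i) := by
  have : strictRegion p cost i = probSimplex (d + 1) ∩ ⋂ j, {x | j ≠ i → 0 < adv p cost i j x} := by
    ext x; simp [strictRegion]
  rw [this]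
  refine (isClosed_probSimplex _).measurableSet.inter (MeasurableSet.iInter fun j => ?_)
  by_cases h : j = i
  · simp [h]
  · simp only [ne_eq, h, not_false_eq_true, forall_const]
    exact (isOpen_lt continuous_const (continuous_adv p cost i j)).measurableSet

lemma IsInstance.le_strictRegion {ς θ : ℝ} {p : Fin N → Vec (d + 1)} {cost : Fin N → ℝ}
    (h : IsInstance ς θ p cost) (hς : 0 < ς) (hθ : 0 < θ) (i : Fin N) :
    ENNReal.ofReal ς ≤ uniformSimplex d (strictRegion p cost i) := by
  refine (h.le_uniformSimplex i).trans (measure_mono_ae ?_)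
  have : ∀ᵐ x ∂uniformSimplex d, ∀ j, j ≠ i → adv p cost i j x ≠ 0 := by
    rw [ae_all_iff]; intro j
    by_cases hj : j = i
    · simp [hj]
    · filter_upwards [h.uniformSimplex_adv_eq_zero hς hθ (Ne.symm hj)] with x hx _ using hx
  filter_upwards [this] with x hx hxr
  have hxr' := mem_region_iff.1 hxr
  exact ⟨hxr'.1, fun j hj => lt_of_le_of_ne (hxr'.2 j) (hx j hj).symm⟩

lemma pairwise_disjoint_strictRegion (p : Fin N → Vec (d + 1)) (cost : Fin N → ℝ) :
    Pairwise (Function.onFun Disjoint (strictRegion p cost)) := by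
  intro i j hij
  rw [Function.onFun, Set.disjoint_left]
  intro x hi hj
  have h1 := hi.2 j hij.symm
  have h2 := hj.2 i hij
  rw [adv_swap] at h2; linarith

/-- The strict regions are disjoint and differ from the regions by ties only, which form a null set.
-/
lemma IsInstance.card_mul_le {ς θ : ℝ} {p : Fin N → Vec (d + 1)} {cost : Fin N → ℝ}
    (h : IsInstance ς θ p cost) (hς : 0 < ς) (hθ : 0 < θ) (I : Finset (Fin N)) :
    I.card * ς ≤ (uniformSimplex d).real (⋃ i ∈ I, strictRegion p cost i) := by
  rw [measureReal_biUnion_finset (fun i _ j _ hij => pairwise_disjoint_strictRegion p cost hij)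
    (fun i _ => measurableSet_strictRegion p cost i), ← nsmul_eq_mul, ← Finset.sum_const]
  refine Finset.sum_le_sum fun i _ => ?_
  rw [measureReal_def, ← ENNReal.ofReal_le_iff_le_toReal (measure_ne_top _ _)]
  exact h.le_strictRegion hς hθ i

lemma IsInstance.card_mul_le_one {ς θ : ℝ} {p : Fin N → Vec (d + 1)} {cost : Fin N → ℝ}
    (h : IsInstance ς θ p cost) (hς : 0 < ς) (hθ : 0 < θ) : N * ς ≤ 1 := by
  have h1 := h.card_mul_le hς hθ Finset.univ
  rw [Finset.card_univ, Fintype.card_fin] at h1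
  exact h1.trans measureReal_le_one

/-- A region that lies in a slab cannot be too large. -/
lemma IsInstance.le_of_slab {ς θ : ℝ} {p : Fin N → Vec (d + 1)} {cost : Fin N → ℝ}
    (h : IsInstance ς θ p cost) (hd : 1 ≤ d) (i : Fin N) {n : Vec (d + 1)}
    (hn : ∑ l, n l = 0) (hn1 : ‖n‖ = 1) {s : Vec (d + 1)} {w₁ w₂ : ℝ} (hw : w₁ < w₂)
    (hs : ∀ z ∈ region p cost i, w₁ ≤ inner ℝ (z - s) n ∧ inner ℝ (z - s) n ≤ w₂) :
    ς ≤ (w₂ - w₁) * (2 * d * √(d + 1)) := by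
  -- Fibers in the direction of the normal are no longer than the slab is wide.
  have h1 := volume_le_of_fibers hd (isClosed_region p cost i).measurableSet
    (fun x hx => hx.1) hn hn1 (w := w₂ - w₁) (by linarith) (by
      intro x hx r hxr
      have a1 := hs x hx
      have a2 := hs _ hxr
      have : x + r • n - s = (x - s) + r • n := by abel
      rw [this, inner_add_left, inner_smul_left, real_inner_self_eq_norm_sq, hn1] at a2
      simp at a2
      rw [abs_le]; constructor <;> linarith)
  have h2 := h.le_uniformSimplex i
  rw [uniformSimplex_apply, ENNReal.le_div_iff_mul_le (Or.inl (volume_probSimplex_pos d).ne')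
    (Or.inl (volume_probSimplex_lt_top d).ne), Set.inter_eq_right.2 (fun x hx => hx.1)] at h2
  have h3 := (ENNReal.mul_le_mul_iff_left (volume_probSimplex_pos d).ne'
    (volume_probSimplex_lt_top d).ne).1 (h2.trans h1)
  exact (ENNReal.ofReal_le_ofReal_iff (mul_nonneg (by linarith) (by positivity))).1 h3

end SimplexSearch

/-! ### Probability that a random segment crosses a surface. -/

namespace SimplexSearch

variable {d N : ℕ}

lemma crossing_smul {n : ℕ} (v : Vec n) (b : ℝ) {r : ℝ} (hr : r ≠ 0) (y x : Vec n) :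
    crossing (r • v) (r * b) y x = crossing v b y x := by
  simp only [crossing, inner_smul_right, ← mul_sub]
  rw [mul_div_mul_left _ _ hr]

lemma crossing_swap {n : ℕ} (v : Vec n) (b : ℝ) {y x : Vec n}
    (h : (inner ℝ x v : ℝ) ≠ inner ℝ y v) : crossing v b x y = crossing v b y x := by
  have h1 : (inner ℝ x v - inner ℝ y v : ℝ) ≠ 0 := sub_ne_zero.2 h
  have h2 : (inner ℝ y v - inner ℝ x v : ℝ) ≠ 0 := sub_ne_zero.2 h.symm
  rw [crossing, crossing, ← AffineMap.lineMap_apply_one_sub]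
  congr 1
  field_simp
  ring

/-- The pairs of points on different sides of the level `b` of `inner · v`, joined by a segment
that meets that level in `S`. -/
def crossSet {n : ℕ} (v : Vec n) (b : ℝ) (S : Set (Vec n)) : Set (Vec n × Vec n) :=
  {z | (inner ℝ z.1 v - b) * (inner ℝ z.2 v - b) < 0 ∧ crossing v b z.1 z.2 ∈ S}

lemma measurableSet_crossSet {n : ℕ} (v : Vec n) (b : ℝ) {S : Set (Vec n)}
    (hS : MeasurableSet S) : MeasurableSet (crossSet v b S) := by
  have h1 : Measurable fun z : Vec n × Vec n => (inner ℝ z.1 v : ℝ) :=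
    (measurable_inner_right v).comp measurable_fst
  have h2 : Measurable fun z : Vec n × Vec n => (inner ℝ z.2 v : ℝ) :=
    (measurable_inner_right v).comp measurable_snd
  have m1 : MeasurableSet {z : Vec n × Vec n | (inner ℝ z.1 v - b) * (inner ℝ z.2 v - b) < 0} :=
    ((h1.sub_const b).mul (h2.sub_const b)) measurableSet_Iio
  have m2 : MeasurableSet {z : Vec n × Vec n | crossing v b z.1 z.2 ∈ S} :=
    measurable_crossing v b hS
  exact m1.inter m2

/-- To bound the probability of a crossing it suffices to fix the endpoint further away from the
surface. -/
lemma lineLaw_crossSet_le {v : Vec (d + 1)} {b : ℝ} {S : Set (Vec (d + 1))}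
    (hS : MeasurableSet S) {β : ℝ≥0∞}
    (h : ∀ y ∈ probSimplex (d + 1), uniformSimplex d {x | (inner ℝ y v - b) * (inner ℝ x v - b) < 0 ∧
      |inner ℝ x v - b| ≤ |inner ℝ y v - b| ∧ crossing v b y x ∈ S} ≤ β) :
    lineLaw d (crossSet v b S) ≤ 2 * β := by
  have h1 : Measurable fun z : Vec (d + 1) × Vec (d + 1) => (inner ℝ z.1 v : ℝ) :=
    (measurable_inner_right v).comp measurable_fst
  have h2 : Measurable fun z : Vec (d + 1) × Vec (d + 1) => (inner ℝ z.2 v : ℝ) :=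
    (measurable_inner_right v).comp measurable_snd
  -- Pairs whose first point is the one further from the level. Exchanging the two points preserves
  -- the law, hence the factor 2.
  set C : Set (Vec (d + 1) × Vec (d + 1)) :=
    {z | |inner ℝ z.2 v - b| ≤ |inner ℝ z.1 v - b|} ∩ crossSet v b S with hC
  have hCm : MeasurableSet C := by
    refine MeasurableSet.inter ?_ (measurableSet_crossSet v b hS)
    exact measurableSet_le (h2.sub_const b).norm (h1.sub_const b).norm
  have hCβ : lineLaw d C ≤ β := by
    rw [lineLaw, Measure.prod_apply hCm]
    calc ∫⁻ y, uniformSimplex d (Prod.mk y ⁻¹' C) ∂uniformSimplex d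
        ≤ ∫⁻ _, β ∂uniformSimplex d := by
          refine lintegral_mono_ae ?_
          filter_upwards [ae_mem_probSimplex d] with y hy
          refine le_trans (measure_mono ?_) (h y hy)
          rintro x ⟨hx1, hx2, hx3⟩
          exact ⟨hx2, hx1, hx3⟩
      _ = β := by simp
  have hsub : crossSet v b S ⊆ C ∪ Prod.swap ⁻¹' C := by
    rintro ⟨x, y⟩ ⟨hz1, hz2⟩
    simp only at hz1 hz2
    rcases le_total |inner ℝ y v - b| |inner ℝ x v - b| with hle | hle
    · exact Or.inl ⟨hle, hz1, hz2⟩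
    · refine Or.inr ⟨hle, ?_, ?_⟩
      · simpa [mul_comm] using hz1
      · simp only [Prod.fst_swap, Prod.snd_swap]
        rw [crossing_swap]
        · exact hz2
        · intro h0; rw [h0] at hz1; nlinarith [mul_self_nonneg (inner ℝ x v - b), hz1]
  calc lineLaw d (crossSet v b S) ≤ lineLaw d C + lineLaw d (Prod.swap ⁻¹' C) :=
        (measure_mono hsub).trans (measure_union_le _ _)
    _ = lineLaw d C + lineLaw d C := by
        congr 1
        exact (Measure.measurePreserving_swap (μ := uniformSimplex d)
          (ν := uniformSimplex d)).measure_preimage hCm.nullMeasurableSet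
    _ ≤ 2 * β := by rw [two_mul]; gcongr

/-- The quotient is 1 plus the ratio of the distances of `x` and `y` from the level, and `x` is the
nearer point. -/
lemma crossing_quotient {y x : Vec (d + 1)} {v : Vec (d + 1)} {b : ℝ}
    (h1 : (inner ℝ y v - b) * (inner ℝ x v - b) < 0)
    (h2 : |inner ℝ x v - b| ≤ |inner ℝ y v - b|) :
    1 ≤ (inner ℝ x v - inner ℝ y v) / (b - inner ℝ y v) ∧
      (inner ℝ x v - inner ℝ y v) / (b - inner ℝ y v) ≤ 2 := by
  rcases mul_neg_iff.1 h1 with ⟨h3, h4⟩ | ⟨h3, h4⟩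
  · rw [abs_of_neg h4, abs_of_pos h3] at h2
    rw [← neg_div_neg_eq, le_div_iff₀ (by linarith), div_le_iff₀ (by linarith)]
    constructor <;> linarith
  · rw [abs_of_pos h4, abs_of_neg h3] at h2
    rw [le_div_iff₀ (by linarith), div_le_iff₀ (by linarith)]
    constructor <;> linarith

lemma inner_crossing {n : ℕ} {v : Vec n} {b : ℝ} {y x : Vec n}
    (h : (inner ℝ x v : ℝ) ≠ inner ℝ y v) : inner ℝ (crossing v b y x) v = b := by
  have h1 : (inner ℝ x v - inner ℝ y v : ℝ) ≠ 0 := sub_ne_zero.2 h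
  rw [crossing, AffineMap.lineMap_apply_module', inner_add_left, inner_smul_left, inner_sub_left]
  simp only [conj_trivial]
  field_simp
  ring

/-- The probability that a random segment crosses a surface is bounded in terms of the area. -/
lemma lineLaw_crossSet_le_area (hd : 1 ≤ d) {v : Vec (d + 1)} (hv : ∑ l, v l = 0) (hv0 : v ≠ 0)
    {b : ℝ} {e : Set (Vec (d + 1))} (he : MeasurableSet e) (heP : e ⊆ probSimplex (d + 1)) :
    lineLaw d (crossSet v b e) ≤
      ENNReal.ofReal (6 * d * 2 ^ d) * (μHE[d - 1] e / μHE[d - 1] (probSimplex d)) := by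
  have hn : 0 < ‖v‖ := norm_pos_iff.2 hv0
  set u := ‖v‖⁻¹ • v with hu
  have hu0 : ∑ l, u l = 0 := by
    simp only [hu, PiLp.smul_apply, smul_eq_mul, ← Finset.mul_sum, hv, mul_zero]
  have hu1 : ‖u‖ = 1 := by
    rw [hu, norm_smul, norm_inv, norm_norm, inv_mul_cancel₀ hn.ne']
  have hF0 : μHE[d - 1] (probSimplex d) ≠ 0 := by
    obtain ⟨k, rfl⟩ : ∃ k, d = k + 1 := ⟨d - 1, by omega⟩
    exact (volume_probSimplex_pos k).ne'
  have hFt : μHE[d - 1] (probSimplex d) ≠ ∞ := by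
    obtain ⟨k, rfl⟩ : ∃ k, d = k + 1 := ⟨d - 1, by omega⟩
    exact (volume_probSimplex_lt_top k).ne
  have hP0 := (volume_probSimplex_pos d).ne'
  have hPt := (volume_probSimplex_lt_top d).ne
  have hd0 : (0 : ℝ) < d := by exact_mod_cast hd
  refine (lineLaw_crossSet_le he (β := ENNReal.ofReal (3 / 2 * 2 ^ (d - 1)) * μHE[d - 1] e /
    μHE[d] (probSimplex (d + 1))) ?_).trans ?_
  · intro y hy
    rw [← measure_inter_add_sdiff₀ _ (isClosed_probSimplex (d + 1)).measurableSet.nullMeasurableSet]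
    have hz : uniformSimplex d ({x | (inner ℝ y v - b) * (inner ℝ x v - b) < 0 ∧
      |inner ℝ x v - b| ≤ |inner ℝ y v - b| ∧ crossing v b y x ∈ e} \ probSimplex (d + 1)) = 0 :=
      measure_mono_null (fun x hx => hx.2) (ae_iff.1 (ae_mem_probSimplex d))
    rw [hz, add_zero, uniformSimplex_apply]
    gcongr
    rcases Set.eq_empty_or_nonempty (probSimplex (d + 1) ∩
      ({x | (inner ℝ y v - b) * (inner ℝ x v - b) < 0 ∧
        |inner ℝ x v - b| ≤ |inner ℝ y v - b| ∧ crossing v b y x ∈ e} ∩ probSimplex (d + 1)))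
      with h0 | ⟨x₀, _, ⟨h1, h2, h3⟩, _⟩
    · rw [h0]; simp
    have hiu : ∀ x, (inner ℝ x u : ℝ) = ‖v‖⁻¹ * inner ℝ x v := fun x => by
      rw [hu, inner_smul_right]
    have hyb : (inner ℝ y v : ℝ) ≠ b := by
      intro h0; rw [h0, sub_self, zero_mul] at h1; exact lt_irrefl _ h1
    have hxy : (inner ℝ x₀ v : ℝ) ≠ inner ℝ y v := by
      intro h0; rw [h0] at h1; nlinarith [mul_self_nonneg (inner ℝ y v - b), h1]
    have hyu : (inner ℝ y u : ℝ) ≠ ‖v‖⁻¹ * b := by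
      rw [hiu]; intro h0; exact hyb (mul_left_cancel₀ (inv_ne_zero hn.ne') h0)
    -- The height of the cone is at most the diameter √2 of the simplex.
    have hdist : |‖v‖⁻¹ * b - inner ℝ y u| ≤ 3 / 2 := by
      have h4 : ‖v‖⁻¹ * b - inner ℝ y u = inner ℝ (crossing v b y x₀ - y) u := by
        rw [inner_sub_left, hiu (crossing v b y x₀), inner_crossing hxy]
      rw [h4]
      calc |inner ℝ (crossing v b y x₀ - y) u| ≤ ‖crossing v b y x₀ - y‖ * ‖u‖ :=
            abs_real_inner_le_norm _ _
        _ ≤ √2 * 1 := by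
            rw [hu1]; gcongr; exact norm_sub_le_sqrt_two (heP h3) hy
        _ ≤ 3 / 2 := by
            rw [mul_one, Real.sqrt_le_left (by norm_num)]; norm_num
    refine le_trans (measure_mono ?_) ((volume_cone_le hu0 hu1 hyu he).trans ?_)
    · rintro x ⟨_, ⟨k1, k2, k3⟩, hxP⟩
      have hq := crossing_quotient k1 k2
      have hq' : (inner ℝ x u - inner ℝ y u) / (‖v‖⁻¹ * b - inner ℝ y u) =
          (inner ℝ x v - inner ℝ y v) / (b - inner ℝ y v) := by
        rw [hiu, hiu, ← mul_sub, ← mul_sub, mul_div_mul_left _ _ (inv_ne_zero hn.ne')]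
      refine ⟨hxP, ?_, ?_, ?_⟩
      · rw [hq']; exact hq.1
      · rw [hq']; exact hq.2
      · rw [hu, crossing_smul _ _ (inv_ne_zero hn.ne')]; exact k3
    · gcongr
  -- Replacing the volume of the simplex by that of a facet costs 4d, and 2 · (3/2 · 2^(d−1)) · 4d =
  -- 6d 2^d.
  · have h1 := volume_facet_le hd
    set F := μHE[d - 1] (probSimplex d)
    set P := μHE[d] (probSimplex (d + 1))
    set E := μHE[d - 1] e
    rw [← mul_div_assoc, ENNReal.div_le_iff hP0 hPt]
    have h2 : E = E / F * F := (ENNReal.div_mul_cancel hF0 hFt).symm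
    calc 2 * (ENNReal.ofReal (3 / 2 * 2 ^ (d - 1)) * E)
        = 2 * (ENNReal.ofReal (3 / 2 * 2 ^ (d - 1)) * (E / F * F)) := by rw [← h2]
      _ ≤ 2 * (ENNReal.ofReal (3 / 2 * 2 ^ (d - 1)) * (E / F * (ENNReal.ofReal (4 * d) * P))) := by
          gcongr
      _ = ENNReal.ofReal (2 * (3 / 2 * 2 ^ (d - 1)) * (4 * d)) * (E / F) * P := by
          rw [ENNReal.ofReal_mul (p := 2 * (3 / 2 * 2 ^ (d - 1))) (by positivity),
            ENNReal.ofReal_mul (p := 2) (by norm_num)]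
          simp only [ENNReal.ofReal_ofNat]
          ring
      _ = ENNReal.ofReal (6 * d * 2 ^ d) * (E / F) * P := by
          congr 3
          obtain ⟨k, rfl⟩ : ∃ k, d = k + 1 := ⟨d - 1, by omega⟩
          rw [Nat.add_sub_cancel, pow_succ]; ring

/-- The probability that a random segment crosses a level in a thin strip. -/
lemma lineLaw_crossSet_le_strip (hd : 1 ≤ d) {v t u : Vec (d + 1)} {b : ℝ} (ht : ∑ l, t l = 0)
    (ht1 : ‖t‖ = 1) (htv : inner ℝ t v = (0 : ℝ)) {S : Set (Vec (d + 1))} (hS : MeasurableSet S)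
    {w : ℝ} (hw : 0 < w)
    (hSw : ∀ x ∈ S, ∀ y ∈ S, inner ℝ (x - y) u ≤ w * inner ℝ t u) (htu : 0 < (inner ℝ t u : ℝ)) :
    lineLaw d (crossSet v b S) ≤ ENNReal.ofReal (4 * w * (2 * d * √(d + 1))) := by
  have hP0 := (volume_probSimplex_pos d).ne'
  have hPt := (volume_probSimplex_lt_top d).ne
  have key : ∀ y ∈ probSimplex (d + 1),
      uniformSimplex d {x | (inner ℝ y v - b) * (inner ℝ x v - b) < 0 ∧
      |inner ℝ x v - b| ≤ |inner ℝ y v - b| ∧ crossing v b y x ∈ S} ≤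
      ENNReal.ofReal ((2 * w) * (2 * d * √(d + 1))) := by
    intro y _
    rw [uniformSimplex_apply, ENNReal.div_le_iff hP0 hPt]
    have hm : MeasurableSet {x | (inner ℝ y v - b) * (inner ℝ x v - b) < 0 ∧
        |inner ℝ x v - b| ≤ |inner ℝ y v - b| ∧ crossing v b y x ∈ S} := by
      have h1 : Measurable fun x : Vec (d + 1) => (inner ℝ x v : ℝ) := measurable_inner_right v
      have m1 : MeasurableSet {x | (inner ℝ y v - b) * (inner ℝ x v - b) < 0} :=
        ((h1.sub_const b).const_mul _) measurableSet_Iio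
      have m2 : MeasurableSet {x : Vec (d + 1) | |inner ℝ x v - b| ≤ |inner ℝ y v - b|} :=
        (h1.sub_const b).norm measurableSet_Iic
      have m3 : MeasurableSet {x | crossing v b y x ∈ S} := measurable_crossing_right v b y hS
      exact m1.inter (m2.inter m3)
    refine volume_le_of_fibers hd ((isClosed_probSimplex _).measurableSet.inter hm)
      Set.inter_subset_left ht ht1 (by linarith) ?_
    rintro x ⟨_, hx1, hx2, hx3⟩ s ⟨_, _, _, hs3⟩
    have hq := crossing_quotient hx1 hx2
    have hyb : (b - inner ℝ y v : ℝ) ≠ 0 := by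
      intro h0
      have : (inner ℝ y v - b : ℝ) = 0 := by linarith
      rw [this, zero_mul] at hx1; exact lt_irrefl _ hx1
    set τ := (inner ℝ x v - inner ℝ y v) / (b - inner ℝ y v) with hτ
    have hxy : (inner ℝ x v - inner ℝ y v : ℝ) = τ * (b - inner ℝ y v) := by
      rw [hτ, div_mul_cancel₀ _ hyb]
    -- As `t` is parallel to the level, moving `x` by `s • t` leaves `τ` unchanged and moves the
    -- crossing point by `(s / τ) • t`. The width of `S` bounds |s / τ| by `w`, and `τ ≤ 2` gives
    -- fibers of length at most 2w.
    have h4 : crossing v b y (x + s • t) = crossing v b y x + (s / τ) • t := by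
      simp only [crossing, inner_add_left, inner_smul_left, htv, mul_zero, add_zero,
        AffineMap.lineMap_apply_module']
      rw [hxy]
      have : (b - inner ℝ y v) / (τ * (b - inner ℝ y v)) = 1 / τ := by
        have : τ ≠ 0 := by linarith
        field_simp
      rw [this]
      ext l
      simp only [PiLp.add_apply, PiLp.smul_apply, PiLp.sub_apply, smul_eq_mul]
      ring
    rw [h4] at hs3
    have e1 := hSw _ hs3 _ hx3
    have e2 := hSw _ hx3 _ hs3
    rw [add_sub_cancel_left, inner_smul_left] at e1
    rw [sub_add_cancel_left, inner_neg_left, inner_smul_left] at e2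
    simp only [conj_trivial] at e1 e2
    have e3 : s / τ ≤ w := le_of_mul_le_mul_right e1 htu
    have e4 : -(s / τ) ≤ w := le_of_mul_le_mul_right (by linarith) htu
    have hτ0 : 0 < τ := by linarith [hq.1]
    rw [div_le_iff₀ hτ0] at e3
    rw [← neg_div, div_le_iff₀ hτ0] at e4
    rw [abs_le]; constructor <;> nlinarith [hq.2]
  refine (lineLaw_crossSet_le hS key).trans ?_
  rw [show (2 : ℝ≥0∞) = ENNReal.ofReal 2 by simp, ← ENNReal.ofReal_mul (by norm_num)]
  apply ENNReal.ofReal_le_ofReal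
  apply le_of_eq; ring

end SimplexSearch

/-! ### Good surfaces, strips and transversality. -/

namespace SimplexSearch

variable {d N : ℕ}

/-- The part of the common boundary of the regions of `i` and `j`, inside the simplex, that stays
away from all other regions. -/
def goodSurface (p : Fin N → Vec (d + 1)) (cost : Fin N → ℝ) (ρ : ℝ) (i j : Fin N) :
    Set (Vec (d + 1)) :=
  {x | x ∈ probSimplex (d + 1) ∧ (∀ l, 0 < x l) ∧ adv p cost i j x = 0 ∧
    ∀ k, k ≠ i → k ≠ j → ρ * min ‖p i - p k‖ ‖p j - p k‖ < adv p cost i k x}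

/-- The part of the common boundary of the regions of `i` and `j` that is close to the
region of `k`. -/
def strip (p : Fin N → Vec (d + 1)) (cost : Fin N → ℝ) (ρ : ℝ) (i j k : Fin N) :
    Set (Vec (d + 1)) :=
  {x | x ∈ probSimplex (d + 1) ∧ adv p cost i j x = 0 ∧ 0 ≤ adv p cost i k x ∧
    adv p cost i k x ≤ ρ * min ‖p i - p k‖ ‖p j - p k‖}

lemma measurableSet_goodSurface (p : Fin N → Vec (d + 1)) (cost : Fin N → ℝ) (ρ : ℝ)
    (i j : Fin N) : MeasurableSet (goodSurface p cost ρ i j) := by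
  have m0 : MeasurableSet {x : Vec (d + 1) | x ∈ probSimplex (d + 1)} :=
    (isClosed_probSimplex _).measurableSet
  have m1 : MeasurableSet {x : Vec (d + 1) | ∀ l, 0 < x l} := by
    rw [Set.ofPred_forall]
    exact MeasurableSet.iInter fun l =>
      (isOpen_lt continuous_const (by fun_prop : Continuous fun x : Vec (d + 1) => x l)).measurableSet
  have m2 : MeasurableSet {x : Vec (d + 1) | adv p cost i j x = 0} :=
    (isClosed_eq (continuous_adv p cost i j) continuous_const).measurableSet
  have m3 : MeasurableSet {x : Vec (d + 1) |
      ∀ k, k ≠ i → k ≠ j → ρ * min ‖p i - p k‖ ‖p j - p k‖ < adv p cost i k x} := by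
    rw [Set.ofPred_forall]
    refine MeasurableSet.iInter fun k => ?_
    by_cases h1 : k = i
    · simp [h1]
    by_cases h2 : k = j
    · simp [h2]
    simp only [ne_eq, h1, h2, not_false_eq_true, forall_const]
    exact (isOpen_lt continuous_const (continuous_adv p cost i k)).measurableSet
  exact m0.inter (m1.inter (m2.inter m3))

lemma measurableSet_strip (p : Fin N → Vec (d + 1)) (cost : Fin N → ℝ) (ρ : ℝ) (i j k : Fin N) :
    MeasurableSet (strip p cost ρ i j k) := by
  have m0 : MeasurableSet {x : Vec (d + 1) | x ∈ probSimplex (d + 1)} :=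
    (isClosed_probSimplex _).measurableSet
  have m2 : MeasurableSet {x : Vec (d + 1) | adv p cost i j x = 0} :=
    (isClosed_eq (continuous_adv p cost i j) continuous_const).measurableSet
  have m3 : MeasurableSet {x : Vec (d + 1) | 0 ≤ adv p cost i k x} :=
    (isClosed_le continuous_const (continuous_adv p cost i k)).measurableSet
  have m4 : MeasurableSet {x : Vec (d + 1) |
      adv p cost i k x ≤ ρ * min ‖p i - p k‖ ‖p j - p k‖} :=
    (isClosed_le (continuous_adv p cost i k) continuous_const).measurableSet
  exact m0.inter (m2.inter (m3.inter m4))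

lemma convex_goodSurface (p : Fin N → Vec (d + 1)) (cost : Fin N → ℝ) (ρ : ℝ) (i j : Fin N) :
    Convex ℝ (goodSurface p cost ρ i j) := by
  rw [convex_iff_forall_pos]
  intro x hx y hy a b ha hb hab
  have hadv : ∀ k, adv p cost i k (a • x + b • y) =
      a * adv p cost i k x + b * adv p cost i k y := by
    intro k
    have := adv_lineMap p cost i k x y b
    rw [AffineMap.lineMap_apply_module, show 1 - b = a by linarith] at this
    exact this
  refine ⟨convex_probSimplex _ hx.1 hy.1 ha.le hb.le hab, fun l => ?_, ?_, fun k hki hkj => ?_⟩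
  · have h1 := hx.2.1 l
    have h2 := hy.2.1 l
    simp only [PiLp.add_apply, PiLp.smul_apply, smul_eq_mul]; positivity
  · rw [hadv, hx.2.2.1, hy.2.2.1]; ring
  · have h1 := hx.2.2.2 k hki hkj
    have h2 := hy.2.2.2 k hki hkj
    rw [hadv]
    calc ρ * min ‖p i - p k‖ ‖p j - p k‖
        = a * (ρ * min ‖p i - p k‖ ‖p j - p k‖) + b * (ρ * min ‖p i - p k‖ ‖p j - p k‖) := by
          rw [← add_mul, hab, one_mul]
      _ < _ := by gcongr

set_option maxHeartbeats 1000000 in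
/-- The common boundary of two regions is transversal to the other boundaries. -/
lemma IsInstance.strip_transversal {ς θ : ℝ} {p : Fin N → Vec (d + 1)} {cost : Fin N → ℝ}
    (h : IsInstance ς θ p cost) (hd : 1 ≤ d) (hς : 0 < ς) (hς1 : ς ≤ 1) (hθ : 0 < θ) {ρ : ℝ}
    (hρ : 0 < ρ)
    (hρΦ : 2 * (2 * d * √(d + 1)) * ρ ≤ ς) {i j k : Fin N} (hij : i ≠ j) (hki : k ≠ i) (hkj : k ≠ j)
    (hne : (strip p cost ρ i j k).Nonempty) :
    ∃ t : Vec (d + 1), ∑ l, t l = 0 ∧ ‖t‖ = 1 ∧ inner ℝ t (p i - p j) = (0 : ℝ) ∧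
      ς / (4 * (2 * d * √(d + 1))) * min ‖p i - p k‖ ‖p j - p k‖ ≤ inner ℝ t (p i - p k) := by
  set Φ : ℝ := 2 * d * √(d + 1) with hΦ
  have hd1 : (1 : ℝ) ≤ d := by exact_mod_cast hd
  have hΦ2 : 2 ≤ Φ := by
    have h1 : 1 ≤ √((d : ℝ) + 1) := by rw [Real.one_le_sqrt]; linarith
    rw [hΦ]; nlinarith
  have hΦ8 : 8 ≤ Φ ^ 2 := by
    rw [hΦ, mul_pow, Real.sq_sqrt (by linarith)]; nlinarith
  obtain ⟨s, hsP, hs0, hsk0, hsk⟩ := hne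
  -- This gives ηΦ = ς/4, while ρΦ ≤ ς/2. The slabs found below then have Φ times width at most (1/2
  -- + 3/8)/(9/10) · ς or (10/3)(1/4) · ς, both less than ς.
  set η : ℝ := ς / (4 * Φ) with hη
  set m : ℝ := min ‖p i - p k‖ ‖p j - p k‖ with hm
  have hη0 : 0 < η := by positivity
  have hηΦ : η * Φ = ς / 4 := by rw [hη]; field_simp
  have hηsq : η ^ 2 ≤ 1 / 100 := by
    have : η ^ 2 * Φ ^ 2 ≤ 1 / 16 := by
      rw [← mul_pow, hηΦ]; nlinarith
    nlinarith [sq_nonneg η]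
  have hm0 : 0 < m := lt_min (norm_pos_iff.2 (h.sub_ne_zero hς hθ hki.symm))
    (norm_pos_iff.2 (h.sub_ne_zero hς hθ hkj.symm))
  set v := p i - p j with hv
  set u := p i - p k with hu
  have hv0 : v ≠ 0 := h.sub_ne_zero hς hθ hij
  set G := ‖v‖ with hG
  have hG0 : 0 < G := norm_pos_iff.2 hv0
  set n := G⁻¹ • v with hn
  have hvn : v = G • n := by rw [hn, smul_smul, mul_inv_cancel₀ hG0.ne', one_smul]
  have hn1 : ‖n‖ = 1 := by
    rw [hn, norm_smul, norm_inv, norm_norm, inv_mul_cancel₀ hG0.ne']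
  have hnn : (inner ℝ n n : ℝ) = 1 := by rw [real_inner_self_eq_norm_sq, hn1]; norm_num
  have hnsum : ∑ l, n l = 0 := by
    simp only [hn, PiLp.smul_apply, smul_eq_mul, ← Finset.mul_sum, hv, h.sum_sub, mul_zero]
  set A : ℝ := inner ℝ u n with hA
  set r := u - A • n with hr
  have hur : u = A • n + r := by rw [hr]; abel
  have hrn : (inner ℝ r n : ℝ) = 0 := by
    rw [hr, inner_sub_left, inner_smul_left, hnn, ← hA]; simp
  have hnr : (inner ℝ n r : ℝ) = 0 := by rw [real_inner_comm, hrn]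
  have hrsum : ∑ l, r l = 0 := by
    have h1 := h.sum_sub i k
    simp only [hr, PiLp.sub_apply, PiLp.smul_apply, smul_eq_mul, Finset.sum_sub_distrib,
      ← Finset.mul_sum, hnsum, mul_zero, sub_zero]
    exact h1
  have hu2 : ‖u‖ ^ 2 = A ^ 2 + ‖r‖ ^ 2 := by
    rw [hur, norm_add_sq_real, inner_smul_left, hnr, norm_smul, hn1]; simp
  have hjk : p j - p k = (A - G) • n + r := by
    have : p j - p k = u - v := by rw [hu, hv]; abel
    rw [this, hvn, hur]; module
  have hjk2 : ‖p j - p k‖ ^ 2 = (A - G) ^ 2 + ‖r‖ ^ 2 := by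
    rw [hjk, norm_add_sq_real, inner_smul_left, hnr, norm_smul, hn1]; simp
  -- `r` is the part of p_i − p_k tangential to the boundary of `i` and `j`. If it were short, the
  -- normals of all three boundaries near `s` would be almost parallel to `n`, and one of the three
  -- regions would be caught in a thin slab around `s`.
  have main : η * m ≤ ‖r‖ := by
    by_contra hlt
    push Not at hlt
    have hr2 : ‖r‖ ^ 2 ≤ 1 / 100 * m ^ 2 := by
      calc ‖r‖ ^ 2 ≤ (η * m) ^ 2 := by gcongr
        _ = η ^ 2 * m ^ 2 := by ring
        _ ≤ _ := by gcongr
    have hA9 : (9 / 10 * m) ^ 2 ≤ A ^ 2 := by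
      have : m ^ 2 ≤ ‖u‖ ^ 2 := by gcongr; exact min_le_left _ _
      nlinarith
    have hAG9 : (9 / 10 * m) ^ 2 ≤ (A - G) ^ 2 := by
      have : m ^ 2 ≤ ‖p j - p k‖ ^ 2 := by gcongr; exact min_le_right _ _
      nlinarith
    have hm9 : 0 ≤ 9 / 10 * m := by positivity
    have hA9' := sq_le_sq.1 hA9
    have hAG9' := sq_le_sq.1 hAG9
    rw [abs_of_nonneg hm9] at hA9' hAG9'
    have hzr : ∀ z ∈ probSimplex (d + 1), |inner ℝ (z - s) r| ≤ 3 / 2 * (η * m) := by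
      intro z hz
      calc |inner ℝ (z - s) r| ≤ ‖z - s‖ * ‖r‖ := abs_real_inner_le_norm _ _
        _ ≤ √2 * (η * m) := by
            gcongr; exact norm_sub_le_sqrt_two hz hsP
        _ ≤ 3 / 2 * (η * m) := by
            gcongr; rw [Real.sqrt_le_left (by norm_num)]; norm_num
    have hzij : ∀ z, adv p cost i j z = G * inner ℝ (z - s) n := by
      intro z
      have := adv_sub p cost i j z s
      rw [hs0, sub_zero] at this
      rw [this, ← hv, hvn, inner_smul_right]
    have hzik : ∀ z, adv p cost i k z = adv p cost i k s + A * inner ℝ (z - s) n +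
        inner ℝ (z - s) r := by
      intro z
      have := adv_sub p cost i k z s
      rw [← hu, hur, inner_add_right, inner_smul_right] at this
      linarith
    have hzjk : ∀ z, adv p cost j k z = adv p cost i k s + (A - G) * inner ℝ (z - s) n +
        inner ℝ (z - s) r := by
      intro z
      have := adv_add p cost i j k z
      rw [hzij, hzik] at this; linarith
    have hηm : 0 < η * m := by positivity
    -- The normal components of p_i − p_j, p_i − p_k and p_j − p_k are G, A and A − G. The squeezed
    -- region is that of `i` if A ≤ 0, that of `j` if A ≥ G, and that of `k` in between.
    rcases le_or_gt A 0 with hA0 | hA0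
    · have hA1 : 9 / 10 * m ≤ -A := by rwa [abs_of_nonpos hA0] at hA9'
      have := h.le_of_slab hd i hnsum hn1 (s := s) (w₁ := 0) (w₂ := (ρ + 3 / 2 * η) / (9 / 10))
        (by positivity) (by
          intro z hz
          have hz' := mem_region_iff.1 hz
          have h1 := hz'.2 j
          have h2 := hz'.2 k
          have h3 := abs_le.1 (hzr z hz'.1)
          rw [hzij] at h1
          rw [hzik] at h2
          have h4 : 0 ≤ (inner ℝ (z - s) n : ℝ) := nonneg_of_mul_nonneg_right h1 hG0
          refine ⟨h4, ?_⟩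
          rw [le_div_iff₀ (by norm_num)]
          have h5 : (9 / 10 * m) * inner ℝ (z - s) n ≤ -A * inner ℝ (z - s) n := by gcongr
          have h6 : m * (inner ℝ (z - s) n * (9 / 10)) ≤ m * (ρ + 3 / 2 * η) := by linarith
          exact le_of_mul_le_mul_left h6 hm0)
      have h7 : ((ρ + 3 / 2 * η) / (9 / 10) - 0) * Φ = (ρ * Φ + 3 / 2 * (η * Φ)) / (9 / 10) := by
        ring
      rw [h7, hηΦ, le_div_iff₀ (by norm_num)] at this
      nlinarith
    · rcases le_or_gt G A with hAG | hAG
      · have hA1 : 9 / 10 * m ≤ A - G := by rwa [abs_of_nonneg (by linarith)] at hAG9'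
        have := h.le_of_slab hd j hnsum hn1 (s := s) (w₁ := -((ρ + 3 / 2 * η) / (9 / 10))) (w₂ := 0)
          (by simp only [Left.neg_neg_iff]; positivity) (by
            intro z hz
            have hz' := mem_region_iff.1 hz
            have h1 := hz'.2 i
            have h2 := hz'.2 k
            have h3 := abs_le.1 (hzr z hz'.1)
            rw [adv_swap, hzij] at h1
            rw [hzjk] at h2
            have h4 : (inner ℝ (z - s) n : ℝ) ≤ 0 := by
              have : 0 ≤ G * -(inner ℝ (z - s) n : ℝ) := by linarith
              have := nonneg_of_mul_nonneg_right this hG0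
              linarith
            refine ⟨?_, h4⟩
            rw [neg_le, le_div_iff₀ (by norm_num)]
            have h5 : (9 / 10 * m) * -inner ℝ (z - s) n ≤ (A - G) * -inner ℝ (z - s) n := by
              have : 0 ≤ -(inner ℝ (z - s) n : ℝ) := by linarith
              gcongr
            have h6 : m * (-inner ℝ (z - s) n * (9 / 10)) ≤ m * (ρ + 3 / 2 * η) := by linarith
            exact le_of_mul_le_mul_left h6 hm0)
        have h7 : (0 - -((ρ + 3 / 2 * η) / (9 / 10))) * Φ =
            (ρ * Φ + 3 / 2 * (η * Φ)) / (9 / 10) := by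
          ring
        rw [h7, hηΦ, le_div_iff₀ (by norm_num)] at this
        nlinarith
      · have hA1 : 9 / 10 * m ≤ A := by rwa [abs_of_pos hA0] at hA9'
        have hA2 : 9 / 10 * m ≤ G - A := by
          rw [abs_of_neg (by linarith)] at hAG9'; linarith
        have := h.le_of_slab hd k hnsum hn1 (s := s) (w₁ := -(5 / 3 * η)) (w₂ := 5 / 3 * η)
          (by linarith) (by
            intro z hz
            have hz' := mem_region_iff.1 hz
            have h1 := hz'.2 i
            have h2 := hz'.2 j
            have h3 := abs_le.1 (hzr z hz'.1)
            rw [adv_swap, hzik] at h1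
            rw [adv_swap, hzjk] at h2
            constructor
            · by_contra hc
              push Not at hc
              have h5 : (9 / 10 * m) * (5 / 3 * η) < (G - A) * -inner ℝ (z - s) n := by
                calc (9 / 10 * m) * (5 / 3 * η) < (9 / 10 * m) * -inner ℝ (z - s) n := by
                      gcongr; linarith
                  _ ≤ _ := by
                      have : 0 ≤ -(inner ℝ (z - s) n : ℝ) := by linarith
                      gcongr
              linarith
            · by_contra hc
              push Not at hc
              have h5 : (9 / 10 * m) * (5 / 3 * η) < A * inner ℝ (z - s) n := by
                calc (9 / 10 * m) * (5 / 3 * η) < (9 / 10 * m) * inner ℝ (z - s) n := by gcongr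
                  _ ≤ _ := by
                      have : 0 ≤ (inner ℝ (z - s) n : ℝ) := by linarith
                      gcongr
              linarith)
        have h7 : (5 / 3 * η - -(5 / 3 * η)) * Φ = 10 / 3 * (η * Φ) := by ring
        rw [h7, hηΦ] at this
        linarith
  have hr0 : 0 < ‖r‖ := lt_of_lt_of_le (by positivity) main
  have hrr : (inner ℝ r r : ℝ) = ‖r‖ * ‖r‖ := real_inner_self_eq_norm_mul_norm r
  refine ⟨‖r‖⁻¹ • r, ?_, ?_, ?_, ?_⟩
  · simp only [PiLp.smul_apply, smul_eq_mul, ← Finset.mul_sum, hrsum, mul_zero]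
  · rw [norm_smul, norm_inv, norm_norm, inv_mul_cancel₀ hr0.ne']
  · rw [hvn, inner_smul_left, inner_smul_right, hrn]; simp
  · refine main.trans (le_of_eq ?_)
    rw [hur, inner_smul_left, inner_add_right, inner_smul_right, hrn, hrr]
    simp only [conj_trivial]
    field_simp
    ring

end SimplexSearch

/-! ### Every split of the actions has a large good surface. -/

namespace SimplexSearch

variable {d N : ℕ}

/-- A segment from the regions of `I` to the other regions crosses a common boundary. -/
lemma exists_mem_crossSet {p : Fin N → Vec (d + 1)} {cost : Fin N → ℝ} {a : Vec (d + 1) → Fin N}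
    (ha : IsBestResponse p cost a) {ρ : ℝ} {I : Finset (Fin N)} {i₀ j₀ : Fin N} (hi₀ : i₀ ∈ I)
    (hj₀ : j₀ ∉ I) {x y : Vec (d + 1)} (hx : x ∈ strictRegion p cost i₀)
    (hy : y ∈ strictRegion p cost j₀) (hxl : ∀ l, 0 < x l) (hyl : ∀ l, 0 < y l)
    (hxa : ∀ i j, i ≠ j → adv p cost i j x ≠ 0) (hya : ∀ i j, i ≠ j → adv p cost i j y ≠ 0) :
    ∃ i ∈ I, ∃ j ∈ Iᶜ,
      (x, y) ∈ crossSet (p i - p j) (cost i - cost j) (goodSurface p cost ρ i j) ∨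
      ∃ k, k ≠ i ∧ k ≠ j ∧
        (x, y) ∈ crossSet (p i - p j) (cost i - cost j) (strip p cost ρ i j k) := by
  have hstrict : ∀ i z, z ∈ strictRegion p cost i → z ∈ region p cost i := by
    intro i z hz
    refine mem_region_iff.2 ⟨hz.1, fun j => ?_⟩
    by_cases h : j = i
    · subst h; simp
    · exact (hz.2 j h).le
  have hseg : segment ℝ x y ⊆ probSimplex (d + 1) := (convex_probSimplex _).segment_subset hx.1 hy.1
  -- The regions of `I` and the other regions form two closed sets that cover the segment, as every
  -- contract has a best response. By connectedness they share a point of it.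
  have hconn : IsPreconnected (segment ℝ x y) := (convex_segment x y).isPreconnected
  rw [isPreconnected_closed_iff] at hconn
  obtain ⟨s, hsseg, hsI, hsJ⟩ := hconn (⋃ i ∈ I, region p cost i) (⋃ j ∈ Iᶜ, region p cost j)
    (isClosed_biUnion_finset fun i _ => isClosed_region p cost i)
    (isClosed_biUnion_finset fun i _ => isClosed_region p cost i)
    (by
      intro z hz
      have hzr : z ∈ region p cost (a z) := mem_region_iff.2 ⟨hseg hz, ha.adv_nonneg z⟩
      by_cases hI : a z ∈ I
      · exact Or.inl (Set.mem_biUnion hI hzr)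
      · exact Or.inr (Set.mem_biUnion (Finset.mem_compl.2 hI) hzr))
    ⟨x, left_mem_segment ℝ x y, Set.mem_biUnion hi₀ (hstrict _ _ hx)⟩
    ⟨y, right_mem_segment ℝ x y, Set.mem_biUnion (Finset.mem_compl.2 hj₀) (hstrict _ _ hy)⟩
  simp only [Set.mem_iUnion] at hsI hsJ
  obtain ⟨i, hi, hsi⟩ := hsI
  obtain ⟨j, hj, hsj⟩ := hsJ
  have hij : i ≠ j := by
    rintro rfl; exact (Finset.mem_compl.1 hj) hi
  have hsi' := mem_region_iff.1 hsi
  have hsj' := mem_region_iff.1 hsj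
  have hs0 : adv p cost i j s = 0 := by
    have h1 := hsi'.2 j
    have h2 := hsj'.2 i
    rw [adv_swap] at h2; linarith
  rw [segment_eq_image_lineMap] at hsseg
  obtain ⟨τ, ⟨hτ0, hτ1⟩, rfl⟩ := hsseg
  have hx1 := hxa i j hij
  have hy1 := hya i j hij
  have hτeq := hs0
  rw [adv_lineMap] at hτeq
  have hτ0' : 0 < τ := by
    refine lt_of_le_of_ne hτ0 fun h0 => ?_
    rw [← h0] at hτeq; simp at hτeq; exact hx1 hτeq
  have hτ1' : τ < 1 := by
    refine lt_of_le_of_ne hτ1 fun h0 => ?_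
    rw [h0] at hτeq; simp at hτeq; exact hy1 hτeq
  have hprod : adv p cost i j x * adv p cost i j y < 0 := by
    have h1 : (1 - τ) * adv p cost i j x * adv p cost i j y = -(τ * adv p cost i j y ^ 2) := by
      have : (1 - τ) * adv p cost i j x = -(τ * adv p cost i j y) := by linarith
      rw [this]; ring
    have h2 : 0 < adv p cost i j y ^ 2 := by positivity
    have h3 : (1 - τ) * (adv p cost i j x * adv p cost i j y) < 0 := by
      rw [← mul_assoc, h1]; nlinarith
    exact neg_of_mul_neg_right h3 (by linarith)
  have hcross : crossing (p i - p j) (cost i - cost j) x y = AffineMap.lineMap x y τ := by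
    rw [crossing]
    congr 1
    have hne : (inner ℝ y (p i - p j) - inner ℝ x (p i - p j) : ℝ) ≠ 0 := by
      intro h0
      have : adv p cost i j x = adv p cost i j y := by simp only [adv]; linarith
      rw [this] at hprod; nlinarith [mul_self_nonneg (adv p cost i j y)]
    rw [div_eq_iff hne]
    simp only [adv] at hτeq
    linarith
  have hsl : ∀ l, 0 < (AffineMap.lineMap x y τ : Vec (d + 1)) l := by
    intro l
    have h1 := hxl l
    have h2 := hyl l
    have h3 : 0 < 1 - τ := by linarith
    simp only [AffineMap.lineMap_apply_module, PiLp.add_apply, PiLp.smul_apply, smul_eq_mul]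
    positivity
  refine ⟨i, hi, j, hj, ?_⟩
  by_cases hall : ∀ k, k ≠ i → k ≠ j →
      ρ * min ‖p i - p k‖ ‖p j - p k‖ < adv p cost i k (AffineMap.lineMap x y τ)
  · refine Or.inl ⟨hprod, ?_⟩
    rw [hcross]
    exact ⟨hsi'.1, hsl, hs0, hall⟩
  · push Not at hall
    obtain ⟨k, hki, hkj, hk⟩ := hall
    refine Or.inr ⟨k, hki, hkj, hprod, ?_⟩
    rw [hcross]
    exact ⟨hsi'.1, hs0, hsi'.2 k, hk⟩

/-- In the transversal direction the advantage over `k` grows at a rate of at least ς/(4Φ) times the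
minimum in the definition of the strip, where Φ = 2d√(d+1). An advantage of at most ρ times that
minimum thus confines the strip to width 4Φρ/ς. -/
lemma IsInstance.lineLaw_strip_le {ς θ : ℝ} {p : Fin N → Vec (d + 1)} {cost : Fin N → ℝ}
    (h : IsInstance ς θ p cost) (hd : 1 ≤ d) (hς : 0 < ς) (hς1 : ς ≤ 1) (hθ : 0 < θ) {ρ : ℝ}
    (hρ : 0 < ρ) (hρΦ : 2 * (2 * d * √(d + 1)) * ρ ≤ ς) {i j k : Fin N} (hij : i ≠ j)
    (hki : k ≠ i) (hkj : k ≠ j) :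
    (lineLaw d).real (crossSet (p i - p j) (cost i - cost j) (strip p cost ρ i j k)) ≤
      16 * (2 * d * √(d + 1)) ^ 2 * ρ / ς := by
  have hd1 : (1 : ℝ) ≤ d := by exact_mod_cast hd
  rcases Set.eq_empty_or_nonempty (strip p cost ρ i j k) with h0 | hne
  · have : crossSet (p i - p j) (cost i - cost j) (strip p cost ρ i j k) = ∅ := by
      ext z; simp [crossSet, h0]
    rw [this, measureReal_empty]; positivity
  obtain ⟨t, ht, ht1, htv, htu⟩ := h.strip_transversal hd hς hς1 hθ hρ hρΦ hij hki hkj hne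
  set Φ : ℝ := 2 * d * √(d + 1) with hΦ
  have hΦ0 : 0 < Φ := by positivity
  set m : ℝ := min ‖p i - p k‖ ‖p j - p k‖ with hm
  have hm0 : 0 < m := lt_min (norm_pos_iff.2 (h.sub_ne_zero hς hθ hki.symm))
    (norm_pos_iff.2 (h.sub_ne_zero hς hθ hkj.symm))
  have htu0 : 0 < (inner ℝ t (p i - p k) : ℝ) := lt_of_lt_of_le (by positivity) htu
  have h1 := lineLaw_crossSet_le_strip hd (b := cost i - cost j) (u := p i - p k)
    (w := ρ * (4 * Φ / ς)) ht ht1 htv (measurableSet_strip p cost ρ i j k) (by positivity) (by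
      intro x hx y hy
      rw [← adv_sub]
      have e1 := hx.2.2.2
      have e2 := hy.2.2.1
      calc adv p cost i k x - adv p cost i k y ≤ ρ * m := by linarith
        _ = ρ * (4 * Φ / ς) * (ς / (4 * Φ) * m) := by field_simp
        _ ≤ _ := by gcongr) htu0
  rw [measureReal_def]
  refine ENNReal.toReal_le_of_le_ofReal (by positivity) (h1.trans (le_of_eq ?_))
  congr 1
  rw [← hΦ]
  ring

/-- Some boundary between the regions of `I` and the others has a large part away from all other
regions. -/
lemma IsInstance.exists_goodSurface {ς θ : ℝ} {p : Fin N → Vec (d + 1)} {cost : Fin N → ℝ}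
    (h : IsInstance ς θ p cost) (hd : 1 ≤ d) (hς : 0 < ς) (hς1 : ς ≤ 1) (hθ : 0 < θ)
    {a : Vec (d + 1) → Fin N} (ha : IsBestResponse p cost a) {ρ : ℝ}
    (hρ : 0 < ρ) (hρΦ : 2 * (2 * d * √(d + 1)) * ρ ≤ ς) {I : Finset (Fin N)}
    (hI : I.Nonempty) (hIc : Iᶜ.Nonempty) :
    ∃ i ∈ I, ∃ j ∈ Iᶜ, ς ^ 2 - (N - 2) * (16 * (2 * d * √(d + 1)) ^ 2 * ρ / ς) ≤
      (lineLaw d).real (crossSet (p i - p j) (cost i - cost j) (goodSurface p cost ρ i j)) := by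
  set β : ℝ := 16 * (2 * d * √(d + 1)) ^ 2 * ρ / ς with hβ
  by_contra hcon
  push Not at hcon
  set X := ⋃ i ∈ I, strictRegion p cost i with hX
  set Y := ⋃ i ∈ Iᶜ, strictRegion p cost i with hY
  -- Averaging: `X ×ˢ Y` has probability at least |I| |Iᶜ| ς² and is covered up to a null set by the
  -- |I| |Iᶜ| sets `C i j`, so one of them has probability at least ς². Its N − 2 strips are then
  -- subtracted.
  let C : Fin N → Fin N → Set (Vec (d + 1) × Vec (d + 1)) := fun i j =>
    crossSet (p i - p j) (cost i - cost j) (goodSurface p cost ρ i j) ∪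
      ⋃ k ∈ (Finset.univ.erase i).erase j,
        crossSet (p i - p j) (cost i - cost j) (strip p cost ρ i j k)
  have hlow : (I.card * ς) * (Iᶜ.card * ς) ≤ (lineLaw d).real (X ×ˢ Y) := by
    rw [lineLaw, measureReal_prod_prod]
    have h1 := h.card_mul_le hς hθ I
    have h2 := h.card_mul_le hς hθ Iᶜ
    gcongr
  have hae : ∀ᵐ x ∂uniformSimplex d, (∀ l, 0 < x l) ∧ ∀ i j, i ≠ j → adv p cost i j x ≠ 0 := by
    refine (ae_pos hd).and ?_
    rw [ae_all_iff]; intro i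
    rw [ae_all_iff]; intro j
    by_cases hij : i = j
    · simp [hij]
    · filter_upwards [h.uniformSimplex_adv_eq_zero hς hθ hij] with x hx _ using hx
  have hae2 : ∀ᵐ z ∂lineLaw d,
      ((∀ l, 0 < z.1 l) ∧ ∀ i j, i ≠ j → adv p cost i j z.1 ≠ 0) ∧
      ((∀ l, 0 < z.2 l) ∧ ∀ i j, i ≠ j → adv p cost i j z.2 ≠ 0) :=
    (Measure.quasiMeasurePreserving_fst.ae hae).and (Measure.quasiMeasurePreserving_snd.ae hae)
  have hcover : (lineLaw d).real (X ×ˢ Y) ≤ (lineLaw d).real (⋃ i ∈ I, ⋃ j ∈ Iᶜ, C i j) := by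
    refine ENNReal.toReal_mono (measure_ne_top _ _) (measure_mono_ae ?_)
    filter_upwards [hae2] with z hz hzXY
    obtain ⟨hzX, hzY⟩ := hzXY
    simp only [hX, hY, Set.mem_iUnion] at hzX hzY
    obtain ⟨i₀, hi₀, hx⟩ := hzX
    obtain ⟨j₀, hj₀, hy⟩ := hzY
    obtain ⟨i, hi, j, hj, hz'⟩ := exists_mem_crossSet ha (ρ := ρ) hi₀ (Finset.mem_compl.1 hj₀)
      hx hy hz.1.1 hz.2.1 hz.1.2 hz.2.2
    change z ∈ ⋃ i ∈ I, ⋃ j ∈ Iᶜ, C i j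
    simp only [Set.mem_iUnion]
    refine ⟨i, hi, j, hj, ?_⟩
    rcases hz' with hz' | ⟨k, hki, hkj, hz'⟩
    · exact Or.inl hz'
    · refine Or.inr ?_
      simp only [Set.mem_iUnion]
      exact ⟨k, by simp [hki, hkj], hz'⟩
  have hC : ∀ i ∈ I, ∀ j ∈ Iᶜ, (lineLaw d).real (C i j) < ς ^ 2 := by
    intro i hi j hj
    have hij : i ≠ j := by
      rintro rfl; exact (Finset.mem_compl.1 hj) hi
    have hcard : (((Finset.univ.erase i).erase j).card : ℝ) = N - 2 := by
      have h1 : ((Finset.univ.erase i).erase j).card + 2 = N := by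
        have e1 := Finset.card_erase_add_one
          (show j ∈ (Finset.univ : Finset (Fin N)).erase i by simp [hij.symm])
        have e2 := Finset.card_erase_add_one (Finset.mem_univ i)
        simp only [Finset.card_univ, Fintype.card_fin] at e2
        omega
      have : ((((Finset.univ.erase i).erase j).card + 2 : ℕ) : ℝ) = N := by rw [h1]
      push_cast at this; linarith
    calc (lineLaw d).real (C i j)
        ≤ (lineLaw d).real (crossSet (p i - p j) (cost i - cost j) (goodSurface p cost ρ i j)) +
          (lineLaw d).real (⋃ k ∈ (Finset.univ.erase i).erase j,
            crossSet (p i - p j) (cost i - cost j) (strip p cost ρ i j k)) :=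
          measureReal_union_le _ _
      _ ≤ (lineLaw d).real (crossSet (p i - p j) (cost i - cost j) (goodSurface p cost ρ i j)) +
          ∑ k ∈ (Finset.univ.erase i).erase j, (lineLaw d).real (
            crossSet (p i - p j) (cost i - cost j) (strip p cost ρ i j k)) := by
          gcongr; exact measureReal_biUnion_finset_le _ _
      _ ≤ (lineLaw d).real (crossSet (p i - p j) (cost i - cost j) (goodSurface p cost ρ i j)) +
          ∑ k ∈ (Finset.univ.erase i).erase j, β := by
          gcongr with k hk
          simp only [Finset.mem_erase, Finset.mem_univ, and_true] at hk
          exact h.lineLaw_strip_le hd hς hς1 hθ hρ hρΦ hij hk.2 hk.1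
      _ = (lineLaw d).real (crossSet (p i - p j) (cost i - cost j) (goodSurface p cost ρ i j)) +
          (N - 2) * β := by
          rw [Finset.sum_const, nsmul_eq_mul, hcard]
      _ < ς ^ 2 := by linarith [hcon i hi j hj]
  have hup : (lineLaw d).real (⋃ i ∈ I, ⋃ j ∈ Iᶜ, C i j) < I.card * (Iᶜ.card * ς ^ 2) := by
    calc (lineLaw d).real (⋃ i ∈ I, ⋃ j ∈ Iᶜ, C i j)
        ≤ ∑ i ∈ I, (lineLaw d).real (⋃ j ∈ Iᶜ, C i j) := measureReal_biUnion_finset_le _ _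
      _ ≤ ∑ i ∈ I, ∑ j ∈ Iᶜ, (lineLaw d).real (C i j) := by
          gcongr with i hi; exact measureReal_biUnion_finset_le _ _
      _ < ∑ i ∈ I, ∑ j ∈ Iᶜ, ς ^ 2 :=
          Finset.sum_lt_sum_of_nonempty hI fun i hi =>
            Finset.sum_lt_sum_of_nonempty hIc fun j hj => hC i hi j hj
      _ = _ := by simp
  have : (I.card * ς) * (Iᶜ.card * ς) = I.card * (Iᶜ.card * ς ^ 2) := by ring
  linarith

/-- The subtrahend of `tau` is the sum of d²(c + ε) and (4d/ς)(c + ε), and each summand alone stays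
below the leading term. -/
lemma tau_pos_bounds {ς c ε : ℝ} (hd : 2 ≤ d) (hς : 0 < ς) (hc : 0 < c) (hε : 0 < ε)
    (hτ : 0 < tau d ς c ε) :
    d ^ 2 * (c + ε) < (ς ^ 2 / (3 * d)) ^ d ∧ c + ε < (ς ^ 2 / (3 * d)) ^ d * ς / (4 * d) := by
  have hd2 : (2 : ℝ) ≤ d := by exact_mod_cast hd
  have h1 : (d : ℝ) ^ 2 * (1 + 4 / (d * ς)) * (c + ε) = d ^ 2 * (c + ε) + 4 * d / ς * (c + ε) := by
    field_simp
  rw [tau, h1] at hτ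
  have h2 : 0 < (d : ℝ) ^ 2 * (c + ε) := by positivity
  have h3 : 0 < 4 * (d : ℝ) / ς * (c + ε) := by positivity
  refine ⟨by linarith, ?_⟩
  rw [lt_div_iff₀ (by positivity), ← div_lt_iff₀ hς]
  have : (c + ε) * (4 * d) / ς = 4 * (d : ℝ) / ς * (c + ε) := by ring
  linarith

set_option maxHeartbeats 2000000 in
/-- The constants: the trimming takes away only a part of the boundary. -/
lemma trimming_bound {ς c ε : ℝ} (hd : 2 ≤ d) (hς : 0 < ς) (hN : 2 ≤ N) (hNς : N * ς ≤ 1)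
    (hc : 0 < c) (hε : 0 < ε) (hτ : 0 < tau d ς c ε) :
    2 * (2 * d * √(d + 1)) * (√d * (c + ε)) ≤ ς ∧
    6 * d * 2 ^ d * (ς ^ 2 / (3 * d)) ^ d ≤
      ς ^ 2 - (N - 2) * (16 * (2 * d * √(d + 1)) ^ 2 * (√d * (c + ε)) / ς) := by
  have hd2 : (2 : ℝ) ≤ d := by exact_mod_cast hd
  have hd0 : (0 : ℝ) < d := by linarith
  have hN2 : (2 : ℝ) ≤ N := by exact_mod_cast hN
  -- Two disjoint parts of relative volume `ς` fit into the simplex.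
  have hςh : ς ≤ 1 / 2 := by nlinarith
  obtain ⟨hb1, hb2⟩ := tau_pos_bounds hd hς hc hε hτ
  have hδ : 0 < c + ε := by linarith
  have hsd : √(d : ℝ) ≤ (d + 1) / 2 := by
    rw [Real.sqrt_le_left (by linarith)]; nlinarith [sq_nonneg ((d : ℝ) - 1)]
  have hsd1 : √((d : ℝ) + 1) ^ 2 = d + 1 := Real.sq_sqrt (by linarith)
  have hsd2 : √(d : ℝ) ^ 2 = d := Real.sq_sqrt (by linarith)
  obtain ⟨k, rfl⟩ : ∃ k, d = k + 2 := ⟨d - 2, by omega⟩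
  set D : ℝ := ((k + 2 : ℕ) : ℝ) with hD
  set q : ℝ := ς ^ 2 with hq
  have hq0 : 0 < q := by positivity
  have hq4 : q ≤ 1 / 4 := by nlinarith
  have h9 : 9 * D ^ 2 ≤ (3 * D) ^ (k + 2) := by
    calc 9 * D ^ 2 = (3 * D) ^ 2 := by ring
      _ ≤ _ := pow_le_pow_right₀ (by linarith) (by omega)
  have hcub : 2 * (D * (D + 1) ^ 2) ≤ (3 * D) ^ (k + 2) := by
    rcases Nat.eq_zero_or_pos k with h0 | hk
    · subst h0; simp only [hD]; norm_num
    · have h3 : (3 : ℝ) ≤ D := by rw [hD]; exact_mod_cast (by omega : 3 ≤ k + 2)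
      calc 2 * (D * (D + 1) ^ 2) ≤ (3 * D) ^ 3 := by nlinarith
        _ ≤ _ := pow_le_pow_right₀ (by linarith) (by omega)
  have hpos : 0 < (3 * D) ^ (k + 2) := by positivity
  set b : ℝ := (q / (3 * D)) ^ (k + 2) with hb
  have hb0 : 0 < b := by positivity
  have hbeq : b * (3 * D) ^ (k + 2) = q * (q ^ k * q) := by
    rw [hb, div_pow, div_mul_cancel₀ _ hpos.ne']; ring
  have hqk : q ^ k ≤ 1 := pow_le_one₀ hq0.le (by linarith)
  clear_value D b
  constructor
  · have hss : √(D + 1) * √D ≤ 5 / 4 * D := by nlinarith [sq_nonneg (√(D + 1) - √D)]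
    have hbq : b * 36 ≤ q := by
      have h36 : (36 : ℝ) ≤ (3 * D) ^ (k + 2) := by nlinarith
      calc b * 36 ≤ b * (3 * D) ^ (k + 2) := by gcongr
        _ = q * (q ^ k * q) := hbeq
        _ ≤ q * (1 * 1) := by gcongr; linarith
        _ = q := by ring
    calc 2 * (2 * D * √(D + 1)) * (√D * (c + ε)) = 4 * D * (c + ε) * (√(D + 1) * √D) := by ring
      _ ≤ 4 * D * (c + ε) * (5 / 4 * D) := by gcongr
      _ = 5 * (D ^ 2 * (c + ε)) := by ring
      _ ≤ 5 * b := by linarith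
      _ ≤ ς := by nlinarith
  -- The budget ς² is halved: one half for the strips, one for the guaranteed area. For the strips,
  -- N − 2 ≤ 1/ς − 2 and ς(1 − 2ς) ≤ 1/8.
  · have hloss : (N - 2) * (16 * (2 * D * √(D + 1)) ^ 2 * (√D * (c + ε)) / ς) ≤ q / 2 := by
      have hNi : (N : ℝ) - 2 ≤ 1 / ς - 2 := by
        have : (N : ℝ) ≤ 1 / ς := by rwa [le_div_iff₀ hς]
        linarith
      have hz : 0 ≤ 1 / ς - 2 := by linarith
      calc (N - 2) * (16 * (2 * D * √(D + 1)) ^ 2 * (√D * (c + ε)) / ς)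
          ≤ (1 / ς - 2) * (16 * (2 * D * √(D + 1)) ^ 2 * ((D + 1) / 2 * (b * ς / (4 * D))) / ς) := by
            gcongr
        _ = (q * (1 / ς - 2)) * (8 * D * (D + 1) ^ 2 * b) / q := by
            rw [mul_pow, hsd1]; field_simp; ring
        _ ≤ (1 / 8) * (8 * D * (D + 1) ^ 2 * b) / q := by
            gcongr
            have : q * (1 / ς - 2) = ς * (1 - 2 * ς) := by rw [hq]; field_simp
            rw [this]; nlinarith [sq_nonneg (ς - 1 / 4)]
        _ = (D * (D + 1) ^ 2) * b / q := by ring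
        _ ≤ ((3 * D) ^ (k + 2) / 2) * b / q := by gcongr; linarith
        _ = q ^ k * q / 2 := by
            rw [div_eq_iff hq0.ne']; linarith
        _ ≤ 1 * q / 2 := by gcongr
        _ = q / 2 := by ring
    have hmain : 6 * D * 2 ^ (k + 2) * b ≤ q / 2 := by
      have h2q : 2 * (2 * q) ^ (k + 1) ≤ 1 := by
        have : (2 * q) ^ (k + 1) ≤ 2 * q := by
          calc (2 * q) ^ (k + 1) ≤ (2 * q) ^ 1 :=
                pow_le_pow_of_le_one (by positivity) (by linarith) (by omega)
            _ = 2 * q := pow_one _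
        linarith
      have h1 : 2 ^ (k + 2) * b * (9 * D ^ 2) ≤ q := by
        calc 2 ^ (k + 2) * b * (9 * D ^ 2) ≤ 2 ^ (k + 2) * b * (3 * D) ^ (k + 2) := by gcongr
          _ = 2 ^ (k + 2) * (q * (q ^ k * q)) := by rw [mul_assoc, hbeq]
          _ = q * (2 * (2 * q) ^ (k + 1)) := by rw [mul_pow]; ring
          _ ≤ q * 1 := by gcongr
          _ = q := mul_one q
      have h2 : 6 * D * 2 ^ (k + 2) * b * (3 * D) ≤ 2 * q := by nlinarith
      have h3 : 0 ≤ 6 * D * 2 ^ (k + 2) * b := by positivity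
      nlinarith
    linarith

/-- Some boundary between the regions of `I` and the others has a large part away from all other
regions. -/
lemma IsInstance.exists_goodSurface_area {ς θ c ε : ℝ} {p : Fin N → Vec (d + 1)}
    {cost : Fin N → ℝ} (h : IsInstance ς θ p cost) (hd : 2 ≤ d) (hς : 0 < ς) (hς1 : ς ≤ 1)
    (hθ : 0 < θ) {a : Vec (d + 1) → Fin N} (ha : IsBestResponse p cost a) (hc : 0 < c)
    (hε : 0 < ε) (hτ : 0 < tau d ς c ε) {I : Finset (Fin N)}
    (hI : I.Nonempty) (hIc : Iᶜ.Nonempty) :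
    ∃ i ∈ I, ∃ j ∈ Iᶜ, (ς ^ 2 / (3 * d)) ^ d ≤
      surfaceRatio d (goodSurface p cost (√d * (c + ε)) i j) := by
  have hd2 : (2 : ℝ) ≤ d := by exact_mod_cast hd
  have hN : 2 ≤ N := by
    have h1 := Finset.card_pos.2 hI
    have h2 := Finset.card_pos.2 hIc
    have h3 := Finset.card_add_card_compl I
    rw [Fintype.card_fin] at h3; omega
  obtain ⟨hρΦ, hmain⟩ := trimming_bound hd hς hN (h.card_mul_le_one hς hθ) hc hε hτ
  obtain ⟨i, hi, j, hj, hij⟩ := h.exists_goodSurface (by omega) hς hς1 hθ ha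
    (ρ := √d * (c + ε)) (by positivity) hρΦ hI hIc
  have hne : i ≠ j := by
    rintro rfl; exact (Finset.mem_compl.1 hj) hi
  refine ⟨i, hi, j, hj, ?_⟩
  have harea := lineLaw_crossSet_le_area (by omega : 1 ≤ d) (h.sum_sub i j)
    (h.sub_ne_zero hς hθ hne) (b := cost i - cost j)
    (measurableSet_goodSurface p cost (√d * (c + ε)) i j) (fun x hx => hx.1)
  -- `surfaceRatio` is a `toReal`, so the bound survives only for a finite area.
  have hfin : μHE[d - 1] (goodSurface p cost (√d * (c + ε)) i j) < ∞ := by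
    rcases Set.eq_empty_or_nonempty (goodSurface p cost (√d * (c + ε)) i j) with h0 | ⟨x₀, hx₀⟩
    · rw [h0]; simp
    · refine volume_lt_top_of_isBounded
        (finrank_sumZeroOrtho (h.sum_sub i j) (h.sub_ne_zero hς hθ hne)) (x₀ := x₀) ?_
        ((isBounded_probSimplex _).subset fun x hx => hx.1)
      intro x hx
      rw [mem_sumZeroOrtho, ← mem_sumZero, ← adv_sub p cost, hx.2.2.1, hx₀.2.2.1]
      exact ⟨sub_mem_sumZero hx.1.2 hx₀.1.2, sub_zero _⟩
  have hF0 : μHE[d - 1] (probSimplex d) ≠ 0 := by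
    obtain ⟨k, rfl⟩ : ∃ k, d = k + 1 := ⟨d - 1, by omega⟩
    exact (volume_probSimplex_pos k).ne'
  rw [surfaceRatio_eq (by omega)]
  have hr := ENNReal.toReal_mono (ENNReal.mul_ne_top ENNReal.ofReal_ne_top
    (ENNReal.div_lt_top hfin.ne hF0).ne) harea
  rw [ENNReal.toReal_mul, ENNReal.toReal_ofReal (by positivity)] at hr
  have hle := (hmain.trans hij).trans hr
  exact le_of_mul_le_mul_left hle (by positivity)

end SimplexSearch

/-! ### Counting rounds. -/

namespace SimplexSearch

variable {d N : ℕ}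

lemma isCompact_chordParams {z : Vec (d + 1) × Vec (d + 1)} (hz : z.1 ≠ z.2) :
    IsCompact {s : ℝ | AffineMap.lineMap z.1 z.2 s ∈ probSimplex (d + 1)} := by
  have hcont : Continuous fun s : ℝ => (AffineMap.lineMap z.1 z.2 s : Vec (d + 1)) :=
    AffineMap.lineMap_continuous
  refine Metric.isCompact_of_isClosed_isBounded ((isClosed_probSimplex _).preimage hcont) ?_
  have hd : 0 < dist z.1 z.2 := dist_pos.2 hz
  refine (Metric.isBounded_closedBall (x := (0 : ℝ)) (r := (1 + ‖z.1‖) / dist z.1 z.2)).subset ?_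
  intro s hs
  rw [mem_closedBall_zero_iff, le_div_iff₀ hd, ← dist_lineMap_left (𝕜 := ℝ), dist_eq_norm]
  exact (norm_sub_le _ _).trans (add_le_add_left (norm_le_one_of_mem_probSimplex hs) _)

lemma chordStart_mem {z : Vec (d + 1) × Vec (d + 1)} (hz : z.1 ∈ probSimplex (d + 1)) :
    chordStart z ∈ probSimplex (d + 1) := by
  -- For coinciding points the parameter set is unbounded and `sInf` has no meaning, but then the
  -- line map is constant.
  by_cases h : z.1 = z.2
  · rw [chordStart, ← h, AffineMap.lineMap_same_apply]; exact hz
  · exact (isCompact_chordParams h).sInf_mem ⟨0, by simpa using hz⟩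

lemma chordEnd_mem {z : Vec (d + 1) × Vec (d + 1)} (hz : z.1 ∈ probSimplex (d + 1)) :
    chordEnd z ∈ probSimplex (d + 1) := by
  by_cases h : z.1 = z.2
  · rw [chordEnd, ← h, AffineMap.lineMap_same_apply]; exact hz
  · exact (isCompact_chordParams h).sSup_mem ⟨0, by simpa using hz⟩

/-- No two actions are tied at both `x` and `y`. -/
def NoTies (p : Fin N → Vec (d + 1)) (cost : Fin N → ℝ) (x y : Vec (d + 1)) : Prop :=
  ∀ i j, i ≠ j → adv p cost i j x = 0 → adv p cost i j y ≠ 0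

lemma adv_midpoint (p : Fin N → Vec (d + 1)) (cost : Fin N → ℝ) (i j : Fin N)
    (x y : Vec (d + 1)) : adv p cost i j (midpoint ℝ x y) =
      (adv p cost i j x + adv p cost i j y) / 2 := by
  rw [midpoint, adv_lineMap]
  simp only [invOf_eq_inv]; ring

lemma NoTies.left {p : Fin N → Vec (d + 1)} {cost : Fin N → ℝ} {x y : Vec (d + 1)}
    (h : NoTies p cost x y) : NoTies p cost x (midpoint ℝ x y) := by
  intro i j hij hx hm
  rw [adv_midpoint] at hm
  exact h i j hij hx (by linarith)

lemma NoTies.right {p : Fin N → Vec (d + 1)} {cost : Fin N → ℝ} {x y : Vec (d + 1)}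
    (h : NoTies p cost x y) : NoTies p cost (midpoint ℝ x y) y := by
  intro i j hij hm hy
  rw [adv_midpoint] at hm
  exact h i j hij (by linarith) hy

/-- An advantage is affine along the line. If it vanishes at both ends of the chord, it vanishes at
`z.1` between them, also when the chord degenerates to a point. -/
lemma noTies_chord {p : Fin N → Vec (d + 1)} {cost : Fin N → ℝ} {z : Vec (d + 1) × Vec (d + 1)}
    (hz : z.1 ∈ probSimplex (d + 1)) (hadv : ∀ i j, i ≠ j → adv p cost i j z.1 ≠ 0) :
    NoTies p cost (chordStart z) (chordEnd z) := by
  intro i j hij h1 h2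
  by_cases h : z.1 = z.2
  · rw [chordStart, ← h, AffineMap.lineMap_same_apply] at h1
    exact hadv i j hij h1
  · have h0 : (0 : ℝ) ∈ {s : ℝ | AffineMap.lineMap z.1 z.2 s ∈ probSimplex (d + 1)} := by
      simpa using hz
    have hc := isCompact_chordParams h
    have l1 := csInf_le hc.bddBelow h0
    have l2 := le_csSup hc.bddAbove h0
    rw [chordStart, adv_lineMap] at h1
    rw [chordEnd, adv_lineMap] at h2
    set s₁ := sInf {s : ℝ | AffineMap.lineMap z.1 z.2 s ∈ probSimplex (d + 1)}
    set s₂ := sSup {s : ℝ | AffineMap.lineMap z.1 z.2 s ∈ probSimplex (d + 1)}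
    set A := adv p cost i j z.1
    set B := adv p cost i j z.2
    apply hadv i j hij
    change A = 0
    have h3 : (s₂ - s₁) * A = 0 := by linear_combination s₂ * h1 - s₁ * h2
    rcases mul_eq_zero.1 h3 with h4 | h4
    · have : s₁ = 0 := by linarith
      rw [this] at h1; linarith
    · exact h4

open Classical in
/-- The responses on a segment. -/
noncomputable def responses (a : Vec (d + 1) → Fin N) (x y : Vec (d + 1)) : Finset (Fin N) :=
  {k | ∃ s ∈ Set.Icc (0 : ℝ) 1, a (AffineMap.lineMap x y s) = k}

lemma mem_responses {a : Vec (d + 1) → Fin N} {x y : Vec (d + 1)} {k : Fin N} :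
    k ∈ responses a x y ↔ ∃ s ∈ Set.Icc (0 : ℝ) 1, a (AffineMap.lineMap x y s) = k := by
  simp [responses]

lemma left_mem_responses (a : Vec (d + 1) → Fin N) (x y : Vec (d + 1)) :
    a x ∈ responses a x y := mem_responses.2 ⟨0, by simp, by simp⟩

lemma right_mem_responses (a : Vec (d + 1) → Fin N) (x y : Vec (d + 1)) :
    a y ∈ responses a x y := mem_responses.2 ⟨1, by simp, by simp⟩

lemma one_le_card_responses (a : Vec (d + 1) → Fin N) (x y : Vec (d + 1)) :
    1 ≤ (responses a x y).card := Finset.card_pos.2 ⟨_, left_mem_responses a x y⟩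

lemma two_le_card_responses {a : Vec (d + 1) → Fin N} {x y : Vec (d + 1)} (h : a x ≠ a y) :
    2 ≤ (responses a x y).card :=
  Finset.one_lt_card.2 ⟨_, left_mem_responses a x y, _, right_mem_responses a x y, h⟩

lemma lineMap_midpoint_right (x y : Vec (d + 1)) (s : ℝ) :
    AffineMap.lineMap x (midpoint ℝ x y) s = (AffineMap.lineMap x y (s / 2) : Vec (d + 1)) := by
  simp only [midpoint, AffineMap.lineMap_apply_module', invOf_eq_inv, add_sub_cancel_right,
    smul_smul]
  rw [div_eq_mul_inv]

lemma lineMap_midpoint_left (x y : Vec (d + 1)) (s : ℝ) :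
    AffineMap.lineMap (midpoint ℝ x y) y s =
      (AffineMap.lineMap x y ((1 + s) / 2) : Vec (d + 1)) := by
  simp only [midpoint, AffineMap.lineMap_apply_module, invOf_eq_inv]
  module

/-- The responses on a segment form contiguous blocks. -/
lemma card_responses_add_le {p : Fin N → Vec (d + 1)} {cost : Fin N → ℝ}
    {a : Vec (d + 1) → Fin N} (ha : IsBestResponse p cost a) {x y : Vec (d + 1)}
    (h : NoTies p cost x y) :
    (responses a x (midpoint ℝ x y)).card + (responses a (midpoint ℝ x y) y).card ≤
      (responses a x y).card + 1 := by
  rw [← Finset.card_union_add_card_inter]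
  refine add_le_add (Finset.card_le_card ?_) ?_
  · apply Finset.union_subset
    · intro k hk
      obtain ⟨s, hs, hk⟩ := mem_responses.1 hk
      rw [lineMap_midpoint_right] at hk
      exact mem_responses.2 ⟨_, ⟨by linarith [hs.1], by linarith [hs.2]⟩, hk⟩
    · intro k hk
      obtain ⟨s, hs, hk⟩ := mem_responses.1 hk
      rw [lineMap_midpoint_left] at hk
      exact mem_responses.2 ⟨_, ⟨by linarith [hs.1], by linarith [hs.2]⟩, hk⟩
  · refine (Finset.card_le_card (t := {a (midpoint ℝ x y)}) ?_).trans
      (Finset.card_singleton _).le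
    intro k hk
    obtain ⟨hk1, hk2⟩ := Finset.mem_inter.1 hk
    obtain ⟨s, hs, hk1⟩ := mem_responses.1 hk1
    obtain ⟨t, ht, hk2⟩ := mem_responses.1 hk2
    rw [Finset.mem_singleton]
    by_contra hne
    -- The advantage of `k` over the response at `m` is affine, nonnegative at one point on either
    -- side of `m` and nonpositive at `m`. Hence it vanishes along the whole segment, which `NoTies`
    -- forbids.
    set m := midpoint ℝ x y with hm
    have e1 := ha.adv_nonneg (AffineMap.lineMap x m s) (a m)
    have e2 := ha.adv_nonneg (AffineMap.lineMap m y t) (a m)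
    have e3 := ha.adv_nonneg m k
    rw [hk1, adv_lineMap, hm, adv_midpoint] at e1
    rw [hk2, adv_lineMap, hm, adv_midpoint] at e2
    rw [adv_swap, hm, adv_midpoint] at e3
    have hs0 : s ≠ 1 := by
      rintro rfl; apply hne; rw [← hk1, AffineMap.lineMap_apply_one]
    have ht0 : t ≠ 0 := by
      rintro rfl; apply hne; rw [← hk2, AffineMap.lineMap_apply_zero]
    have hs1 : s < 1 := lt_of_le_of_ne hs.2 hs0
    have ht1 : 0 < t := lt_of_le_of_ne ht.1 ht0.symm
    set l := a (midpoint ℝ x y)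
    set A := adv p cost k l x
    set B := adv p cost k l y
    have f1 : (1 - s) * (A - B) / 2 ≥ 0 := by linarith
    have f2 : t * (B - A) / 2 ≥ 0 := by linarith
    have f3 : 0 ≤ A - B := by
      have : 0 ≤ (1 - s) * (A - B) := by linarith
      exact nonneg_of_mul_nonneg_right this (by linarith)
    have f4 : 0 ≤ B - A := by
      have : 0 ≤ t * (B - A) := by linarith
      exact nonneg_of_mul_nonneg_right this ht1
    have f5 : A = B := by linarith
    rw [f5] at e1 e3
    exact h k l hne (show A = 0 by linarith) (show B = 0 by linarith)

/-- The two halves of a segment share at most one response. So the number of responses minus one is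
superadditive under halving, and it is at least 1 on every piece that is kept. -/
lemma length_searchAll_le {p : Fin N → Vec (d + 1)} {cost : Fin N → ℝ}
    {a : Vec (d + 1) → Fin N} (ha : IsBestResponse p cost a) (k : ℕ) {x y : Vec (d + 1)}
    (h : NoTies p cost x y) :
    (searchAll a k x y).length + 1 ≤ (responses a x y).card := by
  induction k generalizing x y with
  | zero =>
    by_cases hxy : a x = a y
    · simpa [searchAll, hxy] using one_le_card_responses a x y
    · simpa [searchAll, hxy] using two_le_card_responses hxy
  | succ k ih =>
    by_cases hxy : a x = a y
    · simpa [searchAll, hxy] using one_le_card_responses a x y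
    · have h1 := ih h.left
      have h2 := ih h.right
      have h3 := card_responses_add_le ha h
      simp only [searchAll, hxy, if_false, List.length_append]
      omega

/-- At each of the `k` levels the number of pieces still alive is at most the number of responses
minus one, by the same superadditivity. -/
lemma searchAllRounds_le {p : Fin N → Vec (d + 1)} {cost : Fin N → ℝ}
    {a : Vec (d + 1) → Fin N} (ha : IsBestResponse p cost a) (k : ℕ) {x y : Vec (d + 1)}
    (h : NoTies p cost x y) :
    searchAllRounds a k x y ≤ k * ((responses a x y).card - 1) := by
  induction k generalizing x y with
  | zero => simp [searchAllRounds]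
  | succ k ih =>
    by_cases hxy : a x = a y
    · simp [searchAllRounds, hxy]
    · have h1 := ih h.left
      have h2 := ih h.right
      have h3 := card_responses_add_le ha h
      have h4 := two_le_card_responses hxy
      have h5 := one_le_card_responses a x (midpoint ℝ x y)
      have h6 := one_le_card_responses a (midpoint ℝ x y) y
      simp only [searchAllRounds, hxy, if_false]
      obtain ⟨A, hA⟩ : ∃ A, (responses a x (midpoint ℝ x y)).card = A + 1 :=
        Nat.exists_eq_add_of_le' h5
      obtain ⟨B, hB⟩ : ∃ B, (responses a (midpoint ℝ x y) y).card = B + 1 :=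
        Nat.exists_eq_add_of_le' h6
      obtain ⟨C, hC⟩ : ∃ C, (responses a x y).card = C + 1 :=
        Nat.exists_eq_add_of_le' (by omega)
      rw [hA, Nat.add_sub_cancel] at h1
      rw [hB, Nat.add_sub_cancel] at h2
      rw [hC, Nat.add_sub_cancel]
      have h7 : k * A + k * B ≤ k * C := by
        rw [← mul_add]; exact Nat.mul_le_mul_left _ (by omega)
      rw [add_mul]; omega

/-- By minimality of the logarithm, 2^(k−1) < ⌈1/ε⌉ ≤ 2/ε. The additive constants are absorbed since
`ε ≤ 1/3` makes log(1/ε) at least 1. -/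
lemma halvings_le {n : ℕ} {ε : ℝ} (hε : 0 < ε) (hε1 : ε ≤ 1 / 3) {x y : Vec n}
    (h : ‖WithLp.ofLp (x - y)‖ ≤ 1) : (halvings ε x y : ℝ) ≤ 4 * Real.log (1 / ε) := by
  have h3 : 3 ≤ 1 / ε := by rw [le_div_iff₀ hε]; linarith
  have hlog : 1 ≤ Real.log (1 / ε) := by
    rw [Real.le_log_iff_exp_le (by positivity)]
    exact (Real.exp_one_lt_d9.le.trans (by norm_num)).trans h3
  have h1 : halvings ε x y ≤ Nat.clog 2 ⌈1 / ε⌉₊ := by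
    refine Nat.clog_mono_right 2 (Nat.ceil_mono ?_)
    gcongr
  have h1' : (halvings ε x y : ℝ) ≤ (Nat.clog 2 ⌈1 / ε⌉₊ : ℝ) := by exact_mod_cast h1
  refine h1'.trans ?_
  set k := Nat.clog 2 ⌈1 / ε⌉₊ with hk
  have hceil : 1 < ⌈1 / ε⌉₊ := by
    have : (1 : ℝ) < ⌈1 / ε⌉₊ := lt_of_lt_of_le (by linarith) (Nat.le_ceil _)
    exact_mod_cast this
  have h4 : (2 : ℝ) ^ (k - 1) ≤ 2 / ε := by
    have h5 : 2 ^ (k - 1) < ⌈1 / ε⌉₊ := Nat.pow_pred_clog_lt_self (by norm_num) hceil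
    have h6 : (2 : ℝ) ^ (k - 1) < ⌈1 / ε⌉₊ := by exact_mod_cast h5
    have h7 : (⌈1 / ε⌉₊ : ℝ) < 1 / ε + 1 := Nat.ceil_lt_add_one (by positivity)
    have h8 : 2 / ε = 1 / ε + 1 / ε := by ring
    linarith
  have h9 : ((k - 1 : ℕ) : ℝ) * Real.log 2 ≤ Real.log 2 + Real.log (1 / ε) := by
    rw [← Real.log_pow, ← Real.log_mul (by norm_num) (by positivity)]
    apply Real.log_le_log (by positivity)
    rw [mul_one_div]; exact h4
  have hkk : (k : ℝ) ≤ ((k - 1 : ℕ) : ℝ) + 1 := by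
    have : k ≤ (k - 1) + 1 := by omega
    exact_mod_cast this
  have hl2 := Real.log_two_gt_d9
  nlinarith

lemma norm_ofLp_le {n : ℕ} (x : Vec n) : ‖WithLp.ofLp x‖ ≤ ‖x‖ := by
  rw [pi_norm_le_iff_of_nonneg (norm_nonneg _)]
  exact fun l => PiLp.norm_apply_le x l

lemma norm_ofLp_sub_le_one {n : ℕ} {x y : Vec n} (hx : x ∈ probSimplex n)
    (hy : y ∈ probSimplex n) : ‖WithLp.ofLp (x - y)‖ ≤ 1 := by
  rw [pi_norm_le_iff_of_nonneg (by norm_num)]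
  intro l
  have h1 := hx.1 l
  have h2 := hy.1 l
  have h3 := le_one_of_mem_probSimplex hx l
  have h4 := le_one_of_mem_probSimplex hy l
  rw [PiLp.sub_apply, Real.norm_eq_abs, abs_le]
  constructor <;> linarith

/-- The number of rounds of one sample. -/
lemma sampleRounds_le {p : Fin N → Vec (d + 1)} {cost : Fin N → ℝ}
    {a : Vec (d + 1) → Fin N} (hd : 2 ≤ d) (ha : IsBestResponse p cost a) {c ε : ℝ} (hε : 0 < ε)
    (hε1 : ε ≤ 1 / 3) (hc : √2 * c ≤ 1) {z : Vec (d + 1) × Vec (d + 1)}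
    (hz : z.1 ∈ probSimplex (d + 1)) (hadv : ∀ i j, i ≠ j → adv p cost i j z.1 ≠ 0)
    {F : ℕ → Fin (d + 1) → Vec (d + 1)} (hF : ∀ k, IsCenteredSimplex c (F k)) :
    (sampleRounds a ε z F : ℝ) ≤ 16 * (N * d ^ 2 * Real.log (1 / ε)) := by
  have hd2 : (2 : ℝ) ≤ d := by exact_mod_cast hd
  have hlog : 1 ≤ Real.log (1 / ε) := by
    have h3 : 3 ≤ 1 / ε := by rw [le_div_iff₀ hε]; linarith
    rw [Real.le_log_iff_exp_le (by positivity)]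
    exact (Real.exp_one_lt_d9.le.trans (by norm_num)).trans h3
  set L := Real.log (1 / ε) with hL
  have hnt := noTies_chord hz hadv
  have hk0 := halvings_le hε hε1 (norm_ofLp_sub_le_one (chordStart_mem hz) (chordEnd_mem hz))
  have hcard : (responses a (chordStart z) (chordEnd z)).card ≤ N := by
    simpa using Finset.card_le_univ (responses a (chordStart z) (chordEnd z))
  have hlen := length_searchAll_le ha (halvings ε (chordStart z) (chordEnd z)) hnt
  have hr := searchAllRounds_le ha (halvings ε (chordStart z) (chordEnd z)) hnt
  have hN1 : 1 ≤ N := by omega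
  have hN : (1 : ℝ) ≤ N := by exact_mod_cast hN1
  have hlen' : ((segments a ε z).length : ℝ) ≤ N := by
    have : (segments a ε z).length ≤ N := by unfold segments; omega
    exact_mod_cast this
  have hr' : (searchAllRounds a (halvings ε (chordStart z) (chordEnd z)) (chordStart z)
      (chordEnd z) : ℝ) ≤ 4 * L * N := by
    calc _ ≤ ((halvings ε (chordStart z) (chordEnd z) *
          ((responses a (chordStart z) (chordEnd z)).card - 1) : ℕ) : ℝ) := by exact_mod_cast hr
      _ ≤ (halvings ε (chordStart z) (chordEnd z) : ℝ) * N := by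
          push_cast
          gcongr
          omega
      _ ≤ _ := by gcongr
  have hedge : ∀ (k : Fin (segments a ε z).length) (r r' : Fin (d + 1)),
      ((if r < r' ∧ a (vertex (F k) ((segments a ε z).get k) r) ≠
          a (vertex (F k) ((segments a ε z).get k) r') then
        halvings ε (vertex (F k) ((segments a ε z).get k) r)
          (vertex (F k) ((segments a ε z).get k) r')
      else 0 : ℕ) : ℝ) ≤ 4 * L := by
    intro k r r'
    split_ifs with hif
    · refine halvings_le hε hε1 ((norm_ofLp_le _).trans ?_)
      rw [← dist_eq_norm, vertex, vertex, dist_add_left, (hF k).2.2 r r' hif.1.ne]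
      exact hc
    · simp; linarith
  unfold sampleRounds
  push_cast
  have hsum : (∑ k : Fin (segments a ε z).length, (((d : ℝ) + 1) + ∑ r : Fin (d + 1),
      ∑ r' : Fin (d + 1), ((if r < r' ∧ a (vertex (F k) ((segments a ε z).get k) r) ≠
          a (vertex (F k) ((segments a ε z).get k) r') then
        halvings ε (vertex (F k) ((segments a ε z).get k) r)
          (vertex (F k) ((segments a ε z).get k) r')
      else 0 : ℕ) : ℝ))) ≤ N * (((d : ℝ) + 1) + (d + 1) * ((d + 1) * (4 * L))) := by
    calc _ ≤ ∑ k : Fin (segments a ε z).length, (((d : ℝ) + 1) + ∑ r : Fin (d + 1),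
          ∑ r' : Fin (d + 1), 4 * L) := by
          gcongr with k _ r _ r' _
          exact hedge k r r'
      _ = (segments a ε z).length * (((d : ℝ) + 1) + (d + 1) * ((d + 1) * (4 * L))) := by
          simp; ring
      _ ≤ _ := by gcongr
  push_cast at hsum
  -- With d ≥ 2 and L ≥ 1 every term is a multiple of N d² L; the constants add up to 3/2 + 10,
  -- below 16.
  have e1 : (d : ℝ) + 1 ≤ 3 / 4 * d ^ 2 * L := by nlinarith
  have e2 : ((d : ℝ) + 1) * ((d + 1) * (4 * L)) ≤ 9 * d ^ 2 * L := by
    have : ((d : ℝ) + 1) * (d + 1) ≤ 9 / 4 * d ^ 2 := by nlinarith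
    nlinarith
  have e3 : 2 + 4 * L * N ≤ 6 * (L * N) := by nlinarith
  have e4 : 6 * (L * N) ≤ 3 / 2 * (N * d ^ 2 * L) := by
    have : 0 ≤ L * N := by positivity
    nlinarith
  have e5 : N * (((d : ℝ) + 1) + (d + 1) * ((d + 1) * (4 * L))) ≤ N * (10 * d ^ 2 * L) := by
    gcongr
    have : 0 ≤ (d : ℝ) ^ 2 * L := by positivity
    linarith
  have e6 : 0 ≤ N * (d : ℝ) ^ 2 * L := by positivity
  linarith

end SimplexSearch

namespace SimplexSearch

variable {d N : ℕ}

/-! ### Regular simplices as frames -/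

/-- Polarization expresses inner products by the equal distances and the norms. Summing over one
vertex, with centroid zero, shows that all norms are equal and determines them. -/
lemma IsCenteredSimplex.inner_eq {c : ℝ} {v : Fin (d + 1) → Vec (d + 1)}
    (hv : IsCenteredSimplex c v) (r s : Fin (d + 1)) :
    inner ℝ (v r) (v s) = c ^ 2 * ((if r = s then 1 else 0) - ((d : ℝ) + 1)⁻¹) := by
  obtain ⟨-, h2, h3⟩ := hv
  have hsq : √2 ^ 2 = (2 : ℝ) := Real.sq_sqrt (by norm_num)
  have hd : (0 : ℝ) < (d : ℝ) + 1 := by positivity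
  have key : ∀ r s, ‖v r‖ ^ 2 - 2 * inner ℝ (v r) (v s) + ‖v s‖ ^ 2 =
      2 * c ^ 2 - if r = s then 2 * c ^ 2 else 0 := by
    intro r s
    rw [← norm_sub_sq_real]
    by_cases h : r = s
    · subst h; simp
    · rw [← dist_eq_norm, h3 r s h, mul_pow, hsq, if_neg h]; ring
  have hsum : ∀ r, ((d : ℝ) + 1) * ‖v r‖ ^ 2 + ∑ s, ‖v s‖ ^ 2 = 2 * c ^ 2 * d := by
    intro r
    have h4 := Finset.sum_congr rfl (fun s (_ : s ∈ Finset.univ) => key r s)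
    rw [Finset.sum_add_distrib, Finset.sum_sub_distrib, Finset.sum_sub_distrib,
      ← Finset.mul_sum, ← inner_sum, h2, inner_zero_right] at h4
    simp at h4
    linarith
  have hnorm : ∀ r, ((d : ℝ) + 1) * ‖v r‖ ^ 2 = c ^ 2 * d := by
    have h5 := Finset.sum_congr rfl (fun r (_ : r ∈ Finset.univ) => hsum r)
    rw [Finset.sum_add_distrib, ← Finset.mul_sum] at h5
    simp at h5
    have h6 : ∑ s, ‖v s‖ ^ 2 = c ^ 2 * d := by
      have : ((d : ℝ) + 1) * (∑ s, ‖v s‖ ^ 2 - c ^ 2 * d) = 0 := by linarith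
      rcases mul_eq_zero.1 this with h | h
      · exact absurd h hd.ne'
      · linarith
    intro r
    linarith [hsum r]
  have h7 : ∀ r, ‖v r‖ ^ 2 = c ^ 2 * d / (d + 1) := fun r => by
    rw [eq_div_iff hd.ne', ← hnorm r]; ring
  have h8 := key r s
  rw [h7, h7] at h8
  have h9 : c ^ 2 * d / (d + 1) = c ^ 2 * (1 - ((d : ℝ) + 1)⁻¹) := by field_simp; ring
  rw [h9] at h8
  split_ifs at h8 ⊢ <;> linarith

lemma IsCenteredSimplex.norm_sq {c : ℝ} {v : Fin (d + 1) → Vec (d + 1)}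
    (hv : IsCenteredSimplex c v) (r : Fin (d + 1)) : ‖v r‖ ^ 2 = c ^ 2 * (1 - ((d : ℝ) + 1)⁻¹) := by
  rw [← real_inner_self_eq_norm_sq, hv.inner_eq]; simp

lemma IsCenteredSimplex.norm_le {c : ℝ} (hc : 0 ≤ c) {v : Fin (d + 1) → Vec (d + 1)}
    (hv : IsCenteredSimplex c v) (r : Fin (d + 1)) : ‖v r‖ ≤ c := by
  have h := hv.norm_sq r
  have : 0 ≤ ((d : ℝ) + 1)⁻¹ := by positivity
  refine abs_le_of_sq_le_sq' ?_ hc |>.2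
  rw [h]; nlinarith [sq_nonneg c]

/-- The vertices of a regular simplex form a tight frame of the vectors with sum zero. -/
lemma IsCenteredSimplex.sum_inner_sq {c : ℝ} (hc : 0 < c) {v : Fin (d + 1) → Vec (d + 1)}
    (hv : IsCenteredSimplex c v) {x : Vec (d + 1)} (hx : ∑ l, x l = 0) :
    ∑ r, inner ℝ (v r) x ^ 2 = c ^ 2 * ‖x‖ ^ 2 := by
  -- Rescaled and lifted in the direction of `ones`, the vertices become an orthonormal basis; the
  -- frame identity is Parseval's.
  set w : Fin (d + 1) → Vec (d + 1) := fun r => c⁻¹ • v r + ((d : ℝ) + 1)⁻¹ • ones (d + 1) with hw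
  have hone : ∀ r, inner ℝ (v r) (ones (d + 1)) = (0 : ℝ) := fun r => by
    rw [real_inner_comm, inner_ones, hv.1 r]
  have hone' : ∀ r, inner ℝ (ones (d + 1)) (v r) = (0 : ℝ) := fun r => by
    rw [inner_ones, hv.1 r]
  have h11 : inner ℝ (ones (d + 1)) (ones (d + 1)) = (d : ℝ) + 1 := by
    rw [inner_ones]; simp
  have hd : (0 : ℝ) < (d : ℝ) + 1 := by positivity
  have hon : Orthonormal ℝ w := by
    rw [orthonormal_iff_ite]
    intro r s
    simp only [hw, inner_add_left, inner_add_right, real_inner_smul_left, real_inner_smul_right,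
      hone, hone', h11, hv.inner_eq]
    field_simp
    split_ifs <;> ring
  have hcard : Fintype.card (Fin (d + 1)) = Module.finrank ℝ (Vec (d + 1)) := by simp
  have hb : ⇑(basisOfOrthonormalOfCardEqFinrank hon hcard) = w :=
    coe_basisOfOrthonormalOfCardEqFinrank hon hcard
  set b := (basisOfOrthonormalOfCardEqFinrank hon hcard).toOrthonormalBasis (by rw [hb]; exact hon)
  have hbw : ∀ r, b r = w r := fun r => by
    rw [Module.Basis.coe_toOrthonormalBasis, hb]
  have h := b.sum_sq_norm_inner_right x
  rw [← h, Finset.mul_sum]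
  refine Finset.sum_congr rfl fun r _ => ?_
  rw [hbw, hw]
  simp only [inner_add_left, real_inner_smul_left, inner_ones, hx, Real.norm_eq_abs, sq_abs]
  field_simp
  ring

/-! ### Edges with a switching point -/

/-- The segment from `x` to `y` contains a short piece on which both hyperplanes
`⟨·, g⟩ = C` and `⟨·, g'⟩ = C` are crossed, downwards. -/
def CrossedEdge {n : ℕ} (ε : ℝ) (g g' : Vec n) (C : ℝ) (x y : Vec n) : Prop :=
  ∃ s t : ℝ, 0 ≤ s ∧ s < t ∧ t ≤ 1 ∧ (t - s) * ‖WithLp.ofLp (x - y)‖ ≤ ε ∧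
    C ≤ inner ℝ (AffineMap.lineMap x y s) g ∧ inner ℝ (AffineMap.lineMap x y t) g ≤ C ∧
    C ≤ inner ℝ (AffineMap.lineMap x y s) g' ∧ inner ℝ (AffineMap.lineMap x y t) g' ≤ C

lemma inner_lineMap {n : ℕ} (x y g : Vec n) (s : ℝ) :
    inner ℝ (AffineMap.lineMap x y s) g = (1 - s) * inner ℝ x g + s * inner ℝ y g := by
  simp only [AffineMap.lineMap_apply_module, inner_add_left, inner_smul_left]; simp

/-- A bound for the pairing with a difference of two probability vectors. -/
lemma inner_sub_le_of_forall {n : ℕ} {x a b : Vec n} (ha : a ∈ probSimplex n)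
    (hb : b ∈ probSimplex n) {M : ℝ} (hM : ∀ l k, x l - x k ≤ M) : inner ℝ x (a - b) ≤ M := by
  have h1 : inner ℝ x (a - b) = ∑ l, ∑ k, (a l * b k) * (x l - x k) := by
    have h2 : ∀ l, ∑ k, (a l * b k) * (x l - x k) =
        a l * x l - a l * ∑ k, x k * b k := by
      intro l
      rw [Finset.mul_sum]
      have : a l * x l = ∑ k, a l * x l * b k := by rw [← Finset.mul_sum, hb.2, mul_one]
      rw [this, ← Finset.sum_sub_distrib]
      exact Finset.sum_congr rfl fun k _ => by ring
    rw [Finset.sum_congr rfl fun l _ => h2 l, Finset.sum_sub_distrib, ← Finset.sum_mul, ha.2,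
      inner_sub_right, inner_eq_sum, inner_eq_sum, one_mul]
    congr 1
    exact Finset.sum_congr rfl fun l _ => mul_comm _ _
  rw [h1]
  calc _ ≤ ∑ l, ∑ k, (a l * b k) * M := by
        refine Finset.sum_le_sum fun l _ => Finset.sum_le_sum fun k _ => ?_
        exact mul_le_mul_of_nonneg_left (hM l k) (mul_nonneg (ha.1 l) (hb.1 k))
    _ = M := by
        simp_rw [← Finset.sum_mul, ← Finset.mul_sum, hb.2, mul_one, ha.2, one_mul]

lemma abs_apply_le_norm_ofLp {n : ℕ} (x : Vec n) (l : Fin n) : |x l| ≤ ‖WithLp.ofLp x‖ :=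
  norm_le_pi_norm (WithLp.ofLp x) l

lemma inner_sub_le_of_norm_ofLp_le {n : ℕ} {x a b : Vec n} (ha : a ∈ probSimplex n)
    (hb : b ∈ probSimplex n) {M : ℝ} (hM : ‖WithLp.ofLp x‖ ≤ M) :
    inner ℝ x (a - b) ≤ 2 * M := by
  refine inner_sub_le_of_forall ha hb fun l k => ?_
  have h1 := (abs_le.1 (abs_apply_le_norm_ofLp x l)).2
  have h2 := (abs_le.1 (abs_apply_le_norm_ofLp x k)).1
  linarith

/-- Both affine functions vanish within the parameter interval [s, t], and the determinant of their
end values is, up to sign, the product of the two slopes times the difference of the zeros. The drop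
of the second function over the interval is at most 2ε, since pairing with a difference of
probability vectors is bounded by the oscillation of the coordinates. -/
lemma CrossedEdge.abs_sub_le {n : ℕ} {ε C : ℝ} {g a b x y : Vec n} (ha : a ∈ probSimplex n)
    (hb : b ∈ probSimplex n) (h : CrossedEdge ε g (a - b) C x y) :
    |(inner ℝ x g - C) * (inner ℝ y (a - b) - C) - (inner ℝ x (a - b) - C) * (inner ℝ y g - C)| ≤
      2 * ε * ((inner ℝ x g - C) - (inner ℝ y g - C)) := by
  obtain ⟨s, t, hs, hst, ht, hε, h1, h2, h3, h4⟩ := h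
  have h5 : (t - s) * (inner ℝ x (a - b) - inner ℝ y (a - b)) ≤ 2 * ε := by
    rw [← inner_sub_left, ← real_inner_smul_left]
    refine inner_sub_le_of_norm_ofLp_le ha hb ?_
    rw [WithLp.ofLp_smul, norm_smul, Real.norm_eq_abs, abs_of_pos (by linarith)]
    exact hε
  rw [inner_lineMap] at h1 h2 h3 h4
  set α := inner ℝ x g - C with hα
  set α' := inner ℝ y g - C with hα'
  set β := inner ℝ x (a - b) - C with hβ
  set β' := inner ℝ y (a - b) - C with hβ'
  have i1 : 0 ≤ (1 - s) * α + s * α' := by rw [hα, hα']; linarith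
  have i2 : (1 - t) * α + t * α' ≤ 0 := by rw [hα, hα']; linarith
  have i3 : 0 ≤ (1 - s) * β + s * β' := by rw [hβ, hβ']; linarith
  have i4 : (1 - t) * β + t * β' ≤ 0 := by rw [hβ, hβ']; linarith
  have i5 : (t - s) * (β - β') ≤ 2 * ε := by
    rw [hβ, hβ']; convert h5 using 2; ring
  have j1 : 0 ≤ α - α' := by
    have : 0 ≤ (t - s) * (α - α') := by linarith
    exact nonneg_of_mul_nonneg_right this (by linarith)
  have j2 : 0 ≤ β - β' := by
    have : 0 ≤ (t - s) * (β - β') := by linarith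
    exact nonneg_of_mul_nonneg_right this (by linarith)
  have k1 : s * (α - α') ≤ α := by linarith
  have k2 : α ≤ t * (α - α') := by linarith
  have k3 : s * (β - β') ≤ β := by linarith
  have k4 : β ≤ t * (β - β') := by linarith
  have e : α * β' - β * α' = β * (α - α') - α * (β - β') := by ring
  have m1 := mul_le_mul_of_nonneg_right k1 j2
  have m2 := mul_le_mul_of_nonneg_right k2 j2
  have m3 := mul_le_mul_of_nonneg_right k3 j1
  have m4 := mul_le_mul_of_nonneg_right k4 j1
  have m5 := mul_le_mul_of_nonneg_right i5 j1
  rw [e, _root_.abs_le]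
  constructor <;> linarith

/-! ### Recovery of the separating hyperplane -/

/-- The situation around a midpoint `m`: the hyperplane `⟨·, g⟩ = C` passes close to `m`, and
separates the vertices in `A` from the others. -/
structure Located (ε c : ℝ) (g g' : Vec (d + 1)) (C : ℝ) (m : Vec (d + 1))
    (v : Fin (d + 1) → Vec (d + 1)) (A : Set (Fin (d + 1))) : Prop where
  simplex : IsCenteredSimplex c v
  nonneg : ∀ r ∈ A, C ≤ inner ℝ (m + v r) g
  nonpos : ∀ r ∉ A, inner ℝ (m + v r) g ≤ C
  crossed : ∀ r ∈ A, ∀ s ∉ A, CrossedEdge ε g g' C (m + v r) (m + v s)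

lemma CrossedEdge.neg {n : ℕ} {ε C : ℝ} {g g' x y : Vec n} (h : CrossedEdge ε g g' C x y) :
    CrossedEdge ε (-g) (-g') (-C) y x := by
  obtain ⟨s, t, hs, hst, ht, hε, h1, h2, h3, h4⟩ := h
  refine ⟨1 - t, 1 - s, by linarith, by linarith, by linarith, ?_, ?_, ?_, ?_, ?_⟩
  · rw [← neg_sub x y, WithLp.ofLp_neg, norm_neg]; convert hε using 2; ring
  all_goals
    rw [AffineMap.lineMap_apply_one_sub, inner_neg_right]; linarith

lemma Located.neg {ε c C : ℝ} {g g' m : Vec (d + 1)} {v : Fin (d + 1) → Vec (d + 1)}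
    {A : Set (Fin (d + 1))} (h : Located ε c g g' C m v A) :
    Located ε c (-g) (-g') (-C) m v Aᶜ where
  simplex := h.simplex
  nonneg r hr := by
    rw [inner_neg_right]; linarith [h.nonpos r hr]
  nonpos r hr := by
    rw [inner_neg_right]; linarith [h.nonneg r (Set.notMem_compl_iff.1 hr)]
  crossed r hr s hs := (h.crossed s (Set.notMem_compl_iff.1 hs) r hr).neg

lemma IsCenteredSimplex.sum_adv {c : ℝ} {v : Fin (d + 1) → Vec (d + 1)}
    (hv : IsCenteredSimplex c v) (m g : Vec (d + 1)) (C : ℝ) :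
    ∑ r, (inner ℝ (m + v r) g - C) = (d + 1) * (inner ℝ m g - C) := by
  simp_rw [inner_add_left]
  rw [Finset.sum_sub_distrib, Finset.sum_add_distrib, ← sum_inner Finset.univ v, hv.2.1, inner_zero_left]
  simp; ring

/-- Variance decomposition around the centroid `m`; the tight frame evaluates the variance. -/
lemma IsCenteredSimplex.sum_adv_sq {c : ℝ} (hc : 0 < c) {v : Fin (d + 1) → Vec (d + 1)}
    (hv : IsCenteredSimplex c v) {m g : Vec (d + 1)} (hg : ∑ l, g l = 0) (C : ℝ) :
    ∑ r, (inner ℝ (m + v r) g - C) ^ 2 =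
      c ^ 2 * ‖g‖ ^ 2 + (d + 1) * (inner ℝ m g - C) ^ 2 := by
  have h1 : ∀ r, (inner ℝ (m + v r) g - C) ^ 2 =
      inner ℝ (v r) g ^ 2 + 2 * (inner ℝ m g - C) * inner ℝ (v r) g + (inner ℝ m g - C) ^ 2 := by
    intro r; rw [inner_add_left]; ring
  simp_rw [h1]
  rw [Finset.sum_add_distrib, Finset.sum_add_distrib, hv.sum_inner_sq hc hg, ← Finset.mul_sum,
    ← sum_inner, hv.2.1, inner_zero_left]
  simp

/-- Let α and β be the values of the true and of the candidate affine function at the vertices.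
Crossed edges make the 2 × 2 minors of (α, β) small, so β is nearly a multiple of α, provided that
both sides contain a vertex with α not too small. -/
lemma exists_multiple_of_located {ε c C : ℝ} (hd : 1 ≤ d) (hc : 0 < c) (hε : 0 < ε)
    (hεc : ((d : ℝ) + 1) ^ 2 * ε ≤ c)
    {g a b m : Vec (d + 1)} {v : Fin (d + 1) → Vec (d + 1)} {A : Set (Fin (d + 1))}
    (hg : ∑ l, g l = 0) (hg0 : g ≠ 0)
    (ha : a ∈ probSimplex (d + 1)) (hb : b ∈ probSimplex (d + 1))
    (hmg : |inner ℝ m g - C| ≤ √((d : ℝ) + 1) * ε / 2 * ‖g‖)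
    (h : Located ε c g (a - b) C m v A) {r₀ : Fin (d + 1)} (hr₀ : r₀ ∈ A)
    (hmax : ∀ r, |inner ℝ (m + v r) g - C| ≤ inner ℝ (m + v r₀) g - C) :
    ∃ Λ : ℝ, ∀ r, |(inner ℝ (m + v r) (a - b) - C) - Λ * (inner ℝ (m + v r) g - C)| ≤
      4 * (2 * d + 1) * ε := by
  have hd1 : (1 : ℝ) ≤ d := by exact_mod_cast hd
  have hG : 0 < ‖g‖ := norm_pos_iff.2 hg0
  set G := ‖g‖ with hGdef
  set α : Fin (d + 1) → ℝ := fun r => inner ℝ (m + v r) g - C with hα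
  set β : Fin (d + 1) → ℝ := fun r => inner ℝ (m + v r) (a - b) - C with hβ
  set q := √((d : ℝ) + 1) with hq
  have hq2 : q ^ 2 = (d : ℝ) + 1 := Real.sq_sqrt (by positivity)
  have hq0 : 0 < q := Real.sqrt_pos.2 (by positivity)
  set ᾱ := inner ℝ m g - C with hᾱ
  have hsum : ∑ r, α r = (d + 1) * ᾱ := h.simplex.sum_adv m g C
  have hsq : ∑ r, α r ^ 2 = c ^ 2 * G ^ 2 + (d + 1) * ᾱ ^ 2 := h.simplex.sum_adv_sq hc hg C
  set a0 := α r₀ with ha0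
  have hmax' : ∀ r, |α r| ≤ a0 := hmax
  have ha0n : 0 ≤ a0 := (abs_nonneg _).trans (hmax' r₀)
  -- The squares of the d + 1 values sum to at least c²G², so the largest value is not small.
  have h1 : c * G ≤ q * a0 := by
    have h2 : ∑ r, α r ^ 2 ≤ ∑ _r : Fin (d + 1), a0 ^ 2 :=
      Finset.sum_le_sum fun r _ => by
        rw [← sq_abs]; exact pow_le_pow_left₀ (abs_nonneg _) (hmax' r) 2
    rw [hsq] at h2
    simp at h2
    refine abs_le_of_sq_le_sq' ?_ (by positivity) |>.2
    rw [mul_pow, mul_pow, hq2]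
    nlinarith [sq_nonneg ᾱ]
  have ha0p : 0 < a0 := by
    by_contra hcon
    have : a0 = 0 := by linarith
    rw [this, mul_zero] at h1
    have : 0 < c * G := by positivity
    linarith
  have h3 : (d + 1) * |ᾱ| ≤ a0 / 2 := by
    have h4 : q * ((d + 1) * |ᾱ|) ≤ q * (a0 / 2) := by
      calc q * ((d + 1) * |ᾱ|) ≤ q * ((d + 1) * (q * ε / 2 * G)) := by gcongr
        _ = (((d : ℝ) + 1) ^ 2 * ε) * G / 2 := by
            rw [show q * ((d + 1) * (q * ε / 2 * G)) = q ^ 2 * (((d : ℝ) + 1) * ε * G / 2) by ring,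
              hq2]; ring
        _ ≤ c * G / 2 := by gcongr
        _ ≤ _ := by linarith
    exact le_of_mul_le_mul_left h4 hq0
  -- The hyperplane passes close to the centroid, so all values sum to at most a0/2. The d vertices
  -- other than `r₀` must therefore sum to at most −a0/2, and one of them is at most −a0/(2d).
  obtain ⟨r₁, hr₁A, hr₁⟩ : ∃ r₁, r₁ ∉ A ∧ a0 ≤ 2 * d * (-α r₁) := by
    by_contra hcon
    push Not at hcon
    have h5 : ∀ r, r ≠ r₀ → -(a0 / (2 * d)) < α r := by
      intro r hr
      by_cases hrA : r ∈ A
      · have h6 : 0 ≤ α r := by have := h.nonneg r hrA; simp only [hα]; linarith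
        have : 0 < a0 / (2 * d) := by positivity
        linarith
      · have := hcon r hrA
        rw [neg_lt, lt_div_iff₀ (by positivity)]
        linarith
    have h6 : ∑ r ∈ Finset.univ.erase r₀, -(a0 / (2 * d)) < ∑ r ∈ Finset.univ.erase r₀, α r := by
      apply Finset.sum_lt_sum_of_nonempty
      · rw [← Finset.card_pos, Finset.card_erase_of_mem (Finset.mem_univ _)]; simp; omega
      · exact fun r hr => h5 r (Finset.ne_of_mem_erase hr)
    rw [Finset.sum_erase_eq_sub (f := α) (Finset.mem_univ r₀), hsum, Finset.sum_const,
      Finset.card_erase_of_mem (Finset.mem_univ _)] at h6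
    simp at h6
    have h7 : (d : ℝ) * (a0 / (2 * d)) = a0 / 2 := by field_simp
    have h8 := le_abs_self ᾱ
    have h9 : (d + 1) * ᾱ ≤ (d + 1) * |ᾱ| := by gcongr
    linarith
  set b1 := -α r₁ with hb1
  have hb1p : 0 < b1 := by
    by_contra hcon
    have : 2 * d * b1 ≤ 0 := mul_nonpos_of_nonneg_of_nonpos (by positivity) (by linarith)
    linarith
  have hcr : ∀ r ∈ A, ∀ s ∉ A, |α r * β s - β r * α s| ≤ 2 * ε * (α r - α s) :=
    fun r hr s hs => (h.crossed r hr s hs).abs_sub_le ha hb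
  set Λ := β r₀ / a0 with hΛ
  have hΛa : Λ * a0 = β r₀ := by rw [hΛ]; field_simp
  set E := 4 * (2 * d + 1) * ε with hE
  refine ⟨Λ, fun r => ?_⟩
  change |β r - Λ * α r| ≤ E
  by_cases hrA : r ∈ A
  -- `r` and `r₀` are on the same side and no crossed edge joins them; both are compared with `r₁`.
  · have e1 := hcr r hrA r₁ hr₁A
    have e2 := hcr r₀ hr₀ r₁ hr₁A
    have e3 : α r ≤ a0 := (le_abs_self _).trans (hmax' r)
    have e4 : 0 ≤ α r := by have := h.nonneg r hrA; simp only [hα]; linarith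
    have e5 : b1 * (β r - Λ * α r) = (α r * β r₁ - β r * α r₁) -
        (α r / a0) * (a0 * β r₁ - β r₀ * α r₁) := by
      rw [← hΛa, hb1]; field_simp; ring
    have e6 : α r / a0 ≤ 1 := (div_le_one ha0p).2 e3
    have e7 : b1 * |β r - Λ * α r| ≤ b1 * E := by
      rw [← abs_of_pos hb1p, ← abs_mul, abs_of_pos hb1p, e5]
      calc _ ≤ |α r * β r₁ - β r * α r₁| + |(α r / a0) * (a0 * β r₁ - β r₀ * α r₁)| := abs_sub _ _
        _ ≤ 2 * ε * (α r - α r₁) + 1 * (2 * ε * (a0 - α r₁)) := by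
            rw [abs_mul, abs_of_nonneg (div_nonneg e4 ha0p.le)]
            gcongr
        _ ≤ 4 * ε * (a0 + b1) := by rw [hb1]; nlinarith
        _ ≤ 4 * ε * (2 * d * b1 + b1) := by gcongr
        _ = b1 * E := by rw [hE]; ring
    exact le_of_mul_le_mul_left e7 hb1p
  · have e1 := hcr r₀ hr₀ r hrA
    have e3 : -α r ≤ a0 := (neg_le_abs _).trans (hmax' r)
    have e5 : a0 * (β r - Λ * α r) = a0 * β r - β r₀ * α r := by rw [← hΛa]; ring
    have e7 : a0 * |β r - Λ * α r| ≤ a0 * E := by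
      rw [← abs_of_pos ha0p, ← abs_mul, abs_of_pos ha0p, e5]
      calc _ ≤ 2 * ε * (a0 - α r) := e1
        _ ≤ 2 * ε * (a0 + a0) := by gcongr; linarith
        _ = a0 * (4 * 1 * ε) := by ring
        _ ≤ a0 * E := by rw [hE]; gcongr; linarith
    exact le_of_mul_le_mul_left e7 ha0p

/-- The function ⟨·, w⟩ − B with w = (a − b) − Λg and B = (1 − Λ)C is small at all vertices. The
frame makes `w` small, hence B is small as well, and |C| ≥ θ forces Λ close to 1. This is where the
cost gap fixes the length of the normal. -/
lemma norm_sub_le_of_multiple {c θ C E Λ : ℝ} (hc : 0 < c) (hc1 : c ≤ 1)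
    (hθ : 0 < θ) (hC : θ ≤ |C|) (hC1 : |C| ≤ 1) (hE0 : 0 ≤ E)
    {g a b m : Vec (d + 1)} {v : Fin (d + 1) → Vec (d + 1)} (hv : IsCenteredSimplex c v)
    (hg : ∑ l, g l = 0) (hg1 : ‖g‖ ≤ √2)
    (ha : a ∈ probSimplex (d + 1)) (hb : b ∈ probSimplex (d + 1))
    (hm : m ∈ probSimplex (d + 1))
    (hγ : ∀ r, |(inner ℝ (m + v r) (a - b) - C) - Λ * (inner ℝ (m + v r) g - C)| ≤ E) :
    ‖(a - b) - g‖ ≤ 9 / 2 * √((d : ℝ) + 1) * E / (c * θ) := by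
  set q := √((d : ℝ) + 1) with hq
  have hq2 : q ^ 2 = (d : ℝ) + 1 := Real.sq_sqrt (by positivity)
  have hq0 : 0 < q := Real.sqrt_pos.2 (by positivity)
  set w := (a - b) - Λ • g with hw
  set B := (1 - Λ) * C with hB
  have hγ' : ∀ r, inner ℝ (m + v r) w - B =
      (inner ℝ (m + v r) (a - b) - C) - Λ * (inner ℝ (m + v r) g - C) := by
    intro r
    simp only [hw, hB, inner_sub_right, real_inner_smul_right]; ring
  have hw0 : ∑ l, w l = 0 := by
    simp only [hw, PiLp.sub_apply, PiLp.smul_apply, Finset.sum_sub_distrib, ha.2, hb.2,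
      smul_eq_mul, ← Finset.mul_sum, hg]
    simp
  have hwn : ‖w‖ ≤ q * E / c := by
    have f1 := hv.sum_adv_sq hc hw0 (m := m) B
    have f2 : ∑ r, (inner ℝ (m + v r) w - B) ^ 2 ≤ ∑ _r : Fin (d + 1), E ^ 2 :=
      Finset.sum_le_sum fun r _ => by
        rw [hγ', ← sq_abs]; exact pow_le_pow_left₀ (abs_nonneg _) (hγ r) 2
    rw [f1] at f2
    simp at f2
    rw [le_div_iff₀ hc]
    refine abs_le_of_sq_le_sq' ?_ (by positivity) |>.2
    rw [mul_pow, mul_pow, hq2]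
    nlinarith [sq_nonneg (inner ℝ m w - B)]
  have hmB : |inner ℝ m w - B| ≤ E := by
    have f1 := hv.sum_adv m w B
    have f2 : |∑ r, (inner ℝ (m + v r) w - B)| ≤ (d + 1) * E := by
      calc _ ≤ ∑ r, |inner ℝ (m + v r) w - B| := Finset.abs_sum_le_sum_abs _ _
        _ ≤ ∑ _r : Fin (d + 1), E := Finset.sum_le_sum fun r _ => by rw [hγ']; exact hγ r
        _ = (d + 1) * E := by simp
    rw [f1, abs_mul, abs_of_pos (by positivity)] at f2
    exact le_of_mul_le_mul_left f2 (by positivity)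
  have hBn : |B| ≤ E + √2 * (q * E / c) := by
    have f1 : |inner ℝ m w| ≤ √2 * (q * E / c) := by
      have f2 : inner ℝ m w = inner ℝ (m - center d) w := by
        rw [inner_sub_left, inner_center, hw0]; ring
      rw [f2]
      refine (abs_real_inner_le_norm _ _).trans ?_
      gcongr
      refine norm_sub_le_sqrt_two hm ⟨fun l => ?_, sum_center d⟩
      rw [center_apply]; positivity
    calc |B| = |inner ℝ m w - (inner ℝ m w - B)| := by congr 1; ring
      _ ≤ _ := (abs_sub _ _).trans (by linarith)
  have hθ1 : θ ≤ 1 := hC.trans hC1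
  have hΛ1 : |1 - Λ| ≤ (E + √2 * (q * E / c)) / θ := by
    rw [le_div_iff₀ hθ]
    refine le_trans ?_ hBn
    rw [hB, abs_mul]; gcongr
  have hq1 : 1 ≤ q := by rw [hq, Real.one_le_sqrt]; linarith [(Nat.cast_nonneg d : (0 : ℝ) ≤ d)]
  have h2 : √2 ≤ 3 / 2 := by
    rw [Real.sqrt_le_left (by norm_num)]; norm_num
  have hX : E ≤ q * E / c := by
    rw [le_div_iff₀ hc]
    calc E * c ≤ E * 1 := by gcongr
      _ ≤ q * E := by nlinarith
  set X := q * E / c with hXdef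
  have hX0 : 0 ≤ X := by positivity
  have hXθ : X ≤ X / θ := by rw [le_div_iff₀ hθ]; nlinarith
  have h22 : √2 * √2 = 2 := Real.mul_self_sqrt (by norm_num)
  have hD : (a - b) - g = w - (1 - Λ) • g := by rw [hw]; module
  rw [hD]
  calc _ ≤ ‖w‖ + ‖(1 - Λ) • g‖ := norm_sub_le _ _
    _ ≤ X + (E + √2 * X) / θ * √2 := by
        rw [norm_smul, Real.norm_eq_abs]; gcongr
    _ ≤ X / θ + (X + √2 * X) / θ * √2 := by gcongr
    _ = (X / θ) * (3 + √2) := by field_simp; nlinarith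
    _ ≤ (X / θ) * (9 / 2) := by gcongr; linarith
    _ = _ := by rw [hXdef]; field_simp

lemma norm_sub_le_of_located_of_max {ε c θ C : ℝ} (hd : 1 ≤ d) (hc : 0 < c) (hc1 : c ≤ 1) (hε : 0 < ε)
    (hεc : ((d : ℝ) + 1) ^ 2 * ε ≤ c) (hθ : 0 < θ) (hC : θ ≤ |C|) (hC1 : |C| ≤ 1)
    {g a b m : Vec (d + 1)} {v : Fin (d + 1) → Vec (d + 1)} {A : Set (Fin (d + 1))}
    (hg : ∑ l, g l = 0) (hg0 : g ≠ 0) (hg1 : ‖g‖ ≤ √2)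
    (ha : a ∈ probSimplex (d + 1)) (hb : b ∈ probSimplex (d + 1))
    (hm : m ∈ probSimplex (d + 1))
    (hmg : |inner ℝ m g - C| ≤ √((d : ℝ) + 1) * ε / 2 * ‖g‖)
    (h : Located ε c g (a - b) C m v A) {r₀ : Fin (d + 1)} (hr₀ : r₀ ∈ A)
    (hmax : ∀ r, |inner ℝ (m + v r) g - C| ≤ inner ℝ (m + v r₀) g - C) :
    ‖(a - b) - g‖ ≤ 18 * (2 * d + 1) * √((d : ℝ) + 1) * ε / (c * θ) := by
  obtain ⟨Λ, hΛ⟩ := exists_multiple_of_located hd hc hε hεc hg hg0 ha hb hmg h hr₀ hmax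
  refine (norm_sub_le_of_multiple hc hc1 hθ hC hC1 (by positivity) h.simplex hg hg1 ha hb hm
    hΛ).trans_eq ?_
  ring

/-- Two hyperplanes which are both located around the same regular simplex are close. -/
lemma norm_sub_le_of_located {ε c θ C : ℝ} (hd : 1 ≤ d) (hc : 0 < c) (hc1 : c ≤ 1) (hε : 0 < ε)
    (hεc : ((d : ℝ) + 1) ^ 2 * ε ≤ c) (hθ : 0 < θ) (hC : θ ≤ |C|) (hC1 : |C| ≤ 1)
    {g a b m : Vec (d + 1)} {v : Fin (d + 1) → Vec (d + 1)} {A : Set (Fin (d + 1))}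
    (hg : ∑ l, g l = 0) (hg0 : g ≠ 0) (hg1 : ‖g‖ ≤ √2)
    (ha : a ∈ probSimplex (d + 1)) (hb : b ∈ probSimplex (d + 1))
    (hm : m ∈ probSimplex (d + 1))
    (hmg : |inner ℝ m g - C| ≤ √((d : ℝ) + 1) * ε / 2 * ‖g‖)
    (h : Located ε c g (a - b) C m v A) :
    ‖(a - b) - g‖ ≤ 18 * (2 * d + 1) * √((d : ℝ) + 1) * ε / (c * θ) := by
  obtain ⟨r₀, hr₀⟩ := Finite.exists_max fun r => |inner ℝ (m + v r) g - C|
  by_cases hA : r₀ ∈ A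
  · refine norm_sub_le_of_located_of_max hd hc hc1 hε hεc hθ hC hC1 hg hg0 hg1 ha hb hm hmg h hA
      fun r => (hr₀ r).trans ?_
    rw [abs_of_nonneg (sub_nonneg.2 (h.nonneg r₀ hA))]
  -- If the largest absolute value occurs on the negative side, the roles of the two actions are
  -- exchanged.
  · have h' := h.neg
    rw [neg_sub] at h'
    have e : ∀ x : Vec (d + 1), inner ℝ x (-g) - -C = -(inner ℝ x g - C) := fun x => by
      rw [inner_neg_right]; ring
    rw [← norm_neg, show -(a - b - g) = (b - a) - -g by abel]
    refine norm_sub_le_of_located_of_max hd hc hc1 hε hεc hθ (by rwa [abs_neg]) (by rwa [abs_neg])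
      (by simp [hg]) (neg_ne_zero.2 hg0) (by rwa [norm_neg]) hb ha hm ?_ h' hA fun r => ?_
    · rw [e, abs_neg, norm_neg]; exact hmg
    · rw [e, e, abs_neg]
      refine (hr₀ r).trans ?_
      rw [abs_of_nonpos (sub_nonpos.2 (h.nonpos r₀ hA))]

end SimplexSearch

namespace SimplexSearch

variable {d N : ℕ}

/-! ### Correctness of the searches -/

lemma norm_le_sqrt_mul_norm_ofLp {n : ℕ} (x : Vec n) : ‖x‖ ≤ √(n : ℝ) * ‖WithLp.ofLp x‖ := by
  refine abs_le_of_sq_le_sq' ?_ (by positivity) |>.2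
  rw [mul_pow, Real.sq_sqrt (Nat.cast_nonneg n), norm_sq_eq_sum]
  calc ∑ l, x l ^ 2 ≤ ∑ _l : Fin n, ‖WithLp.ofLp x‖ ^ 2 :=
        Finset.sum_le_sum fun l _ => by
          rw [← sq_abs]
          exact pow_le_pow_left₀ (abs_nonneg _) (abs_apply_le_norm_ofLp x l) 2
    _ = _ := by simp

lemma norm_ofLp_le_mul_two_pow {n : ℕ} {ε : ℝ} (hε : 0 < ε) (x y : Vec n) :
    ‖WithLp.ofLp (x - y)‖ ≤ ε * 2 ^ halvings ε x y := by
  rw [← div_le_iff₀' hε]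
  refine (Nat.le_ceil _).trans ?_
  have : ⌈‖WithLp.ofLp (x - y)‖ / ε⌉₊ ≤ 2 ^ halvings ε x y := Nat.le_pow_clog (by norm_num) _
  exact_mod_cast this

/-- The invariant only says that the response at the far end differs from the one at `x`. That
suffices, because near a good surface there are just two possible responses. -/
lemma searchOne_spec (a : Vec (d + 1) → Fin N) (k : ℕ) {x y : Vec (d + 1)} (h : a x ≠ a y) :
    ∃ s t : ℝ, 0 ≤ s ∧ s < t ∧ t ≤ 1 ∧ (t - s) * 2 ^ k = 1 ∧
      searchOne a k x y = (AffineMap.lineMap x y s, AffineMap.lineMap x y t) ∧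
      a (AffineMap.lineMap x y s) = a x ∧ a (AffineMap.lineMap x y t) ≠ a x := by
  induction k generalizing x y with
  | zero => exact ⟨0, 1, le_rfl, by norm_num, le_rfl, by norm_num, by simp [searchOne], by simp,
      by simpa using h.symm⟩
  | succ k ih =>
    by_cases hm : a (midpoint ℝ x y) = a x
    · obtain ⟨s, t, hs, hst, ht, hk, h1, h2, h3⟩ := ih (x := midpoint ℝ x y) (y := y) (by rwa [hm])
      rw [lineMap_midpoint_left] at h2 h3
      refine ⟨(1 + s) / 2, (1 + t) / 2, by linarith, by linarith, by linarith, ?_, ?_,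
        by rw [h2, hm], by rwa [hm] at h3⟩
      · rw [← hk, pow_succ]; ring
      · rw [searchOne, if_pos hm, h1, lineMap_midpoint_left, lineMap_midpoint_left]
    · obtain ⟨s, t, hs, hst, ht, hk, h1, h2, h3⟩ := ih (x := x) (y := midpoint ℝ x y) (Ne.symm hm)
      rw [lineMap_midpoint_right] at h2 h3
      refine ⟨s / 2, t / 2, by linarith, by linarith, by linarith, ?_, ?_, h2, h3⟩
      · rw [← hk, pow_succ]; ring
      · rw [searchOne, if_neg hm, h1, lineMap_midpoint_right, lineMap_midpoint_right]

/-- The side of the hyperplane between the regions of `i` and `j`; ties are attributed according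
to the response. -/
def Prefers (p : Fin N → Vec (d + 1)) (cost : Fin N → ℝ) (a : Vec (d + 1) → Fin N) (i j : Fin N)
    (x : Vec (d + 1)) : Prop :=
  0 < adv p cost i j x ∨ adv p cost i j x = 0 ∧ a x = i

variable {p : Fin N → Vec (d + 1)} {cost : Fin N → ℝ} {a : Vec (d + 1) → Fin N} {i j : Fin N}

lemma Prefers.nonneg {x : Vec (d + 1)} (h : Prefers p cost a i j x) : 0 ≤ adv p cost i j x := by
  rcases h with h | h
  · exact h.le
  · exact h.1.ge

lemma nonpos_of_not_prefers {x : Vec (d + 1)} (h : ¬Prefers p cost a i j x) :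
    adv p cost i j x ≤ 0 := by
  by_contra hcon
  exact h (Or.inl (not_le.1 hcon))

lemma mul_nonpos_of_prefers {x y : Vec (d + 1)}
    (h : Prefers p cost a i j x ↔ ¬Prefers p cost a i j y) :
    adv p cost i j x * adv p cost i j y ≤ 0 := by
  by_cases hx : Prefers p cost a i j x
  · exact mul_nonpos_of_nonneg_of_nonpos hx.nonneg (nonpos_of_not_prefers (h.1 hx))
  · exact mul_nonpos_of_nonpos_of_nonneg (nonpos_of_not_prefers hx)
      (not_not.1 (mt h.2 hx)).nonneg

/-- A common third response would beat `i` at both ends, hence also in between, where `i` beats it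
strictly. A common response `i` or `j` contradicts the preferences, which break ties by the
response. -/
lemma response_ne_of_prefers (ha : IsBestResponse p cost a) {x y : Vec (d + 1)}
    {t : ℝ} (ht0 : 0 ≤ t) (ht1 : t ≤ 1)
    (hthird : ∀ k, k ≠ i → k ≠ j → 0 < adv p cost i k (AffineMap.lineMap x y t))
    (hx : Prefers p cost a i j x) (hy : ¬Prefers p cost a i j y) : a x ≠ a y := by
  intro hxy
  by_cases hki : a y = i
  · have h1 := ha.adv_nonneg y j
    rw [hki] at h1
    exact hy (Or.inr ⟨le_antisymm (nonpos_of_not_prefers hy) h1, hki⟩)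
  by_cases hkj : a y = j
  · have h1 := ha.adv_nonneg x i
    rw [hxy, hkj, adv_swap] at h1
    rcases hx with h | h
    · linarith
    · exact hki (hxy ▸ h.2)
  have h1 := ha.adv_nonneg x i
  have h2 := ha.adv_nonneg y i
  have h3 := hthird (a y) hki hkj
  rw [hxy] at h1
  rw [adv_swap, adv_lineMap] at h3
  have h4 := mul_nonneg (sub_nonneg.2 ht1) h1
  have h5 := mul_nonneg ht0 h2
  linarith

/-- The preference between `i` and `j` flips on exactly one half of the segment, and `x₀` lies in
that half. Its ends have different responses, so the piece around `x₀` is never dropped. -/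
lemma exists_mem_searchAll (ha : IsBestResponse p cost a) (hij : i ≠ j) (k : ℕ)
    {x y x₀ : Vec (d + 1)} (hnt : NoTies p cost x y) {t : ℝ} (ht0 : 0 ≤ t) (ht1 : t ≤ 1)
    (hx₀ : AffineMap.lineMap x y t = x₀) (h0 : adv p cost i j x₀ = 0)
    (hthird : ∀ k, k ≠ i → k ≠ j → 0 < adv p cost i k x₀)
    (hxy : Prefers p cost a i j x ↔ ¬Prefers p cost a i j y)
    (hx : x ∈ probSimplex (d + 1)) (hy : y ∈ probSimplex (d + 1)) :
    ∃ s ∈ searchAll a k x y, s.1 ∈ probSimplex (d + 1) ∧ s.2 ∈ probSimplex (d + 1) ∧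
      (∃ t : ℝ, 0 ≤ t ∧ t ≤ 1 ∧ AffineMap.lineMap s.1 s.2 t = x₀) ∧
      ‖WithLp.ofLp (s.1 - s.2)‖ * 2 ^ k = ‖WithLp.ofLp (x - y)‖ := by
  induction k generalizing x y t with
  | zero =>
    have hne : a x ≠ a y := by
      by_cases hp : Prefers p cost a i j x
      · exact response_ne_of_prefers ha ht0 ht1 (by rwa [hx₀]) hp (hxy.1 hp)
      · refine (response_ne_of_prefers ha (t := 1 - t) (by linarith) (by linarith) ?_
          (not_not.1 (mt hxy.2 hp)) hp).symm
        rwa [AffineMap.lineMap_apply_one_sub, hx₀]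
    exact ⟨(x, y), by simp [searchAll, hne], hx, hy, ⟨t, ht0, ht1, hx₀⟩, by simp⟩
  | succ k ih =>
    have hne : a x ≠ a y := by
      by_cases hp : Prefers p cost a i j x
      · exact response_ne_of_prefers ha ht0 ht1 (by rwa [hx₀]) hp (hxy.1 hp)
      · refine (response_ne_of_prefers ha (t := 1 - t) (by linarith) (by linarith) ?_
          (not_not.1 (mt hxy.2 hp)) hp).symm
        rwa [AffineMap.lineMap_apply_one_sub, hx₀]
    have hm : midpoint ℝ x y ∈ probSimplex (d + 1) :=
      (convex_probSimplex _).segment_subset hx hy (midpoint_mem_segment x y)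
    rw [← hx₀, adv_lineMap] at h0
    set A := adv p cost i j x
    set B := adv p cost i j y
    by_cases hc : Prefers p cost a i j x ↔ ¬Prefers p cost a i j (midpoint ℝ x y)
    · have h1 := mul_nonpos_of_prefers hc
      rw [adv_midpoint] at h1
      have ht : t ≤ 1 / 2 := by
        by_contra hcon
        push Not at hcon
        -- If `t > 1/2`, the sign change on the left half would force A = 0. Then B = 0 too, and `i`
        -- and `j` would be tied at both ends.
        have h2 : A ^ 2 * (2 * t - 1) = t * (A * (A + B)) := by linear_combination -A * h0
        have h3 : t * (A * (A + B)) ≤ 0 :=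
          mul_nonpos_of_nonneg_of_nonpos ht0 (by change A * ((A + B) / 2) ≤ 0 at h1; linarith)
        have hA : A = 0 := by
          by_contra hA
          have : 0 < A ^ 2 * (2 * t - 1) := mul_pos (by positivity) (by linarith)
          linarith
        have hB : t * B = 0 := by rw [hA] at h0; linarith
        rcases mul_eq_zero.1 hB with h | h
        · linarith
        · exact hnt i j hij hA h
      obtain ⟨s, hs, h2, h3, h4, h5⟩ := ih hnt.left (t := 2 * t) (by linarith) (by linarith)
        (by rw [lineMap_midpoint_right, ← hx₀]; congr 1; ring) hc hx hm
      refine ⟨s, by simp [searchAll, hne, hs], h2, h3, h4, ?_⟩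
      rw [pow_succ, ← mul_assoc, h5, left_sub_midpoint, WithLp.ofLp_smul, norm_smul]
      simp
      ring
    · have hc' : Prefers p cost a i j (midpoint ℝ x y) ↔ ¬Prefers p cost a i j y := by
        clear ih h0 hthird
        by_cases h2 : Prefers p cost a i j (midpoint ℝ x y) <;>
          by_cases h3 : Prefers p cost a i j y <;> by_cases h4 : Prefers p cost a i j x <;>
          simp_all
      have h1 := mul_nonpos_of_prefers hc'
      rw [adv_midpoint] at h1
      have ht : 1 / 2 ≤ t := by
        by_contra hcon
        push Not at hcon
        have h2 : B ^ 2 * (1 - 2 * t) = (1 - t) * ((A + B) * B) := by linear_combination -B * h0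
        have h3 : (1 - t) * ((A + B) * B) ≤ 0 :=
          mul_nonpos_of_nonneg_of_nonpos (by linarith)
            (by change (A + B) / 2 * B ≤ 0 at h1; linarith)
        have hB : B = 0 := by
          by_contra hB
          have : 0 < B ^ 2 * (1 - 2 * t) := mul_pos (by positivity) (by linarith)
          linarith
        have hA : (1 - t) * A = 0 := by rw [hB] at h0; linarith
        rcases mul_eq_zero.1 hA with h | h
        · linarith
        · exact hnt i j hij h hB
      obtain ⟨s, hs, h2, h3, h4, h5⟩ := ih hnt.right (t := 2 * t - 1) (by linarith) (by linarith)
        (by rw [lineMap_midpoint_left, ← hx₀]; congr 1; ring) hc' hm hy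
      refine ⟨s, by simp [searchAll, hne, hs], h2, h3, h4, ?_⟩
      rw [pow_succ, ← mul_assoc, h5, midpoint_sub_right, WithLp.ofLp_smul, norm_smul]
      simp
      ring

/-- Positive coordinates put `x₀` strictly inside the chord. The advantage is not constant along the
line, so its signs at the two ends are strictly opposite. -/
lemma exists_lineMap_chord {z : Vec (d + 1) × Vec (d + 1)} {x₀ : Vec (d + 1)}
    (hx₀ : x₀ ∈ chord z) (hpos : ∀ l, 0 < x₀ l) (hz : z.1 ∈ probSimplex (d + 1))
    (hadv : adv p cost i j z.1 ≠ 0) (h0 : adv p cost i j x₀ = 0) :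
    (∃ t : ℝ, 0 ≤ t ∧ t ≤ 1 ∧ AffineMap.lineMap (chordStart z) (chordEnd z) t = x₀) ∧
      (Prefers p cost a i j (chordStart z) ↔ ¬Prefers p cost a i j (chordEnd z)) := by
  obtain ⟨hl, hP⟩ := hx₀
  obtain ⟨s, hs⟩ := mem_affineSpan_pair_iff_exists_lineMap_eq.1 hl
  have hne : z.1 ≠ z.2 := by
    intro h
    rw [← h, AffineMap.lineMap_same_apply] at hs
    rw [hs] at hadv
    exact hadv h0
  have hcpt := isCompact_chordParams hne
  set S := {s : ℝ | AffineMap.lineMap z.1 z.2 s ∈ probSimplex (d + 1)} with hS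
  -- Positivity of the coordinates is an open condition, and the coordinate sum is 1 along the whole
  -- line.
  have hsS : S ∈ nhds s := by
    have hev : ∀ᶠ r in nhds s, ∀ l, 0 < (AffineMap.lineMap z.1 z.2 r : Vec (d + 1)) l := by
      rw [Filter.eventually_all]
      intro l
      have hcont : Continuous fun r : ℝ => (AffineMap.lineMap z.1 z.2 r : Vec (d + 1)) l :=
        (EuclideanSpace.proj (𝕜 := ℝ) l).continuous.comp AffineMap.lineMap_continuous
      exact hcont.continuousAt.eventually_const_lt (by simpa only [hs] using hpos l)
    filter_upwards [hev] with r hr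
    refine ⟨fun l => (hr l).le, ?_⟩
    have e1 : ∀ r : ℝ, ∑ l, (AffineMap.lineMap z.1 z.2 r : Vec (d + 1)) l =
        (1 - r) * ∑ l, z.1 l + r * ∑ l, z.2 l := by
      intro r
      simp [AffineMap.lineMap_apply_module, Finset.sum_add_distrib, Finset.mul_sum]
    have e2 := hP.2
    rw [← hs, e1, hz.2] at e2
    have e3 : s * (∑ l, z.2 l - 1) = 0 := by linarith
    rw [e1, hz.2]
    rcases mul_eq_zero.1 e3 with e | e
    · exfalso
      rw [e, AffineMap.lineMap_apply_zero] at hs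
      rw [hs] at hadv
      exact hadv h0
    · rw [show ∑ l, z.2 l = 1 by linarith]; ring
  obtain ⟨δ, hδ, hball⟩ := Metric.mem_nhds_iff.1 hsS
  have l1 : sInf S < s := by
    have : s - δ / 2 ∈ S := hball (by simp [abs_of_pos hδ, hδ])
    linarith [csInf_le hcpt.bddBelow this]
  have l2 : s < sSup S := by
    have : s + δ / 2 ∈ S := hball (by simp [abs_of_pos hδ, hδ])
    linarith [le_csSup hcpt.bddAbove this]
  set s₁ := sInf S
  set s₂ := sSup S
  have hstart : chordStart z = AffineMap.lineMap z.1 z.2 s₁ := rfl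
  have hend : chordEnd z = AffineMap.lineMap z.1 z.2 s₂ := rfl
  constructor
  · refine ⟨(s - s₁) / (s₂ - s₁), div_nonneg (by linarith) (by linarith),
      (div_le_one (by linarith)).2 (by linarith), ?_⟩
    rw [hstart, hend, ← hs]
    have hd0 : s₂ - s₁ ≠ 0 := by linarith
    simp only [AffineMap.lineMap_apply_module']
    have : s = s₁ + (s - s₁) / (s₂ - s₁) * (s₂ - s₁) := by field_simp; ring
    conv_rhs => rw [this]
    module
  · rw [← hs, adv_lineMap] at h0
    set A := adv p cost i j z.1
    set B := adv p cost i j z.2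
    have f1 : adv p cost i j (chordStart z) = (s - s₁) * (A - B) := by
      rw [hstart, adv_lineMap]; linear_combination h0
    have f2 : adv p cost i j (chordEnd z) = (s - s₂) * (A - B) := by
      rw [hend, adv_lineMap]; linear_combination h0
    have hAB : A - B ≠ 0 := by
      intro h
      apply hadv
      linear_combination h0 + s * h
    unfold Prefers
    rw [f1, f2]
    rcases lt_or_gt_of_ne hAB with h | h
    · have g1 : (s - s₁) * (A - B) < 0 := mul_neg_of_pos_of_neg (by linarith) h
      have g2 : 0 < (s - s₂) * (A - B) := mul_pos_of_neg_of_neg (by linarith) h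
      simp [g2, g1.ne, not_lt.2 g1.le]
    · have g1 : 0 < (s - s₁) * (A - B) := mul_pos (by linarith) h
      have g2 : (s - s₂) * (A - B) < 0 := mul_neg_of_neg_of_pos (by linarith) h
      simp [g1, g2.ne, not_lt.2 g2.le]

/-- If a third action k is played at `w`, then at `x₀` the action `i` leads k by at most ρ‖p_i −
p_k‖ and `j` leads it by at most ρ‖p_j − p_k‖. The two leads agree at `x₀`, so the smaller bound
applies; hence the minimum in `goodSurface`. -/
lemma response_of_near (ha : IsBestResponse p cost a) {ρ : ℝ} {x₀ w : Vec (d + 1)}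
    (hx₀ : x₀ ∈ goodSurface p cost ρ i j) (hw : ‖w - x₀‖ ≤ ρ) : a w = i ∨ a w = j := by
  by_contra hcon
  push Not at hcon
  obtain ⟨-, -, h0, hk⟩ := hx₀
  have h1 := hk (a w) hcon.1 hcon.2
  have h2 : ∀ l, adv p cost l (a w) x₀ ≤ ρ * ‖p l - p (a w)‖ := by
    intro l
    have h3 := ha.adv_nonneg w l
    rw [adv_swap] at h3
    have h4 := adv_sub p cost l (a w) x₀ w
    have h5 : inner ℝ (x₀ - w) (p l - p (a w)) ≤ ‖w - x₀‖ * ‖p l - p (a w)‖ := by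
      rw [norm_sub_rev]; exact real_inner_le_norm _ _
    have h6 : ‖w - x₀‖ * ‖p l - p (a w)‖ ≤ ρ * ‖p l - p (a w)‖ := by gcongr
    linarith
  have h7 := h2 i
  have h8 := h2 j
  rw [← adv_add p cost i j, h0, zero_add] at h7 h1
  rcases min_cases ‖p i - p (a w)‖ ‖p j - p (a w)‖ with h | h
  · rw [h.1] at h1; linarith
  · rw [h.1] at h1; linarith

/-- A line which meets the good part of the surface between two regions leads to a simplex
that separates the two regions, for every tuple that is consistent with the memory. -/
lemma exists_located (hd : 1 ≤ d) (ha : IsBestResponse p cost a) (hij : i ≠ j) {c ε : ℝ}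
    (hc : 0 < c) (hε : 0 < ε) {z : Vec (d + 1) × Vec (d + 1)} {x₀ : Vec (d + 1)}
    (hx₀ : x₀ ∈ chord z) (hg : x₀ ∈ goodSurface p cost (√(d : ℝ) * (c + ε)) i j)
    (hz : z.1 ∈ probSimplex (d + 1)) (hadv : ∀ i j, i ≠ j → adv p cost i j z.1 ≠ 0)
    {F : ℕ → Fin (d + 1) → Vec (d + 1)} (hF : ∀ k, IsCenteredSimplex c (F k))
    {M : Set (Vec (d + 1) × Fin N)} (hM : ∀ w ∈ samplePoints a ε z F, (w, a w) ∈ M)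
    {q : Fin N → Vec (d + 1)} (hq : q ∈ feasible cost M) :
    ∃ (m e : Vec (d + 1)) (v : Fin (d + 1) → Vec (d + 1)) (A : Set (Fin (d + 1))),
      m ∈ probSimplex (d + 1) ∧ ∑ l, e l = 0 ∧ ‖WithLp.ofLp e‖ ≤ ε ∧ ‖m - x₀‖ ≤ ‖e‖ / 2 ∧
      Located ε c (p i - p j) (q i - q j) (cost i - cost j) m v A := by
  obtain ⟨⟨t, ht0, ht1, ht⟩, hpref⟩ := exists_lineMap_chord (a := a) hx₀ hg.2.1 hz (hadv i j hij)
    hg.2.2.1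
  have hd1 : (1 : ℝ) ≤ d := by exact_mod_cast hd
  have hsd : 1 ≤ √(d : ℝ) := Real.one_le_sqrt.2 hd1
  obtain ⟨s, hs, hs1, hs2, ⟨r, hr0, hr1, hr⟩, hlen⟩ := exists_mem_searchAll ha hij
    (halvings ε (chordStart z) (chordEnd z)) (noTies_chord hz hadv) ht0 ht1 ht hg.2.2.1
    (fun k hki hkj => lt_of_le_of_lt (by positivity) (hg.2.2.2 k hki hkj)) hpref
    (chordStart_mem hz) (chordEnd_mem hz)
  have hse : ‖WithLp.ofLp (s.1 - s.2)‖ ≤ ε := by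
    have h1 := norm_ofLp_le_mul_two_pow hε (chordStart z) (chordEnd z)
    rw [← hlen] at h1
    exact le_of_mul_le_mul_right h1 (by positivity)
  obtain ⟨k, hk⟩ := List.mem_iff_getElem?.1 hs
  set m := midpoint ℝ s.1 s.2 with hm
  have hmx : ‖m - x₀‖ ≤ ‖s.1 - s.2‖ / 2 := by
    have : m - x₀ = (r - 1 / 2) • (s.1 - s.2) := by
      rw [hm, ← hr, midpoint_eq_smul_add, AffineMap.lineMap_apply_module, invOf_eq_inv]; module
    rw [this, norm_smul, Real.norm_eq_abs]
    have : |r - 1 / 2| ≤ 1 / 2 := abs_le.2 ⟨by linarith, by linarith⟩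
    nlinarith [norm_nonneg (s.1 - s.2)]
  -- Half of the segment has length at most √(d+1) ε/2 ≤ √d ε, and a vertex is at distance at most c
  -- from `m`. This determines the radius √d (c + ε).
  have hnear : ∀ r, m + F k r ∈ Metric.closedBall x₀ (√(d : ℝ) * (c + ε)) := by
    intro r
    rw [mem_closedBall_iff_norm]
    have h1 : m + F k r - x₀ = (m - x₀) + F k r := by abel
    have h2 := (hF k).norm_le hc.le r
    have h3 : ‖s.1 - s.2‖ ≤ √((d + 1 : ℕ) : ℝ) * ε :=
      (norm_le_sqrt_mul_norm_ofLp _).trans (by gcongr)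
    have h4 : √((d + 1 : ℕ) : ℝ) ≤ 2 * √(d : ℝ) := by
      rw [show 2 * √(d : ℝ) = √(4 * d) by
        rw [Real.sqrt_mul (by norm_num), show (4 : ℝ) = 2 ^ 2 by norm_num,
          Real.sqrt_sq (by norm_num)]]
      apply Real.sqrt_le_sqrt; push_cast; linarith
    have h5 : √((d + 1 : ℕ) : ℝ) * ε ≤ 2 * √(d : ℝ) * ε := by gcongr
    have h6 : c ≤ √(d : ℝ) * c := by nlinarith
    rw [h1]
    refine (norm_add_le _ _).trans ?_
    rw [mul_add]; linarith
  have hresp : ∀ w ∈ Metric.closedBall x₀ (√(d : ℝ) * (c + ε)), a w = i ∨ a w = j :=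
    fun w hw => response_of_near ha hg (mem_closedBall_iff_norm.1 hw)
  -- The ball is convex, so whole edges see only the two responses.
  have hedge : ∀ (r r' : Fin (d + 1)) (s : ℝ), 0 ≤ s → s ≤ 1 →
      a (AffineMap.lineMap (m + F k r) (m + F k r') s) = i ∨
      a (AffineMap.lineMap (m + F k r) (m + F k r') s) = j := by
    intro r r' s h0 h1
    apply hresp
    exact (convex_closedBall _ _).lineMap_mem (hnear r) (hnear r') ⟨h0, h1⟩
  have hposp : ∀ w, a w = i → cost i - cost j ≤ inner ℝ w (p i - p j) := fun w hw => by
    have := ha w j; rwa [hw] at this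
  have hnegp : ∀ w, a w = j → inner ℝ w (p i - p j) ≤ cost i - cost j := fun w hw => by
    have := ha w i
    rw [hw, ← neg_sub (p i), inner_neg_right] at this
    linarith
  have hposq : ∀ w ∈ samplePoints a ε z F, a w = i → cost i - cost j ≤ inner ℝ w (q i - q j) :=
    fun w hw hwi => by
      have := hq.2.1 _ (hM w hw) j (by simpa [hwi] using hij.symm)
      simpa [hwi] using this
  have hnegq : ∀ w ∈ samplePoints a ε z F, a w = j → inner ℝ w (q i - q j) ≤ cost i - cost j :=
    fun w hw hwj => by
      have := hq.2.1 _ (hM w hw) i (by simpa [hwj] using hij)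
      simp only [hwj] at this
      rw [← neg_sub (q i), inner_neg_right] at this
      linarith
  have hshort : ∀ (x y : Vec (d + 1)) (s t : ℝ), (t - s) * 2 ^ halvings ε x y = 1 →
      (t - s) * ‖WithLp.ofLp (x - y)‖ ≤ ε := by
    intro x y s t h1
    have h2 := norm_ofLp_le_mul_two_pow hε x y
    have h3 : 0 < t - s := by
      by_contra hcon
      have := mul_nonpos_of_nonpos_of_nonneg (not_lt.1 hcon)
        (by positivity : (0 : ℝ) ≤ 2 ^ halvings ε x y)
      linarith
    calc (t - s) * ‖WithLp.ofLp (x - y)‖ ≤ (t - s) * (ε * 2 ^ halvings ε x y) := by gcongr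
      _ = ε * ((t - s) * 2 ^ halvings ε x y) := by ring
      _ = ε := by rw [h1, mul_one]
  refine ⟨m, s.1 - s.2, F k, {r | a (m + F k r) = i},
    (convex_probSimplex _).segment_subset hs1 hs2 (midpoint_mem_segment _ _),
    by simp [Finset.sum_sub_distrib, hs1.2, hs2.2], hse, hmx, hF k, fun r hr => hposp _ hr,
    fun r hr => hnegp _ ((hresp _ (hnear r)).resolve_left hr), ?_⟩
  intro r hr r' hr'
  have hr2 : a (m + F k r') = j := (hresp _ (hnear r')).resolve_left hr'
  have hr1 : a (m + F k r) = i := hr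
  have hne : a (m + F k r) ≠ a (m + F k r') := by rw [hr1, hr2]; exact hij
  rcases lt_trichotomy r r' with hlt | heq | hlt
  · obtain ⟨s', t', h1, h2, h3, h4, h5, h6, h7⟩ := searchOne_spec a
      (halvings ε (m + F k r) (m + F k r')) hne
    rw [hr1] at h6 h7
    have h8 := (hedge r r' t' (by linarith) h3).resolve_left h7
    have m1 : AffineMap.lineMap (m + F k r) (m + F k r') s' ∈ samplePoints a ε z F :=
      ⟨k, s, hk, Or.inr (Or.inr ⟨r, r', hlt, hne, Or.inl (congrArg Prod.fst h5).symm⟩)⟩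
    have m2 : AffineMap.lineMap (m + F k r) (m + F k r') t' ∈ samplePoints a ε z F :=
      ⟨k, s, hk, Or.inr (Or.inr ⟨r, r', hlt, hne, Or.inr (congrArg Prod.snd h5).symm⟩)⟩
    exact ⟨s', t', h1, h2, h3, hshort _ _ _ _ h4, hposp _ h6, hnegp _ h8, hposq _ m1 h6,
      hnegq _ m2 h8⟩
  · exact absurd (by rw [heq]) hne
  -- Edges are searched from the smaller index to the larger, here against the direction wanted; the
  -- parameters are reversed.
  · obtain ⟨s', t', h1, h2, h3, h4, h5, h6, h7⟩ := searchOne_spec a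
      (halvings ε (m + F k r') (m + F k r)) hne.symm
    rw [hr2] at h6 h7
    have h8 := (hedge r' r t' (by linarith) h3).resolve_right h7
    have m1 : AffineMap.lineMap (m + F k r') (m + F k r) s' ∈ samplePoints a ε z F :=
      ⟨k, s, hk, Or.inr (Or.inr ⟨r', r, hlt, hne.symm, Or.inl (congrArg Prod.fst h5).symm⟩)⟩
    have m2 : AffineMap.lineMap (m + F k r') (m + F k r) t' ∈ samplePoints a ε z F :=
      ⟨k, s, hk, Or.inr (Or.inr ⟨r', r, hlt, hne.symm, Or.inr (congrArg Prod.snd h5).symm⟩)⟩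
    refine ⟨1 - t', 1 - s', by linarith, by linarith, by linarith, ?_, ?_⟩
    · rw [← neg_sub (m + F k r'), WithLp.ofLp_neg, norm_neg]
      convert hshort _ _ _ _ h4 using 2; ring
    · simp only [AffineMap.lineMap_apply_one_sub]
      exact ⟨hposp _ h8, hnegp _ h6, hposq _ m2 h8, hnegq _ m1 h6⟩

end SimplexSearch

namespace SimplexSearch

/-! ### The two-dimensional simplex -/

lemma sum_fin_three (x : Vec 3) : ∑ l, x l = x 0 + x 1 + x 2 := Fin.sum_univ_three _

lemma inner_fin_three (x y : Vec 3) : inner ℝ x y = x 0 * y 0 + x 1 * y 1 + x 2 * y 2 := by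
  rw [inner_eq_sum, Fin.sum_univ_three]

/-- A vector in the plane spanned by `x` and `y`, in terms of its inner products with them. -/
lemma norm_sq_gram {x y D : Vec 3} (hx : ∑ l, x l = 0) (hy : ∑ l, y l = 0) (hD : ∑ l, D l = 0) :
    ‖inner ℝ D x • y - inner ℝ D y • x‖ ^ 2 =
      ‖D‖ ^ 2 * (‖x‖ ^ 2 * ‖y‖ ^ 2 - inner ℝ x y ^ 2) := by
  rw [sum_fin_three] at hx hy hD
  have ex : x 2 = -x 0 - x 1 := by linarith
  have ey : y 2 = -y 0 - y 1 := by linarith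
  have eD : D 2 = -D 0 - D 1 := by linarith
  simp only [← real_inner_self_eq_norm_sq, inner_fin_three, PiLp.sub_apply, PiLp.smul_apply,
    smul_eq_mul, ex, ey, eD]
  ring

/-- The sides of an equilateral triangle in the plane `∑ l, x l = 0` arise from each other by a
cyclic shift. -/
lemma shift_of_equilateral {x y : Vec 3} {c : ℝ} (hc : 0 < c) (hx : ∑ l, x l = 0)
    (hy : ∑ l, y l = 0) (hxx : ‖x‖ ^ 2 = 2 * c ^ 2) (hyy : ‖y‖ ^ 2 = 2 * c ^ 2)
    (hxy : inner ℝ x y = c ^ 2) :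
    (∀ l, y l = -x (l + 1)) ∨ ∀ l, y l = -x (l + 2) := by
  suffices h : (y 0 = -x 1 ∧ y 1 = -x 2 ∧ y 2 = -x 0) ∨
      (y 0 = -x 2 ∧ y 1 = -x 0 ∧ y 2 = -x 1) by
    rcases h with ⟨e0, e1, e2⟩ | ⟨e0, e1, e2⟩
    · left; intro l; fin_cases l <;> assumption
    · right; intro l; fin_cases l <;> assumption
  rw [← real_inner_self_eq_norm_sq] at hxx hyy
  rw [inner_fin_three] at hxx hyy hxy
  rw [sum_fin_three] at hx hy
  have ex : x 2 = -x 0 - x 1 := by linarith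
  have ey : y 2 = -y 0 - y 1 := by linarith
  rw [ex] at hxx hxy ⊢
  rw [ey] at hyy hxy ⊢
  generalize x 0 = a at *
  generalize x 1 = b at *
  generalize y 0 = u at *
  generalize y 1 = v at *
  have h1 : (a * v - b * u - c ^ 2) * (a * v - b * u + c ^ 2) = 0 := by
    have h2 : 3 * (a * v - b * u) ^ 2 = 3 * (c ^ 2) ^ 2 := by
      have h3 : 3 * (a * v - b * u) ^ 2 =
          (a * a + b * b + (-a - b) * (-a - b)) * (u * u + v * v + (-u - v) * (-u - v)) -
          (a * u + b * v + (-a - b) * (-u - v)) ^ 2 := by ring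
      rw [h3, hxx, hyy, hxy]; ring
    linarith
  have hc2 : 2 * c ^ 2 ≠ 0 := by positivity
  have e1 : a * a + a * b + b * b = c ^ 2 := by linarith
  have e2 : 2 * a * u + 2 * b * v + a * v + b * u = c ^ 2 := by linarith
  rcases mul_eq_zero.1 h1 with h | h
  · left
    have hu : u = -b := by
      have : 2 * c ^ 2 * (u + b) = 0 := by
        linear_combination (2 * u + 2 * b) * (-e1) + a * e2 - (a + 2 * b) * h + 2 * b * e1
      rcases mul_eq_zero.1 this with h | h
      · exact absurd h hc2
      · linarith
    have hv : v = a + b := by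
      have : 2 * c ^ 2 * (v - (a + b)) = 0 := by
        linear_combination (2 * v - 2 * (a + b)) * (-e1) + b * e2 + (2 * a + b) * h -
          2 * (a + b) * e1
      rcases mul_eq_zero.1 this with h | h
      · exact absurd h hc2
      · linarith
    exact ⟨hu, by linarith, by linarith⟩
  · right
    have hu : u = a + b := by
      have : 2 * c ^ 2 * (u - (a + b)) = 0 := by
        linear_combination (2 * u - 2 * (a + b)) * (-e1) + a * e2 - (a + 2 * b) * h -
          2 * (a + b) * e1
      rcases mul_eq_zero.1 this with h | h
      · exact absurd h hc2
      · linarith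
    have hv : v = -a := by
      have : 2 * c ^ 2 * (v + a) = 0 := by
        linear_combination (2 * v + 2 * a) * (-e1) + b * e2 + (2 * a + b) * h + 2 * a * e1
      rcases mul_eq_zero.1 this with h | h
      · exact absurd h hc2
      · linarith
    exact ⟨by linarith, hv, by linarith⟩

/-- According to the signs the sum is ±(u − w) or ±(u − 2v + w), and the latter equals ∓3v because
the three numbers sum to zero. -/
lemma abs_sub_add_abs_sub_le {u v w ε : ℝ} (hsum : u + v + w = 0) (hu : |u| ≤ ε) (hv : |v| ≤ ε)
    (hw : |w| ≤ ε) : |u - v| + |v - w| ≤ 3 * ε := by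
  have h0 := abs_le.1 hu
  have h1 := abs_le.1 hv
  have h2 := abs_le.1 hw
  rcases abs_cases (u - v) with h | h <;> rcases abs_cases (v - w) with h' | h' <;> linarith

lemma abs_sub_shift_le {f : Fin 3 → ℝ} {ε : ℝ} (hsum : f 0 + f 1 + f 2 = 0)
    (hf : ∀ l, |f l| ≤ ε) (l k : Fin 3) :
    |f l - f k| + |f (l + 1) - f (k + 1)| ≤ 3 * ε := by
  have hε : 0 ≤ ε := (abs_nonneg _).trans (hf 0)
  have h01 := abs_sub_add_abs_sub_le hsum (hf 0) (hf 1) (hf 2)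
  have h12 := abs_sub_add_abs_sub_le (by linarith) (hf 1) (hf 2) (hf 0)
  have h20 := abs_sub_add_abs_sub_le (by linarith) (hf 2) (hf 0) (hf 1)
  by_cases hlk : l = k
  · subst hlk; simp [hε]
  fin_cases l <;> fin_cases k
  · exact absurd rfl hlk
  · exact h01
  · rw [abs_sub_comm, abs_sub_comm (f (_ + 1))]; exact h20
  · rw [abs_sub_comm, abs_sub_comm (f (_ + 1))]; exact h01
  · exact absurd rfl hlk
  · exact h12
  · exact h20
  · rw [abs_sub_comm, abs_sub_comm (f (_ + 1))]; exact h12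
  · exact absurd rfl hlk

/-- The triangle inequality would give 4ε. Since `y` is a cyclic shift of −`x`, the two
contributions are differences of neighboring coordinate pairs of one vector with sum zero, which
saves ε; the sharp plane bound needs this. -/
lemma inner_smul_sub_smul_le {x y a b : Vec 3} {c ε κ κ' : ℝ} (hc : 0 < c) (hx : ∑ l, x l = 0)
    (hy : ∑ l, y l = 0) (hxx : ‖x‖ ^ 2 = 2 * c ^ 2) (hyy : ‖y‖ ^ 2 = 2 * c ^ 2)
    (hxy : inner ℝ x y = c ^ 2) (ha : a ∈ probSimplex 3) (hb : b ∈ probSimplex 3)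
    (hκ : |κ| * ‖WithLp.ofLp x‖ ≤ ε) (hκ' : |κ'| * ‖WithLp.ofLp y‖ ≤ ε) :
    inner ℝ (κ • x - κ' • y) (a - b) ≤ 3 * ε := by
  have hε : 0 ≤ ε := le_trans (by positivity) hκ
  have hshift := shift_of_equilateral hc hx hy hxx hyy hxy
  have hfx : ∀ l, |κ| * |x l| ≤ ε := fun l =>
    le_trans (mul_le_mul_of_nonneg_left (abs_apply_le_norm_ofLp x l) (abs_nonneg _)) hκ
  have hfy : ∀ l, |κ'| * |y l| ≤ ε := fun l =>
    le_trans (mul_le_mul_of_nonneg_left (abs_apply_le_norm_ofLp y l) (abs_nonneg _)) hκ'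
  have hfy' : ∀ l, |κ'| * |x l| ≤ ε := by
    intro l
    rcases hshift with h | h
    · have := hfy (l + 2)
      rwa [h, abs_neg, add_assoc, show (2 : Fin 3) + 1 = 0 from rfl, add_zero] at this
    · have := hfy (l + 1)
      rwa [h, abs_neg, add_assoc, show (1 : Fin 3) + 2 = 0 from rfl, add_zero] at this
  set K := max |κ| |κ'| with hK
  have hK0 : 0 ≤ K := le_max_of_le_left (abs_nonneg _)
  have hKx : ∀ l, |K * x l| ≤ ε := by
    intro l
    rw [abs_mul, abs_of_nonneg hK0]
    rcases max_cases |κ| |κ'| with h | h <;> rw [hK, h.1]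
    · exact hfx l
    · exact hfy' l
  rw [sum_fin_three] at hx
  have hKs : K * x 0 + K * x 1 + K * x 2 = 0 := by rw [← mul_add, ← mul_add, hx, mul_zero]
  have hsh : ∀ l k, K * (|x l - x k| + |x (l + 1) - x (k + 1)|) ≤ 3 * ε := by
    intro l k
    have := abs_sub_shift_le (f := fun l => K * x l) hKs hKx l k
    simpa only [← mul_sub, abs_mul, abs_of_nonneg hK0, ← mul_add] using this
  have hgen : ∀ u w : ℝ, κ * u + κ' * w ≤ K * (|u| + |w|) := by
    intro u w
    calc κ * u + κ' * w ≤ |κ * u| + |κ' * w| := add_le_add (le_abs_self _) (le_abs_self _)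
      _ ≤ K * |u| + K * |w| := by
          rw [abs_mul, abs_mul]
          gcongr
          · exact le_max_left _ _
          · exact le_max_right _ _
      _ = _ := by ring
  refine inner_sub_le_of_forall ha hb fun l k => ?_
  simp only [PiLp.sub_apply, PiLp.smul_apply, smul_eq_mul]
  have h3 : κ * x l - κ' * y l - (κ * x k - κ' * y k) =
      κ * (x l - x k) + κ' * (y k - y l) := by ring
  rw [h3]
  refine (hgen _ _).trans ?_
  rcases hshift with h | h
  · rw [h, h, neg_sub_neg]
    exact hsh l k
  · rw [h, h, neg_sub_neg, add_comm |x l - x k|]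
    have := hsh (l + 2) (k + 2)
    rwa [add_assoc l, add_assoc k, show (2 : Fin 3) + 1 = 0 from rfl, add_zero, add_zero] at this

/-- Two coordinates have the same sign, so their squares sum to at most the square of the third. -/
lemma norm_sq_le_of_sum_eq_zero {e : Vec 3} {ε : ℝ} (he : ∑ l, e l = 0)
    (h : ‖WithLp.ofLp e‖ ≤ ε) : ‖e‖ ^ 2 ≤ 2 * ε ^ 2 := by
  have hε : 0 ≤ ε := (norm_nonneg _).trans h
  have hb : ∀ l, e l ^ 2 ≤ ε ^ 2 := fun l => by
    rw [← sq_abs]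
    exact pow_le_pow_left₀ (abs_nonneg _) ((abs_apply_le_norm_ofLp e l).trans h) 2
  have h0 := hb 0
  have h1 := hb 1
  have h2 := hb 2
  rw [norm_sq_eq_sum, Fin.sum_univ_three]
  rw [sum_fin_three] at he
  generalize e 0 = x at *
  generalize e 1 = y at *
  generalize e 2 = z at *
  by_cases hxy : 0 ≤ x * y
  · have : z = -x - y := by linarith
    subst this; nlinarith
  · by_cases hyz : 0 ≤ y * z
    · have : x = -y - z := by linarith
      subst this; nlinarith
    · have hxz : 0 ≤ x * z := by
        have h3 : 0 < (x * y) * (y * z) := mul_pos_of_neg_of_neg (not_le.1 hxy) (not_le.1 hyz)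
        have h4 : 0 < y ^ 2 * (x * z) := by convert h3 using 1; ring
        exact (pos_of_mul_pos_right h4 (sq_nonneg y)).le
      have : y = -x - z := by linarith
      subst this; nlinarith

/-- A line passing close to the centroid of an equilateral triangle cuts it in a long segment. -/
lemma le_three_mul_of_near_centroid {s t ρ ℓ : ℝ} (hs : 0 < s) (ht : 0 < t) (hℓ : 0 ≤ ℓ)
    (hℓ2 : ℓ ^ 2 = s ^ 2 + t ^ 2 - s * t) (hρ : 0 ≤ ρ) (hρ1 : 3 * ρ ^ 2 < 1)
    (h : (s + t - 3 * (s * t)) ^ 2 ≤ 3 * ρ ^ 2 * ℓ ^ 2) : 2 - √3 * ρ ≤ 3 * ℓ := by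
  have h3 : √3 ^ 2 = 3 := Real.sq_sqrt (by norm_num)
  have hst : 0 < s * t := mul_pos hs ht
  have h1 : s + t - 3 * (s * t) ≤ √3 * ρ * ℓ := by
    refine abs_le_of_sq_le_sq' ?_ (by positivity) |>.2
    rw [mul_pow, mul_pow, h3]; exact h
  have hρ3 : √3 * ρ < 1 := by
    refine abs_lt_of_sq_lt_sq' ?_ (by norm_num) |>.2
    rw [mul_pow, h3]; linarith
  have h4 : ℓ ≤ s + t := abs_le_of_sq_le_sq' (by nlinarith) (by positivity) |>.2
  have h5 : s + t ≤ 2 * ℓ :=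
    abs_le_of_sq_le_sq' (by nlinarith [sq_nonneg (s - t)]) (by positivity) |>.2
  have hℓp : 0 < ℓ := by linarith
  -- With ℓ ≤ s + t ≤ 2ℓ the relation ℓ² = (s + t)² − 3st becomes an inequality linear in s + t.
  have h6 : 0 ≤ (s + t - ℓ) * (2 * ℓ - (s + t)) := mul_nonneg (by linarith) (by linarith)
  have h7 : (s + t) * (1 - 3 * ℓ) + 3 * ℓ ^ 2 ≤ √3 * ρ * ℓ := by nlinarith
  rcases le_or_gt (3 * ℓ) 1 with hl | hl
  · have h8 : ℓ * (1 - 3 * ℓ) ≤ (s + t) * (1 - 3 * ℓ) := by gcongr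
    have h9 : √3 * ρ * ℓ < 1 * ℓ := by gcongr
    nlinarith
  · have h8 : 2 * ℓ * (1 - 3 * ℓ) ≤ (s + t) * (1 - 3 * ℓ) :=
      mul_le_mul_of_nonpos_right h5 (by linarith)
    have h9 : ℓ * (2 - 3 * ℓ) ≤ ℓ * (√3 * ρ) := by nlinarith
    linarith [le_of_mul_le_mul_left h9 hℓp]

/-- By the intermediate value theorem the second hyperplane crosses the edge in the same short
piece; `κ` is the parameter shift from the first crossing to the second. -/
lemma CrossedEdge.exists_error {n : ℕ} {ε C s : ℝ} {g g' x y : Vec n}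
    (h : CrossedEdge ε g g' C x y) (hlt : inner ℝ y g < inner ℝ x g)
    (hs : inner ℝ (AffineMap.lineMap x y s) g = C) :
    ∃ κ : ℝ, |κ| * ‖WithLp.ofLp (x - y)‖ ≤ ε ∧
      inner ℝ (AffineMap.lineMap x y s) g' - C = κ * inner ℝ (x - y) g' := by
  obtain ⟨s', t', h1, h2, h3, h4, h5, h6, h7, h8⟩ := h
  rw [inner_lineMap] at h5 h6 hs
  have hs1 : s' ≤ s := by
    have : 0 ≤ (s - s') * (inner ℝ x g - inner ℝ y g) := by linarith
    have := nonneg_of_mul_nonneg_left this (by linarith)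
    linarith
  have hs2 : s ≤ t' := by
    have : 0 ≤ (t' - s) * (inner ℝ x g - inner ℝ y g) := by linarith
    have := nonneg_of_mul_nonneg_left this (by linarith)
    linarith
  have hcont : ContinuousOn (fun r : ℝ => inner ℝ (AffineMap.lineMap x y r : Vec n) g')
      (Set.Icc s' t') :=
    ((AffineMap.lineMap_continuous (p := x) (q := y)).inner continuous_const).continuousOn
  obtain ⟨r, hr, hrC⟩ := intermediate_value_Icc' h2.le hcont ⟨h8, h7⟩
  refine ⟨r - s, le_trans ?_ h4, ?_⟩
  · gcongr
    exact abs_le.2 ⟨by linarith [hr.1], by linarith [hr.2]⟩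
  · simp only at hrC
    rw [← hrC, inner_lineMap, inner_lineMap, inner_sub_left]; ring

/-- If all values were nonpositive, the sum of their squares would be at most the square of their
sum. By the frame identity the hyperplane would then be too far from the centroid. -/
lemma Located.exists_mem {ε c C : ℝ} (hc : 0 < c) (hεc : 5 * ε ^ 2 < c ^ 2)
    {g g' m e : Vec (2 + 1)} {v : Fin (2 + 1) → Vec (2 + 1)} {A : Set (Fin (2 + 1))}
    (hg : ∑ l, g l = 0) (hg0 : g ≠ 0) (he : ∑ l, e l = 0) (he1 : ‖WithLp.ofLp e‖ ≤ ε)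
    (hmg : |inner ℝ m g - C| ≤ ‖e‖ / 2 * ‖g‖) (h : Located ε c g g' C m v A) :
    ∃ r ∈ A, 0 < inner ℝ (m + v r) g - C := by
  have hG : 0 < ‖g‖ := norm_pos_iff.2 hg0
  by_contra hcon
  push Not at hcon
  have hle : ∀ r, inner ℝ (m + v r) g - C ≤ 0 := fun r => by
    by_cases hr : r ∈ A
    · exact hcon r hr
    · linarith [h.nonpos r hr]
  have h1 := h.simplex.sum_adv m g C
  have h2 := h.simplex.sum_adv_sq hc hg C (m := m)
  rw [Fin.sum_univ_three] at h1 h2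
  have l0 := hle 0
  have l1 := hle 1
  have l2 := hle 2
  set x := inner ℝ (m + v 0) g - C
  set y := inner ℝ (m + v 1) g - C
  set z := inner ℝ (m + v 2) g - C
  have h3 : (inner ℝ m g - C) ^ 2 ≤ ε ^ 2 / 2 * ‖g‖ ^ 2 := by
    rw [← sq_abs]
    calc |inner ℝ m g - C| ^ 2 ≤ (‖e‖ / 2 * ‖g‖) ^ 2 := by gcongr
      _ = ‖e‖ ^ 2 / 4 * ‖g‖ ^ 2 := by ring
      _ ≤ (2 * ε ^ 2) / 4 * ‖g‖ ^ 2 := by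
          gcongr; exact norm_sq_le_of_sum_eq_zero he he1
      _ = _ := by ring
  have h4 : x ^ 2 + y ^ 2 + z ^ 2 ≤ (x + y + z) ^ 2 := by
    nlinarith [mul_nonneg_of_nonpos_of_nonpos l0 l1, mul_nonneg_of_nonpos_of_nonpos l0 l2,
      mul_nonneg_of_nonpos_of_nonpos l1 l2]
  rw [h1, h2] at h4
  push_cast at h4
  have h5 : c ^ 2 * ‖g‖ ^ 2 ≤ 3 * ε ^ 2 * ‖g‖ ^ 2 := by nlinarith
  have h6 : c ^ 2 ≤ 3 * ε ^ 2 := le_of_mul_le_mul_right h5 (by positivity)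
  nlinarith [sq_nonneg ε]

end SimplexSearch

/-! ### The two-dimensional bound with the required constant. -/

namespace SimplexSearch

/-- The constant is 2.4703 = 3 · 0.8201 + 2 · 0.005, the coefficient of ε in the error estimate for
the Gram identity. -/
lemma length_bound {c ε ℓ : ℝ} (hc : 0 < c) (hε : 0 < ε) (hεc : 5 * ε ^ 2 < c ^ 2)
    (hℓ : 2 - √3 * (ε / c) ≤ 3 * ℓ) : √(c ^ 2 - ε ^ 2) * 2.4703 ≤ 4 * (√2 * c * ℓ) := by
  set ρ := ε / c with hρ
  have hερ : ε = ρ * c := by rw [hρ]; field_simp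
  have hρ0 : 0 < ρ := div_pos hε hc
  have hρ1 : 5 * ρ ^ 2 < 1 := by
    rw [hρ, div_pow, ← mul_div_assoc, div_lt_one (by positivity)]; exact hεc
  have hρ2 : ρ < 0.4473 := by nlinarith
  have h1 : √(c ^ 2 - ε ^ 2) ≤ c * (1 - ρ ^ 2 / 2) := by
    rw [Real.sqrt_le_left (mul_nonneg hc.le (by nlinarith)), hερ]
    nlinarith [sq_nonneg (c * ρ ^ 2)]
  have h2 : 1.4142 ≤ √2 := Real.le_sqrt_of_sq_le (by norm_num)
  have h3 : √3 ≤ 1.7321 := by rw [Real.sqrt_le_left (by norm_num)]; norm_num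
  have h4 : 2 - 1.7321 * ρ ≤ 3 * ℓ := by nlinarith
  have h5 : (1 - ρ ^ 2 / 2) * 2.4703 ≤ 4 * (1.4142 * ℓ) := by nlinarith
  have hℓ0 : 0 ≤ ℓ := by nlinarith
  calc √(c ^ 2 - ε ^ 2) * 2.4703 ≤ c * (1 - ρ ^ 2 / 2) * 2.4703 := by gcongr
    _ = c * ((1 - ρ ^ 2 / 2) * 2.4703) := by ring
    _ ≤ c * (4 * (1.4142 * ℓ)) := by gcongr
    _ ≤ c * (4 * (√2 * ℓ)) := by gcongr
    _ = _ := by ring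

lemma norm_sub_center_two_le {m : Vec 3} (hm : m ∈ probSimplex 3) :
    ‖m - center 2‖ ≤ 0.8166 := by
  have h1 : ‖m - center 2‖ ^ 2 = ‖m‖ ^ 2 - 1 / 3 := by
    rw [norm_sub_sq_real, real_inner_comm, inner_center, hm.2, ← real_inner_self_eq_norm_sq
      (center 2), inner_center, sum_center]
    norm_num
    ring
  refine abs_le_of_sq_le_sq' ?_ (by norm_num) |>.2
  rw [h1]
  have : ‖m‖ ^ 2 ≤ 1 := pow_le_one₀ (norm_nonneg m) (norm_le_one_of_mem_probSimplex hm)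
  linarith [show (0.8166 : ℝ) ^ 2 ≥ 2 / 3 by norm_num]

/-- `s` and `t` are the fractions at which the line cuts the two sides from the lone vertex, and ℓ
is the length of the cut relative to the side. The frame identity expresses the gradient by s, t and
ℓ, which turns closeness to the centroid into a relation between them. -/
lemma exists_cut_params {α₀ α₁ α₂ ᾱ c ε G : ℝ} (hc : 0 < c) (hε : 0 < ε)
    (hεc : 5 * ε ^ 2 < c ^ 2) (hα₀ : 0 < α₀) (hα₁ : α₁ ≤ 0) (hα₂ : α₂ ≤ 0)
    (hS : α₀ + α₁ + α₂ = 3 * ᾱ)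
    (hQ : α₀ ^ 2 + α₁ ^ 2 + α₂ ^ 2 = c ^ 2 * G ^ 2 + 3 * ᾱ ^ 2)
    (hᾱ : ᾱ ^ 2 ≤ ε ^ 2 / 2 * G ^ 2) :
    ∃ s t ℓ : ℝ, 0 ≤ s ∧ s ≤ 1 ∧ s * (α₀ - α₁) = α₀ ∧ t * (α₀ - α₂) = α₀ ∧ 0 ≤ ℓ ∧ ℓ ≤ 1 ∧
      ℓ ^ 2 = s ^ 2 + t ^ 2 - s * t ∧ √(c ^ 2 - ε ^ 2) * 2.4703 ≤ 4 * (√2 * c * ℓ) := by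
  obtain ⟨s, hs⟩ : ∃ s, s = α₀ / (α₀ - α₁) := ⟨_, rfl⟩
  obtain ⟨t, ht⟩ : ∃ t, t = α₀ / (α₀ - α₂) := ⟨_, rfl⟩
  have hp : 0 < α₀ - α₁ := by linarith
  have hq : 0 < α₀ - α₂ := by linarith
  have hs0 : 0 < s := hs ▸ div_pos hα₀ hp
  have ht0 : 0 < t := ht ▸ div_pos hα₀ hq
  have hs1 : s ≤ 1 := hs ▸ (div_le_one hp).2 (by linarith)
  have ht1 : t ≤ 1 := ht ▸ (div_le_one hq).2 (by linarith)
  have hsp : s * (α₀ - α₁) = α₀ := by rw [hs]; exact div_mul_cancel₀ _ hp.ne'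
  have htq : t * (α₀ - α₂) = α₀ := by rw [ht]; exact div_mul_cancel₀ _ hq.ne'
  clear hs ht
  obtain ⟨ℓ, hℓ⟩ : ∃ ℓ, ℓ = √(s ^ 2 + t ^ 2 - s * t) := ⟨_, rfl⟩
  have hℓ2 : ℓ ^ 2 = s ^ 2 + t ^ 2 - s * t :=
    by rw [hℓ, Real.sq_sqrt (by nlinarith [sq_nonneg (s - t), mul_pos hs0 ht0])]
  have hℓ1 : ℓ ≤ 1 := by
    rw [hℓ, Real.sqrt_le_left (by norm_num)]
    rcases le_total s t with hst | hst <;> nlinarith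
  have hℓ0 : 0 ≤ ℓ := hℓ ▸ Real.sqrt_nonneg _
  have hframe : 3 * (s * t) ^ 2 * (c ^ 2 * G ^ 2) = 2 * α₀ ^ 2 * ℓ ^ 2 := by
    have e1 : 3 * (c ^ 2 * G ^ 2) =
        2 * ((α₀ - α₁) ^ 2 + (α₀ - α₂) ^ 2 - (α₀ - α₁) * (α₀ - α₂)) := by
      have : ᾱ = (α₀ + α₁ + α₂) / 3 := by linarith
      rw [this] at hQ
      linarith
    rw [hℓ2]
    calc _ = (s * t) ^ 2 * (3 * (c ^ 2 * G ^ 2)) := by ring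
      _ = 2 * ((s * (α₀ - α₁)) ^ 2 * t ^ 2 + (t * (α₀ - α₂)) ^ 2 * s ^ 2 -
          (s * (α₀ - α₁)) * (t * (α₀ - α₂)) * (s * t)) := by rw [e1]; ring
      _ = _ := by rw [hsp, htq]; ring
  have hcen : (s + t - 3 * (s * t)) ^ 2 ≤ 3 * (ε / c) ^ 2 * ℓ ^ 2 := by
    have e1 : 3 * (s * t) * ᾱ = -(α₀ * (s + t - 3 * (s * t))) := by
      have : 3 * ᾱ = 3 * α₀ - (α₀ - α₁) - (α₀ - α₂) := by linarith
      linear_combination s * t * this - t * hsp - s * htq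
    have e2 : α₀ ^ 2 * (s + t - 3 * (s * t)) ^ 2 = 9 * (s * t) ^ 2 * ᾱ ^ 2 := by
      linear_combination -(3 * (s * t) * ᾱ - (α₀ * (s + t - 3 * (s * t)))) * e1
    have e3 : α₀ ^ 2 * (s + t - 3 * (s * t)) ^ 2 ≤ α₀ ^ 2 * (3 * (ε / c) ^ 2 * ℓ ^ 2) := by
      rw [e2]
      calc 9 * (s * t) ^ 2 * ᾱ ^ 2 ≤ 9 * (s * t) ^ 2 * (ε ^ 2 / 2 * G ^ 2) := by gcongr
        _ = 3 / 2 * (ε / c) ^ 2 * (3 * (s * t) ^ 2 * (c ^ 2 * G ^ 2)) := by field_simp; ring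
        _ = _ := by rw [hframe]; ring
    exact le_of_mul_le_mul_left e3 (by positivity)
  have hρ3 : 3 * (ε / c) ^ 2 < 1 := by
    rw [div_pow, ← mul_div_assoc, div_lt_one (by positivity)]; nlinarith [sq_nonneg ε]
  refine ⟨s, t, ℓ, hs0.le, hs1, hsp, htq, hℓ0, hℓ1, hℓ2, ?_⟩
  exact length_bound hc hε hεc
    (le_three_mul_of_near_centroid hs0 ht0 hℓ0 hℓ2 (by positivity) hρ3 hcen)

/-- The two points where a line close to the centroid crosses an equilateral triangle. -/
lemma Located.exists_cut {ε c C : ℝ} (hc : 0 < c) (hc1 : c ≤ 1 / 288) (hε : 0 < ε)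
    (hεc : 5 * ε ^ 2 < c ^ 2)
    {g g' m e : Vec (2 + 1)} {v : Fin (2 + 1) → Vec (2 + 1)} {A : Set (Fin (2 + 1))}
    (hg : ∑ l, g l = 0) (hg0 : g ≠ 0) (he : ∑ l, e l = 0) (he1 : ‖WithLp.ofLp e‖ ≤ ε)
    (hmg : |inner ℝ m g - C| ≤ ‖e‖ / 2 * ‖g‖)
    (h : Located ε c g g' C m v A) {r₀ r₁ r₂ : Fin (2 + 1)} (h01 : r₀ ≠ r₁) (h02 : r₀ ≠ r₂)
    (h12 : r₁ ≠ r₂) (hsum : ∀ f : Fin (2 + 1) → ℝ, ∑ r, f r = f r₀ + f r₁ + f r₂)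
    (hr₁ : r₁ ∉ A) (hr₂ : r₂ ∉ A) :
    ∃ (s t : ℝ) (P Q : Vec (2 + 1)), (0 ≤ s ∧ s ≤ 1) ∧
      AffineMap.lineMap (m + v r₀) (m + v r₁) s = P ∧
      AffineMap.lineMap (m + v r₀) (m + v r₂) t = Q ∧ inner ℝ P g = C ∧ inner ℝ Q g = C ∧
      inner ℝ (m + v r₁) g < inner ℝ (m + v r₀) g ∧
      inner ℝ (m + v r₂) g < inner ℝ (m + v r₀) g ∧
      ‖Q - P‖ ≤ 0.005 ∧ √(c ^ 2 - ε ^ 2) * 2.4703 ≤ 4 * ‖Q - P‖ := by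
  have hv := h.simplex
  have hG : 0 < ‖g‖ := norm_pos_iff.2 hg0
  set G := ‖g‖ with hGdef
  have hα₀ : 0 < inner ℝ (m + v r₀) g - C := by
    obtain ⟨r, hr, hpos⟩ := h.exists_mem hc hεc hg hg0 he he1 hmg
    have h3 := hsum fun s => if s = r then 1 else 0
    have hr1 : r ≠ r₁ := fun h => hr₁ (h ▸ hr)
    have hr2 : r ≠ r₂ := fun h => hr₂ (h ▸ hr)
    by_cases hr0 : r₀ = r
    · rwa [hr0]
    · simp [hr0, hr1.symm, hr2.symm] at h3
  have hα₁ := h.nonpos r₁ hr₁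
  have hα₂ := h.nonpos r₂ hr₂
  have hS := hv.sum_adv m g C
  have hQ := hv.sum_adv_sq hc hg C (m := m)
  rw [hsum] at hS hQ
  push_cast at hS hQ
  set α₀ := inner ℝ (m + v r₀) g - C with hα₀d
  set α₁ := inner ℝ (m + v r₁) g - C with hα₁d
  set α₂ := inner ℝ (m + v r₂) g - C with hα₂d
  set ᾱ := inner ℝ m g - C with hᾱd
  have hᾱ : ᾱ ^ 2 ≤ ε ^ 2 / 2 * G ^ 2 := by
    rw [← sq_abs]
    calc |ᾱ| ^ 2 ≤ (‖e‖ / 2 * G) ^ 2 := by gcongr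
      _ = ‖e‖ ^ 2 / 4 * G ^ 2 := by ring
      _ ≤ (2 * ε ^ 2) / 4 * G ^ 2 := by
          gcongr; exact norm_sq_le_of_sum_eq_zero he he1
      _ = _ := by ring
  obtain ⟨s, t, ℓ, hs0, hs1, hsp, htq, hℓ0, hℓ1, hℓ2, hlen⟩ := exists_cut_params hc hε hεc hα₀
    (sub_nonpos.2 hα₁) (sub_nonpos.2 hα₂) (by linarith) (by linarith) hᾱ
  set x := v r₀ - v r₁ with hx
  set y := v r₀ - v r₂ with hy
  have hxx : ‖x‖ ^ 2 = 2 * c ^ 2 := by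
    rw [hx, ← dist_eq_norm, hv.2.2 _ _ h01, mul_pow, Real.sq_sqrt (by norm_num)]
  have hyy : ‖y‖ ^ 2 = 2 * c ^ 2 := by
    rw [hy, ← dist_eq_norm, hv.2.2 _ _ h02, mul_pow, Real.sq_sqrt (by norm_num)]
  have hxy : inner ℝ x y = c ^ 2 := by
    simp only [hx, hy, inner_sub_left, inner_sub_right, hv.inner_eq, h02, h12, h01.symm,
      if_true, if_false]
    ring
  set P := (AffineMap.lineMap (m + v r₀) (m + v r₁) s : Vec (2 + 1)) with hP
  set Q := (AffineMap.lineMap (m + v r₀) (m + v r₂) t : Vec (2 + 1)) with hQd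
  have hPg : inner ℝ P g = C := by rw [hP, inner_lineMap]; linarith
  have hQg : inner ℝ Q g = C := by rw [hQd, inner_lineMap]; linarith
  have hPQ : Q - P = s • x - t • y := by
    rw [hP, hQd, hx, hy, AffineMap.lineMap_apply_module, AffineMap.lineMap_apply_module]; module
  have hL : ‖Q - P‖ = √2 * c * ℓ := by
    have : ‖Q - P‖ ^ 2 = (√2 * c * ℓ) ^ 2 := by
      rw [hPQ, norm_sub_sq_real, norm_smul, norm_smul, mul_pow, mul_pow, hxx, hyy,
        real_inner_smul_left, real_inner_smul_right, hxy, mul_pow, mul_pow, hℓ2,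
        Real.sq_sqrt (by norm_num)]
      simp
      ring
    exact (sq_eq_sq₀ (norm_nonneg _) (by positivity)).1 this
  have hsq2 : √2 ≤ 1.4143 := by rw [Real.sqrt_le_left (by norm_num)]; norm_num
  refine ⟨s, t, P, Q, ⟨hs0, hs1⟩, rfl, rfl, hPg, hQg, by linarith, by linarith, ?_,
    by rwa [hL]⟩
  rw [hL]
  calc √2 * c * ℓ ≤ 1.4143 * (1 / 288) * 1 := by gcongr
    _ ≤ _ := by norm_num

/-- The error at a cut point is its parameter shift times the drop along the edge. Each error is at
most 2ε, but their difference is at most 3ε, as the edge vectors are cyclic shifts of each other up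
to sign. -/
lemma Located.error_le {ε c C : ℝ} (hc : 0 < c)
    {g a b m : Vec (2 + 1)} {v : Fin (2 + 1) → Vec (2 + 1)} {A : Set (Fin (2 + 1))}
    (ha : a ∈ probSimplex (2 + 1)) (hb : b ∈ probSimplex (2 + 1))
    (h : Located ε c g (a - b) C m v A) {r₀ r₁ r₂ : Fin (2 + 1)} (h01 : r₀ ≠ r₁) (h02 : r₀ ≠ r₂)
    (h12 : r₁ ≠ r₂) (hr₀ : r₀ ∈ A) (hr₁ : r₁ ∉ A) (hr₂ : r₂ ∉ A) {s t : ℝ} {P Q : Vec (2 + 1)}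
    (hP : AffineMap.lineMap (m + v r₀) (m + v r₁) s = P)
    (hQ : AffineMap.lineMap (m + v r₀) (m + v r₂) t = Q)
    (hPg : inner ℝ P g = C) (hQg : inner ℝ Q g = C)
    (h1 : inner ℝ (m + v r₁) g < inner ℝ (m + v r₀) g)
    (h2 : inner ℝ (m + v r₂) g < inner ℝ (m + v r₀) g) :
    |inner ℝ P (a - b) - C| ≤ 2 * ε ∧
      |(inner ℝ P (a - b) - C) - (inner ℝ Q (a - b) - C)| ≤ 3 * ε := by
  have hv := h.simplex
  set x := v r₀ - v r₁ with hx
  set y := v r₀ - v r₂ with hy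
  have hx0 : ∑ l, x l = 0 := by simp [hx, Finset.sum_sub_distrib, hv.1]
  have hy0 : ∑ l, y l = 0 := by simp [hy, Finset.sum_sub_distrib, hv.1]
  have hxx : ‖x‖ ^ 2 = 2 * c ^ 2 := by
    rw [hx, ← dist_eq_norm, hv.2.2 _ _ h01, mul_pow, Real.sq_sqrt (by norm_num)]
  have hyy : ‖y‖ ^ 2 = 2 * c ^ 2 := by
    rw [hy, ← dist_eq_norm, hv.2.2 _ _ h02, mul_pow, Real.sq_sqrt (by norm_num)]
  have hxy : inner ℝ x y = c ^ 2 := by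
    simp only [hx, hy, inner_sub_left, inner_sub_right, hv.inner_eq, h02, h12, h01.symm,
      if_true, if_false]
    ring
  have hVx : (m + v r₀) - (m + v r₁) = x := by rw [hx]; abel
  have hVy : (m + v r₀) - (m + v r₂) = y := by rw [hy]; abel
  obtain ⟨κ, hκ, hκe⟩ := (h.crossed r₀ hr₀ r₁ hr₁).exists_error h1 (by rw [hP]; exact hPg)
  obtain ⟨κ', hκ', hκe'⟩ := (h.crossed r₀ hr₀ r₂ hr₂).exists_error h2 (by rw [hQ]; exact hQg)
  rw [hP] at hκe
  rw [hQ] at hκe'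
  rw [hVx] at hκ hκe
  rw [hVy] at hκ' hκe'
  have hd12 : |κ * inner ℝ x (a - b) - κ' * inner ℝ y (a - b)| ≤ 3 * ε := by
    have e1 := inner_smul_sub_smul_le hc hx0 hy0 hxx hyy hxy ha hb hκ hκ'
    have e2 := inner_smul_sub_smul_le hc hx0 hy0 hxx hyy hxy hb ha hκ hκ'
    rw [← neg_sub a b, inner_neg_right] at e2
    rw [inner_sub_left, real_inner_smul_left, real_inner_smul_left] at e1 e2
    exact abs_le.2 ⟨by linarith, e1⟩
  have hd1 : |κ * inner ℝ x (a - b)| ≤ 2 * ε := by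
    have hn : ‖WithLp.ofLp (κ • x)‖ ≤ ε := by
      rw [WithLp.ofLp_smul, norm_smul, Real.norm_eq_abs]; exact hκ
    have e1 := inner_sub_le_of_norm_ofLp_le ha hb hn
    have e2 := inner_sub_le_of_norm_ofLp_le hb ha hn
    rw [← neg_sub a b, inner_neg_right] at e2
    rw [real_inner_smul_left] at e1 e2
    exact abs_le.2 ⟨by linarith, e1⟩
  exact ⟨by rw [hκe]; exact hd1, by rw [hκe, hκe']; exact hd12⟩

/-- Two points P, Q on the true line determine a normal in the plane. With X, Y their positions
relative to the center, `g` pairs to C with both, while the deviation D of the candidate pairs to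
the errors E, E'. The Gram identity gives ‖D‖ |C| ‖Q − P‖ = ‖g‖ ‖E Y − E' X‖. -/
lemma norm_sub_le_of_located_single {ε c θ C : ℝ} (hc : 0 < c) (hc1 : c ≤ 1 / 288) (hε : 0 < ε)
    (hεc : 5 * ε ^ 2 < c ^ 2) (hθ : 0 < θ) (hC : θ ≤ |C|)
    {g a b m e : Vec (2 + 1)} {v : Fin (2 + 1) → Vec (2 + 1)} {A : Set (Fin (2 + 1))}
    (hg : ∑ l, g l = 0) (hg0 : g ≠ 0) (hg1 : ‖g‖ ≤ √2)
    (ha : a ∈ probSimplex (2 + 1)) (hb : b ∈ probSimplex (2 + 1)) (hm : m ∈ probSimplex (2 + 1))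
    (he : ∑ l, e l = 0) (he1 : ‖WithLp.ofLp e‖ ≤ ε)
    (hmg : |inner ℝ m g - C| ≤ ‖e‖ / 2 * ‖g‖)
    (h : Located ε c g (a - b) C m v A) {r₀ r₁ r₂ : Fin (2 + 1)} (h01 : r₀ ≠ r₁) (h02 : r₀ ≠ r₂)
    (h12 : r₁ ≠ r₂) (hsum : ∀ f : Fin (2 + 1) → ℝ, ∑ r, f r = f r₀ + f r₁ + f r₂)
    (hr₀ : r₀ ∈ A) (hr₁ : r₁ ∉ A) (hr₂ : r₂ ∉ A) :
    ‖(a - b) - g‖ ≤ 4 * √2 * ε / (√(c ^ 2 - ε ^ 2) * θ) := by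
  have hv := h.simplex
  obtain ⟨s, t, P, Q, ⟨hs0, hs1⟩, hP, hQ, hPg, hQg, hlt1, hlt2, hLs, hlen⟩ :=
    h.exists_cut hc hc1 hε hεc hg hg0 he he1 hmg h01 h02 h12 hsum hr₁ hr₂
  obtain ⟨hd1, hd12⟩ := h.error_le hc ha hb h01 h02 h12 hr₀ hr₁ hr₂ hP hQ hPg hQg hlt1 hlt2
  set G := ‖g‖ with hGdef
  set X := P - center 2 with hX
  set Y := Q - center 2 with hY
  have hsumlm : ∀ (r r' : Fin (2 + 1)) (s : ℝ),
      ∑ l, (AffineMap.lineMap (m + v r) (m + v r') s : Vec (2 + 1)) l = 1 := by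
    intro r r' s
    simp [AffineMap.lineMap_apply_module, Finset.sum_add_distrib, ← Finset.mul_sum, hm.2, hv.1]
  have hX0 : ∑ l, X l = 0 := mem_sumZero.1 (sub_mem_sumZero (hP ▸ hsumlm _ _ _) (sum_center 2))
  have hY0 : ∑ l, Y l = 0 := mem_sumZero.1 (sub_mem_sumZero (hQ ▸ hsumlm _ _ _) (sum_center 2))
  have hab0 : ∑ l, (a - b) l = 0 := mem_sumZero.1 (sub_mem_sumZero ha.2 hb.2)
  have hD0 : ∑ l, (a - b - g) l = 0 := by
    simp only [PiLp.sub_apply] at hab0 ⊢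
    rw [Finset.sum_sub_distrib, hab0, hg, sub_zero]
  have hgX : inner ℝ g X = C := by
    rw [real_inner_comm, hX, inner_sub_left, inner_center, hg, hPg]; ring
  have hgY : inner ℝ g Y = C := by
    rw [real_inner_comm, hY, inner_sub_left, inner_center, hg, hQg]; ring
  have hDX : inner ℝ (a - b - g) X = inner ℝ P (a - b) - C := by
    rw [inner_sub_left, hgX, real_inner_comm, hX, inner_sub_left, inner_center, hab0]; ring
  have hDY : inner ℝ (a - b - g) Y = inner ℝ Q (a - b) - C := by
    rw [inner_sub_left, hgY, real_inner_comm, hY, inner_sub_left, inner_center, hab0]; ring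
  have k1 := norm_sq_gram hX0 hY0 hg
  have k2 := norm_sq_gram hX0 hY0 hD0
  rw [hgX, hgY, ← smul_sub, norm_smul, Real.norm_eq_abs,
    show Y - X = Q - P by rw [hX, hY]; abel] at k1
  rw [hDX, hDY] at k2
  set E := inner ℝ P (a - b) - C with hE
  set E' := inner ℝ Q (a - b) - C with hE'
  set D := ‖a - b - g‖ with hD
  have hmain : D * (|C| * ‖Q - P‖) = G * ‖E • Y - E' • X‖ := by
    refine (sq_eq_sq₀ (by positivity) (by positivity)).1 ?_
    rw [mul_pow D, mul_pow G, k1, k2]; ring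
  -- Circumradius √(2/3) of the triangle of contracts plus c ≤ 1/288.
  have hXn : ‖X‖ ≤ 0.8201 := by
    have e1 : P ∈ Metric.closedBall m c := by
      have hvb : ∀ r, m + v r ∈ Metric.closedBall m c := fun r => by
        rw [mem_closedBall_iff_norm, add_sub_cancel_left]; exact hv.norm_le hc.le r
      rw [← hP]
      exact (convex_closedBall _ _).lineMap_mem (hvb r₀) (hvb r₁) ⟨hs0, hs1⟩
    rw [mem_closedBall_iff_norm] at e1
    have e2 := norm_sub_center_two_le hm
    rw [hX, ← sub_add_sub_cancel P m]
    refine (norm_add_le _ _).trans ?_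
    norm_num at e2 ⊢
    linarith
  -- Written as (E − E') X + E (Q − P), the long vector X meets only the difference of the errors.
  have hcomb : ‖E • Y - E' • X‖ ≤ 3 * ε * 0.8201 + 2 * ε * ‖Q - P‖ := by
    have e1 : E • Y - E' • X = (E - E') • X + E • (Q - P) := by
      rw [show Q - P = Y - X by rw [hX, hY]; abel]; module
    rw [e1]
    refine (norm_add_le _ _).trans ?_
    rw [norm_smul, norm_smul, Real.norm_eq_abs, Real.norm_eq_abs]
    gcongr
  have hR : 0 < √(c ^ 2 - ε ^ 2) := Real.sqrt_pos.2 (by nlinarith [sq_nonneg ε])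
  set R := √(c ^ 2 - ε ^ 2) with hRd
  have hLpos : 0 < ‖Q - P‖ := by linarith
  have hfin : D * (|C| * ‖Q - P‖) ≤ √2 * (2.4703 * ε) := by
    rw [hmain]
    calc G * ‖E • Y - E' • X‖ ≤ √2 * (3 * ε * 0.8201 + 2 * ε * 0.005) := by
          gcongr
          exact hcomb.trans (by gcongr)
      _ = _ := by ring
  have hDR : D * |C| * R ≤ 4 * √2 * ε := by
    have : D * |C| * R * ‖Q - P‖ ≤ 4 * √2 * ε * ‖Q - P‖ := by
      calc D * |C| * R * ‖Q - P‖ = R * (D * (|C| * ‖Q - P‖)) := by ring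
        _ ≤ R * (√2 * (2.4703 * ε)) := by gcongr
        _ = (R * 2.4703) * (√2 * ε) := by ring
        _ ≤ 4 * ‖Q - P‖ * (√2 * ε) := by gcongr
        _ = _ := by ring
    exact le_of_mul_le_mul_right this hLpos
  rw [le_div_iff₀ (by positivity)]
  calc D * (R * θ) = D * θ * R := by ring
    _ ≤ D * |C| * R := by gcongr
    _ ≤ _ := hDR

/-- The bound for the two-dimensional simplex, with the sharp dependence on the edge length. -/
lemma norm_sub_le_of_located_two {ε c θ C : ℝ} (hc : 0 < c) (hc1 : c ≤ 1 / 288) (hε : 0 < ε)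
    (hεc : 5 * ε ^ 2 < c ^ 2) (hθ : 0 < θ) (hC : θ ≤ |C|)
    {g a b m e : Vec (2 + 1)} {v : Fin (2 + 1) → Vec (2 + 1)} {A : Set (Fin (2 + 1))}
    (hg : ∑ l, g l = 0) (hg0 : g ≠ 0) (hg1 : ‖g‖ ≤ √2)
    (ha : a ∈ probSimplex (2 + 1)) (hb : b ∈ probSimplex (2 + 1)) (hm : m ∈ probSimplex (2 + 1))
    (he : ∑ l, e l = 0) (he1 : ‖WithLp.ofLp e‖ ≤ ε)
    (hmg : |inner ℝ m g - C| ≤ ‖e‖ / 2 * ‖g‖)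
    (h : Located ε c g (a - b) C m v A) :
    ‖(a - b) - g‖ ≤ 4 * √2 * ε / (√(c ^ 2 - ε ^ 2) * θ) := by
  have key : ∀ r₀ r₁ r₂ : Fin (2 + 1), r₀ ≠ r₁ → r₀ ≠ r₂ → r₁ ≠ r₂ →
      (∀ f : Fin (2 + 1) → ℝ, ∑ r, f r = f r₀ + f r₁ + f r₂) → (r₁ ∈ A ↔ r₂ ∈ A) →
      (r₀ ∈ A ↔ r₁ ∉ A) → ‖(a - b) - g‖ ≤ 4 * √2 * ε / (√(c ^ 2 - ε ^ 2) * θ) := by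
    intro r₀ r₁ r₂ h01 h02 h12 hsum hA hA'
    by_cases hr₀ : r₀ ∈ A
    · have hr₁ := hA'.1 hr₀
      exact norm_sub_le_of_located_single hc hc1 hε hεc hθ hC hg hg0 hg1 ha hb hm he he1 hmg h h01
        h02 h12 hsum hr₀ hr₁ (mt hA.2 hr₁)
    · have hr₁ : r₁ ∈ A := not_not.1 (mt hA'.2 hr₀)
      have h' := h.neg
      rw [neg_sub] at h'
      rw [← norm_neg, show -(a - b - g) = (b - a) - -g by abel]
      refine norm_sub_le_of_located_single hc hc1 hε hεc hθ (by rwa [abs_neg]) (by simp [hg])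
        (neg_ne_zero.2 hg0) (by rwa [norm_neg]) hb ha hm he he1 ?_ h' h01 h02 h12 hsum hr₀
        (Set.notMem_compl_iff.2 hr₁) (Set.notMem_compl_iff.2 (hA.1 hr₁))
      rw [inner_neg_right, norm_neg, ← abs_neg]
      convert hmg using 2; ring
  obtain ⟨r, hr, -⟩ := h.exists_mem hc hεc hg hg0 he he1 hmg
  obtain ⟨r', hr', -⟩ := h.neg.exists_mem hc hεc (by simp [hg]) (neg_ne_zero.2 hg0) he he1 (by
    rw [inner_neg_right, norm_neg, ← abs_neg]; convert hmg using 2; ring)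
  have s0 : ∀ f : Fin (2 + 1) → ℝ, ∑ r, f r = f 0 + f 1 + f 2 := fun f => Fin.sum_univ_three f
  have s1 : ∀ f : Fin (2 + 1) → ℝ, ∑ r, f r = f 1 + f 2 + f 0 := fun f => by rw [s0]; ring
  have s2 : ∀ f : Fin (2 + 1) → ℝ, ∑ r, f r = f 2 + f 0 + f 1 := fun f => by rw [s0]; ring
  have n01 : (0 : Fin (2 + 1)) ≠ 1 := by decide
  have n02 : (0 : Fin (2 + 1)) ≠ 2 := by decide
  have n12 : (1 : Fin (2 + 1)) ≠ 2 := by decide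
  -- Both sides contain a vertex, so exactly one vertex is alone on its side.
  by_cases a0 : (0 : Fin (2 + 1)) ∈ A <;> by_cases a1 : (1 : Fin (2 + 1)) ∈ A <;>
    by_cases a2 : (2 : Fin (2 + 1)) ∈ A
  · exfalso; fin_cases r' <;> contradiction
  · exact key 2 0 1 n02.symm n12.symm n01 s2 (by simp [a0, a1]) (by simp [a0, a2])
  · exact key 1 2 0 n12 n01.symm n02.symm s1 (by simp [a0, a2]) (by simp [a1, a2])
  · exact key 0 1 2 n01 n02 n12 s0 (by simp [a1, a2]) (by simp [a0, a1])
  · exact key 0 1 2 n01 n02 n12 s0 (by simp [a1, a2]) (by simp [a0, a1])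
  · exact key 1 2 0 n12 n01.symm n02.symm s1 (by simp [a0, a2]) (by simp [a1, a2])
  · exact key 2 0 1 n02.symm n12.symm n01 s2 (by simp [a0, a1]) (by simp [a0, a2])
  · exfalso; fin_cases r <;> contradiction

end SimplexSearch

/-! ### Recovery of one difference of distributions. -/

namespace SimplexSearch

variable {d N : ℕ}

/-- At a tie the cost difference equals a difference of two expected payments in [0, 1]. -/
lemma IsInstance.abs_cost_sub_le_one {ς θ : ℝ} {p : Fin N → Vec (d + 1)} {cost : Fin N → ℝ}
    (h : IsInstance ς θ p cost) {i j : Fin N} {x : Vec (d + 1)} (hx : x ∈ probSimplex (d + 1))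
    (h0 : adv p cost i j x = 0) : |cost i - cost j| ≤ 1 := by
  have h1 : cost i - cost j = inner ℝ x (p i) - inner ℝ x (p j) := by
    rw [adv, inner_sub_right] at h0; linarith
  have hle : ∀ k, inner ℝ x (p k) ≤ 1 := fun k =>
    (real_inner_le_norm _ _).trans (mul_le_one₀ (norm_le_one_of_mem_probSimplex hx)
      (norm_nonneg _) (norm_le_one_of_mem_probSimplex (h.distribution k)))
  have hge : ∀ k, 0 ≤ inner ℝ x (p k) := fun k =>
    inner_nonneg_of_mem_probSimplex hx (h.distribution k)
  rw [h1, abs_le]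
  constructor <;> linarith [hle i, hle j, hge i, hge j]

/-- The line `z` meets the good part of the surface between the regions of `i` and `j`. -/
def Hits (p : Fin N → Vec (d + 1)) (cost : Fin N → ℝ) (ρ : ℝ) (i j : Fin N)
    (z : Vec (d + 1) × Vec (d + 1)) : Prop :=
  (chord z ∩ goodSurface p cost ρ i j).Nonempty

/-- The first point of `z` is in the simplex, and no two actions are tied there. -/
def Generic (p : Fin N → Vec (d + 1)) (cost : Fin N → ℝ) (z : Vec (d + 1) × Vec (d + 1)) : Prop :=
  z.1 ∈ probSimplex (d + 1) ∧ ∀ i j, i ≠ j → adv p cost i j z.1 ≠ 0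

variable {p : Fin N → Vec (d + 1)} {cost : Fin N → ℝ} {a : Vec (d + 1) → Fin N} {i j : Fin N}

lemma norm_sub_sub_le_of_mem {q : Fin N → Vec (d + 1)} (hp : ∀ i, p i ∈ probSimplex (d + 1))
    (hq : ∀ i, q i ∈ probSimplex (d + 1)) (i j : Fin N) :
    ‖(q i - q j) - (p i - p j)‖ ≤ 2 * √2 := by
  refine (norm_sub_le _ _).trans ?_
  linarith [norm_sub_le_sqrt_two (hp i) (hp j), norm_sub_le_sqrt_two (hq i) (hq j)]

/-- Recovery of one difference, in every dimension. -/
lemma norm_sub_sub_le_of_hits {ς θ c ε : ℝ} (hd : 2 ≤ d) (h : IsInstance ς θ p cost)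
    (ha : IsBestResponse p cost a) (hς : 0 < ς) (hθ : 0 < θ) (hij : i ≠ j) (hc : 0 < c)
    (hc1 : c ≤ 1) (hε : 0 < ε) (hεc : ((d : ℝ) + 1) ^ 2 * ε ≤ c)
    {z : Vec (d + 1) × Vec (d + 1)} (hz : Generic p cost z)
    (hit : Hits p cost (√(d : ℝ) * (c + ε)) i j z)
    {F : ℕ → Fin (d + 1) → Vec (d + 1)} (hF : ∀ k, IsCenteredSimplex c (F k))
    {M : Set (Vec (d + 1) × Fin N)} (hM : ∀ w ∈ samplePoints a ε z F, (w, a w) ∈ M)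
    {q : Fin N → Vec (d + 1)} (hq : q ∈ feasible cost M) :
    ‖(q i - q j) - (p i - p j)‖ ≤ 18 * (2 * d + 1) * √((d : ℝ) + 1) * ε / (c * θ) := by
  obtain ⟨x₀, hx₀, hg⟩ := hit
  obtain ⟨m, e, v, A, hm, he0, he, hme, hloc⟩ := exists_located (by omega) ha hij hc hε hx₀ hg hz.1
    hz.2 hF hM hq
  refine norm_sub_le_of_located (by omega) hc hc1 hε hεc hθ (h.abs_cost_sub hij)
    (h.abs_cost_sub_le_one hg.1 hg.2.2.1) (h.sum_sub i j) (h.sub_ne_zero hς hθ hij)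
    (norm_sub_le_sqrt_two (h.distribution i) (h.distribution j)) (hq.1 i) (hq.1 j) hm ?_ hloc
  have h1 := adv_sub p cost i j m x₀
  rw [hg.2.2.1, sub_zero] at h1
  change |adv p cost i j m| ≤ _
  rw [h1]
  refine (abs_real_inner_le_norm _ _).trans ?_
  gcongr
  refine hme.trans ?_
  have h2 := norm_le_sqrt_mul_norm_ofLp e
  push_cast at h2
  have h3 : √((d : ℝ) + 1) * ‖WithLp.ofLp e‖ ≤ √((d : ℝ) + 1) * ε := by gcongr
  linarith

lemma xi_le {c ε : ℝ} (hd : 2 ≤ d) (hc : 0 < c) : xi d c ε ≤ c / d := by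
  rw [xi, Real.sqrt_le_left (by positivity), xiSq, div_pow]
  have : 0 ≤ (d : ℝ) * ε ^ 2 / 8 := by positivity
  linarith

/-- Recovery of one difference, with the dependence on the parameters that is claimed in
general. -/
lemma norm_sub_sub_le_of_hits' {ς θ c ε : ℝ} (hd : 2 ≤ d) (h : IsInstance ς θ p cost)
    (ha : IsBestResponse p cost a) (hς : 0 < ς) (hς1 : ς ≤ 1) (hθ : 0 < θ) (hij : i ≠ j)
    (hc : 0 < c) (hε : 0 < ε) (hξ : 0 < xiSq d c ε) (hτ : 0 < tau d ς c ε)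
    {z : Vec (d + 1) × Vec (d + 1)} (hz : Generic p cost z)
    (hit : Hits p cost (√(d : ℝ) * (c + ε)) i j z)
    {F : ℕ → Fin (d + 1) → Vec (d + 1)} (hF : ∀ k, IsCenteredSimplex c (F k))
    {M : Set (Vec (d + 1) × Fin N)} (hM : ∀ w ∈ samplePoints a ε z F, (w, a w) ∈ M)
    {q : Fin N → Vec (d + 1)} (hq : q ∈ feasible cost M) :
    ‖(q i - q j) - (p i - p j)‖ ≤ 2 * √(d : ℝ) * ε / (xi d c ε ^ (d - 1) * θ) := by
  have hd2 : (2 : ℝ) ≤ d := by exact_mod_cast hd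
  have hξ0 : 0 < xi d c ε := Real.sqrt_pos.2 hξ
  -- A bound of at least 2√2 is trivially true. Otherwise ε is small against ξ^(d−1) θ, which
  -- supplies the smallness conditions on ε.
  rcases le_or_gt (2 * √2) (2 * √(d : ℝ) * ε / (xi d c ε ^ (d - 1) * θ)) with htriv | hlt
  · exact (norm_sub_sub_le_of_mem h.distribution hq.1 i j).trans htriv
  have hθ1 : θ ≤ 1 := by
    obtain ⟨x₀, -, hg⟩ := hit
    exact (h.abs_cost_sub hij).trans (h.abs_cost_sub_le_one hg.1 hg.2.2.1)
  have hX : 0 < xi d c ε ^ (d - 1) := by positivity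
  rw [div_lt_iff₀ (by positivity)] at hlt
  have hb := (tau_pos_bounds hd hς hc hε hτ).2
  have hpow : (ς ^ 2 / (3 * d)) ^ d ≤ (1 / (3 * (d : ℝ))) ^ 2 := by
    have h1 : ς ^ 2 / (3 * (d : ℝ)) ≤ 1 / (3 * d) := by
      gcongr; exact pow_le_one₀ hς.le hς1
    have h2 : 1 / (3 * (d : ℝ)) ≤ 1 := by rw [div_le_one (by positivity)]; linarith
    exact (pow_le_pow_left₀ (by positivity) h1 d).trans
      (pow_le_pow_of_le_one (by positivity) h2 hd)
  have hc288 : c ≤ 1 / 288 := by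
    calc c ≤ c + ε := by linarith
      _ ≤ (ς ^ 2 / (3 * d)) ^ d * ς / (4 * d) := hb.le
      _ ≤ (1 / (3 * (2 : ℝ))) ^ 2 * 1 / (4 * 2) := by
          refine div_le_div₀ (by positivity) ?_ (by norm_num) (by linarith)
          refine mul_le_mul (hpow.trans ?_) hς1 hς.le (by positivity)
          gcongr
      _ ≤ _ := by norm_num
  -- For d = 2 the claim is linear in 1/ξ and calls for the plane estimate. For d ≥ 3 at least two
  -- factors ξ ≤ c/d are available, and the spare factor c ≤ 1/288 absorbs the larger constant.
  rcases hd.eq_or_lt with heq | hd3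
  · subst heq
    have hxi : xi 2 c ε = √(c ^ 2 - ε ^ 2) / 2 := by
      rw [xi, xiSq, show c ^ 2 / ((2 : ℕ) : ℝ) ^ 2 - ((2 : ℕ) : ℝ) * ε ^ 2 / 8 =
        (c ^ 2 - ε ^ 2) / 2 ^ 2 by push_cast; ring, Real.sqrt_div' _ (by norm_num),
        Real.sqrt_sq (by norm_num)]
    rw [hxi] at hlt ⊢
    push_cast at hlt ⊢
    norm_num at hlt ⊢
    have hR : 0 < √(c ^ 2 - ε ^ 2) := by rw [hxi] at hξ0; linarith
    have h1 : 2 * ε < √(c ^ 2 - ε ^ 2) * θ := by linarith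
    have h2 : 2 * ε < √(c ^ 2 - ε ^ 2) := by nlinarith
    have h3 : (2 * ε) ^ 2 < c ^ 2 - ε ^ 2 := by
      rwa [← Real.lt_sqrt (by positivity)]
    obtain ⟨x₀, hx₀, hg⟩ := hit
    obtain ⟨m, e, v, A, hm, he0, he, hme, hloc⟩ := exists_located (by omega) ha hij hc hε hx₀ hg
      hz.1 hz.2 hF hM hq
    have hmain := norm_sub_le_of_located_two hc hc288 hε (by linarith) hθ (h.abs_cost_sub hij)
      (h.sum_sub i j) (h.sub_ne_zero hς hθ hij)
      (norm_sub_le_sqrt_two (h.distribution i) (h.distribution j)) (hq.1 i) (hq.1 j) hm he0 he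
      (by
        have h1 := adv_sub p cost i j m x₀
        rw [hg.2.2.1, sub_zero] at h1
        change |adv p cost i j m| ≤ _
        rw [h1]
        refine (abs_real_inner_le_norm _ _).trans ?_
        gcongr) hloc
    refine hmain.trans_eq ?_
    field_simp
    ring
  · have hd3' : (3 : ℝ) ≤ d := by exact_mod_cast hd3
    have hXc : xi d c ε ^ (d - 1) ≤ (c / d) ^ 2 := by
      have h1 : c / d ≤ 1 := by rw [div_le_one (by positivity)]; linarith
      exact (pow_le_pow_left₀ hξ0.le (xi_le hd hc) _).trans
        (pow_le_pow_of_le_one (by positivity) h1 (by omega))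
    have hXd : xi d c ε ^ (d - 1) * d ^ 2 ≤ c ^ 2 := by
      rw [div_pow, le_div_iff₀ (by positivity)] at hXc; exact hXc
    have hs2 : √2 ≤ √(d : ℝ) := Real.sqrt_le_sqrt hd2
    have hsd : 0 < √(d : ℝ) := by positivity
    have hεX : ε ≤ xi d c ε ^ (d - 1) := by
      have h1 : √(d : ℝ) * ε ≤ √(d : ℝ) * xi d c ε ^ (d - 1) := by
        calc √(d : ℝ) * ε ≤ √2 * (xi d c ε ^ (d - 1) * θ) := by linarith
          _ ≤ √(d : ℝ) * (xi d c ε ^ (d - 1) * 1) := by gcongr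
          _ = _ := by ring
      exact le_of_mul_le_mul_left h1 hsd
    have hεc : ((d : ℝ) + 1) ^ 2 * ε ≤ c := by
      calc ((d : ℝ) + 1) ^ 2 * ε ≤ (2 * d ^ 2) * xi d c ε ^ (d - 1) := by
            gcongr; nlinarith
        _ ≤ 2 * c ^ 2 := by linarith
        _ ≤ c := by nlinarith
    refine (norm_sub_sub_le_of_hits hd h ha hς hθ hij hc (by linarith) hε hεc hz hit hF hM
      hq).trans ?_
    rw [div_le_div_iff₀ (by positivity) (by positivity)]
    have hs1 : √((d : ℝ) + 1) ≤ 6 / 5 * √(d : ℝ) := by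
      rw [Real.sqrt_le_left (by positivity), mul_pow, Real.sq_sqrt (by positivity)]
      linarith
    have hk : 18 * (2 * (d : ℝ) + 1) * (6 / 5) * xi d c ε ^ (d - 1) ≤ 2 * c := by
      have h1 : 2 * (d : ℝ) + 1 ≤ d ^ 2 := by nlinarith
      calc _ ≤ 18 * (d : ℝ) ^ 2 * (6 / 5) * xi d c ε ^ (d - 1) := by gcongr
        _ ≤ 18 * (6 / 5) * c ^ 2 := by linarith
        _ ≤ 2 * c := by nlinarith
    calc 18 * (2 * (d : ℝ) + 1) * √((d : ℝ) + 1) * ε * (xi d c ε ^ (d - 1) * θ)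
        ≤ 18 * (2 * (d : ℝ) + 1) * (6 / 5 * √(d : ℝ)) * ε * (xi d c ε ^ (d - 1) * θ) := by
          gcongr
      _ = (18 * (2 * (d : ℝ) + 1) * (6 / 5) * xi d c ε ^ (d - 1)) * (√(d : ℝ) * ε * θ) := by ring
      _ ≤ 2 * c * (√(d : ℝ) * ε * θ) := by gcongr
      _ = _ := by ring

end SimplexSearch

namespace SimplexSearch

variable {d N : ℕ}

/-! ### Detection probabilities -/

lemma surfaceDetection_le_one (d : ℕ) (v : ℝ) : surfaceDetection d v ≤ 1 :=
  csSup_le ⟨0, le_rfl, zero_le_one, fun _ _ _ => measureReal_nonneg⟩ fun _ hs => hs.2.1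

lemma surfaceRatio_homothety (hd : 2 ≤ d) (x : Vec (d + 1)) {r : ℝ} (hr : 0 < r)
    (e : Set (Vec (d + 1))) :
    surfaceRatio d (AffineMap.homothety x r '' e) = r ^ ((d : ℝ) - 1) * surfaceRatio d e := by
  have hd2 : (2 : ℝ) ≤ d := by exact_mod_cast hd
  rw [surfaceRatio, hausdorffMeasure_homothety_image (by linarith) x hr.ne', ENNReal.smul_def,
    smul_eq_mul, mul_div_assoc, ENNReal.toReal_mul, surfaceRatio]
  congr 1
  rw [ENNReal.coe_toReal, NNReal.coe_rpow, coe_nnnorm, Real.norm_of_nonneg hr.le]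

/-- The definition speaks of surfaces with ratio exactly `v`. A larger convex surface contains a
homothetic copy of itself with that ratio, and hitting the copy is hitting the surface. -/
lemma surfaceDetection_le {v : ℝ} (hd : 2 ≤ d) (hv : 0 < v) {e : Set (Vec (d + 1))}
    (he : IsConvexSurface d e) (hve : v ≤ surfaceRatio d e) :
    surfaceDetection d v ≤ (lineLaw d).real {z | (chord z ∩ e).Nonempty} := by
  have hd2 : (2 : ℝ) ≤ d := by exact_mod_cast hd
  have hR : 0 < surfaceRatio d e := hv.trans_le hve
  have hne : e.Nonempty := by
    by_contra hcon
    rw [Set.not_nonempty_iff_eq_empty] at hcon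
    rw [hcon, surfaceRatio] at hR
    simp at hR
  obtain ⟨x, hx⟩ := hne
  set r := (v / surfaceRatio d e) ^ ((d : ℝ) - 1)⁻¹ with hrdef
  have hq : 0 < v / surfaceRatio d e := div_pos hv hR
  have hr : 0 < r := Real.rpow_pos_of_pos hq _
  have hr1 : r ≤ 1 := Real.rpow_le_one hq.le ((div_le_one hR).2 hve)
    (inv_nonneg.2 (by linarith))
  have hsub : AffineMap.homothety x r '' e ⊆ e := by
    rintro _ ⟨y, hy, rfl⟩
    rw [AffineMap.homothety_eq_lineMap]
    exact he.1.lineMap_mem hx hy ⟨hr.le, hr1⟩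
  have he' : IsConvexSurface d (AffineMap.homothety x r '' e) := by
    obtain ⟨h1, h2, H, h3, h4⟩ := he
    exact ⟨h1.affine_image _, hsub.trans h2, H, h3, hsub.trans h4⟩
  have hratio : surfaceRatio d (AffineMap.homothety x r '' e) = v := by
    rw [surfaceRatio_homothety hd x hr, hrdef, ← Real.rpow_mul hq.le,
      inv_mul_cancel₀ (by linarith), Real.rpow_one, div_mul_cancel₀ _ hR.ne']
  refine csSup_le ⟨0, le_rfl, zero_le_one, fun _ _ _ => measureReal_nonneg⟩ fun s hs => ?_
  refine (hs.2.2 _ he' hratio).trans (measureReal_mono ?_)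
  exact fun z hz => hz.mono (Set.inter_subset_inter_right _ hsub)

variable {p : Fin N → Vec (d + 1)} {cost : Fin N → ℝ} {ς θ : ℝ}

lemma IsInstance.isConvexSurface_goodSurface (h : IsInstance ς θ p cost) (hς : 0 < ς) (hθ : 0 < θ)
    (ρ : ℝ) {i j : Fin N} (hij : i ≠ j) : IsConvexSurface d (goodSurface p cost ρ i j) := by
  refine ⟨convex_goodSurface p cost ρ i j, fun x hx => hx.1, ?_⟩
  have hfr := finrank_sumZeroOrtho (h.sum_sub i j) (h.sub_ne_zero hς hθ hij)
  rcases (goodSurface p cost ρ i j).eq_empty_or_nonempty with he | ⟨x, hx⟩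
  · exact ⟨AffineSubspace.mk' 0 (sumZeroOrtho (p i - p j)), by
      rw [AffineSubspace.direction_mk']; exact hfr, by rw [he]; exact Set.empty_subset _⟩
  · refine ⟨AffineSubspace.mk' x (sumZeroOrtho (p i - p j)), by
      rw [AffineSubspace.direction_mk']; exact hfr, fun y hy => ?_⟩
    rw [SetLike.mem_coe, AffineSubspace.mem_mk', vsub_eq_sub, mem_sumZeroOrtho]
    refine ⟨mem_sumZero.1 (sub_mem_sumZero hy.1.2 hx.1.2), ?_⟩
    rw [← adv_sub, hy.2.2.1, hx.2.2.1, sub_zero]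

lemma IsInstance.ae_ne (h : IsInstance ς θ p cost) (hς : 0 < ς) (hθ : 0 < θ) {i j : Fin N}
    (hij : i ≠ j) :
    ∀ᵐ z ∂lineLaw d, inner ℝ z.1 (p i - p j) ≠ inner ℝ z.2 (p i - p j) := by
  have hm : MeasurableSet {z : Vec (d + 1) × Vec (d + 1) |
      inner ℝ z.1 (p i - p j) = inner ℝ z.2 (p i - p j)} :=
    measurableSet_eq_fun ((measurable_inner_right _).comp measurable_fst)
      ((measurable_inner_right _).comp measurable_snd)
  rw [ae_iff]
  simp only [ne_eq, not_not]
  rw [lineLaw, Measure.measure_prod_null hm]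
  refine Filter.Eventually.of_forall fun x => ?_
  have := uniformSimplex_level (h.sum_sub i j) (h.sub_ne_zero hς hθ hij) (inner ℝ x (p i - p j))
  simp only [Pi.zero_apply]
  rw [← this]
  congr 1
  ext y
  simp [eq_comm]

/-- Off the null set of lines parallel to the boundary, hitting becomes a condition on one point
that depends measurably on `z`. -/
lemma hits_iff {ρ : ℝ} {i j : Fin N} {z : Vec (d + 1) × Vec (d + 1)}
    (hz : inner ℝ z.1 (p i - p j) ≠ inner ℝ z.2 (p i - p j)) :
    Hits p cost ρ i j z ↔
      crossing (p i - p j) (cost i - cost j) z.1 z.2 ∈ goodSurface p cost ρ i j := by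
  constructor
  · rintro ⟨x, ⟨hl, -⟩, hx⟩
    obtain ⟨s, hs⟩ := mem_affineSpan_pair_iff_exists_lineMap_eq.1 hl
    have h0 := hx.2.2.1
    rw [← hs, adv, inner_lineMap] at h0
    have : s = (cost i - cost j - inner ℝ z.1 (p i - p j)) /
        (inner ℝ z.2 (p i - p j) - inner ℝ z.1 (p i - p j)) := by
      rw [eq_div_iff (sub_ne_zero.2 hz.symm)]; linarith
    rw [crossing, ← this, hs]
    exact hx
  · intro h
    exact ⟨_, ⟨AffineMap.lineMap_mem_affineSpan_pair _ _ _, h.1⟩, h⟩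

lemma IsInstance.ae_generic (h : IsInstance ς θ p cost) (hς : 0 < ς) (hθ : 0 < θ) :
    ∀ᵐ z ∂lineLaw d, Generic p cost z := by
  have h1 : ∀ᵐ x ∂uniformSimplex d, x ∈ probSimplex (d + 1) ∧
      ∀ i j, i ≠ j → adv p cost i j x ≠ 0 := by
    refine (ae_mem_probSimplex d).and ?_
    rw [ae_all_iff]; intro i
    rw [ae_all_iff]; intro j
    by_cases hij : i = j
    · simp [hij]
    · filter_upwards [h.uniformSimplex_adv_eq_zero hς hθ hij] with x hx _ using hx
  exact Measure.quasiMeasurePreserving_fst.ae h1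

lemma ae_of_hasLaw {Ω Y : Type*} [MeasurableSpace Ω] [MeasurableSpace Y] {μ : Measure Ω}
    {ν : Measure Y} {X : Ω → Y} (hX : HasLaw X ν μ) {q : Y → Prop} (h : ∀ᵐ y ∂ν, q y) :
    ∀ᵐ ω ∂μ, q (X ω) := by
  rw [← hX.map_eq] at h
  exact ae_of_ae_map hX.aemeasurable h

lemma IsRandomInput.ae_generic {T : ℕ} {Ω : Type*} [MeasurableSpace Ω] {μ : Measure Ω} {c : ℝ}
    {Z : Fin T → Ω → Vec (d + 1) × Vec (d + 1)} {F : Fin T → ℕ → Ω → Fin (d + 1) → Vec (d + 1)}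
    (hZ : IsRandomInput μ c Z F) (h : IsInstance ς θ p cost) (hς : 0 < ς) (hθ : 0 < θ) :
    ∀ᵐ ω ∂μ, ∀ t, Generic p cost (Z t ω) :=
  ae_all_iff.2 fun t => ae_of_hasLaw (hZ.law t) (h.ae_generic hς hθ)

/-- The probability that none of the lines meets a given large surface. -/
lemma IsRandomInput.measure_forall_not_hits_le {T : ℕ} {Ω : Type*} [MeasurableSpace Ω]
    {μ : Measure Ω} [IsProbabilityMeasure μ] {c : ℝ}
    {Z : Fin T → Ω → Vec (d + 1) × Vec (d + 1)} {F : Fin T → ℕ → Ω → Fin (d + 1) → Vec (d + 1)}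
    (hZ : IsRandomInput μ c Z F) (h : IsInstance ς θ p cost) (hd : 2 ≤ d) (hς : 0 < ς)
    (hθ : 0 < θ) {ρ v : ℝ} (hv : 0 < v) {i j : Fin N} (hij : i ≠ j)
    (hve : v ≤ surfaceRatio d (goodSurface p cost ρ i j)) :
    μ {ω | ∀ t, ¬Hits p cost ρ i j (Z t ω)} ≤
      ENNReal.ofReal (Real.exp (-(T * surfaceDetection d v))) := by
  set σ := surfaceDetection d v with hσ
  set B : Set (Vec (d + 1) × Vec (d + 1)) :=
    {z | crossing (p i - p j) (cost i - cost j) z.1 z.2 ∈ goodSurface p cost ρ i j} with hB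
  have hBm : MeasurableSet B :=
    measurable_crossing _ _ (measurableSet_goodSurface p cost ρ i j)
  have hiff : ∀ᵐ z ∂lineLaw d, (Hits p cost ρ i j z ↔ z ∈ B) :=
    (h.ae_ne hς hθ hij).mono fun z hz => hits_iff hz
  have hσB : σ ≤ (lineLaw d).real B := by
    refine (surfaceDetection_le hd hv (h.isConvexSurface_goodSurface hς hθ ρ hij) hve).trans_eq ?_
    refine measureReal_congr (hiff.mono fun z hz => ?_)
    exact propext hz
  have hBc : (lineLaw d) Bᶜ ≤ ENNReal.ofReal (Real.exp (-σ)) := by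
    rw [← ofReal_measureReal, probReal_compl_eq_one_sub hBm]
    apply ENNReal.ofReal_le_ofReal
    linarith [Real.add_one_le_exp (-σ)]
  -- Independence applies to the measurable substitute `B`, and 1 − σ ≤ exp(−σ) for each line.
  have hsub : {ω | ∀ t, ¬Hits p cost ρ i j (Z t ω)} ≤ᵐ[μ]
      (⋂ t ∈ (Finset.univ : Finset (Fin T)), Z t ⁻¹' Bᶜ : Set Ω) := by
    have : ∀ᵐ ω ∂μ, ∀ t, (Hits p cost ρ i j (Z t ω) ↔ Z t ω ∈ B) :=
      ae_all_iff.2 fun t => ae_of_hasLaw (hZ.law t) hiff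
    filter_upwards [this] with ω hω hn
    refine Set.mem_iInter₂.2 fun t _ => ?_
    exact fun hB => hn t ((hω t).2 hB)
  refine (measure_mono_ae hsub).trans ?_
  rw [hZ.indep.measure_inter_preimage_eq_mul Finset.univ (fun t _ => hBm.compl)]
  calc ∏ t, μ (Z t ⁻¹' Bᶜ) ≤ ∏ _t : Fin T, ENNReal.ofReal (Real.exp (-σ)) := by
        refine Finset.prod_le_prod' fun t _ => ?_
        rw [← Measure.map_apply_of_aemeasurable (hZ.law t).aemeasurable hBm.compl, (hZ.law t).map_eq]
        exact hBc
    _ = _ := by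
        rw [Finset.prod_const, Finset.card_univ, Fintype.card_fin,
          ← ENNReal.ofReal_pow (Real.exp_nonneg _), ← Real.exp_nat_mul]
        congr 2; ring

/-! ### The graph of neighboring regions -/

lemma goodSurface_comm (p : Fin N → Vec (d + 1)) (cost : Fin N → ℝ) (ρ : ℝ) (i j : Fin N) :
    goodSurface p cost ρ i j = goodSurface p cost ρ j i := by
  have key : ∀ i j, goodSurface p cost ρ i j ⊆ goodSurface p cost ρ j i := by
    rintro i j x ⟨h1, h2, h3, h4⟩
    refine ⟨h1, h2, by rw [adv_swap, h3, neg_zero], fun k hkj hki => ?_⟩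
    rw [min_comm]
    refine (h4 k hki hkj).trans_eq ?_
    rw [← adv_add p cost i j k, h3, zero_add]
  exact Set.Subset.antisymm (key i j) (key j i)

/-- Two actions are neighbors if the good part of the surface between their regions is large. -/
def neighborGraph (p : Fin N → Vec (d + 1)) (cost : Fin N → ℝ) (ρ v : ℝ) : SimpleGraph (Fin N) where
  Adj i j := i ≠ j ∧ v ≤ surfaceRatio d (goodSurface p cost ρ i j)
  symm := ⟨fun i j h => ⟨h.1.symm, by rw [goodSurface_comm]; exact h.2⟩⟩
  loopless := ⟨fun i h => h.1 rfl⟩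

/-- If the actions reachable from `i₀` were not all, splitting them off would yield a large good
surface between a reachable and an unreachable action. -/
lemma IsInstance.connected_neighborGraph {a : Vec (d + 1) → Fin N} {c ε v : ℝ}
    (h : IsInstance ς θ p cost) (hd : 2 ≤ d) (hς : 0 < ς) (hς1 : ς ≤ 1) (hθ : 0 < θ)
    (ha : IsBestResponse p cost a) (hc : 0 < c) (hε : 0 < ε) (hτ : 0 < tau d ς c ε)
    (hv : v ≤ (ς ^ 2 / (3 * d)) ^ d) :
    (neighborGraph p cost (√(d : ℝ) * (c + ε)) v).Connected := by
  classical
  set G := neighborGraph p cost (√(d : ℝ) * (c + ε)) v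
  have : Nonempty (Fin N) := ⟨a 0⟩
  refine SimpleGraph.Connected.mk fun i₀ j₀ => ?_
  by_contra hcon
  set I : Finset (Fin N) := {k | G.Reachable i₀ k} with hI
  have hi : i₀ ∈ I := by simp [hI]
  have hj : j₀ ∈ Iᶜ := by simpa [hI] using hcon
  obtain ⟨i, hiI, j, hjI, hij⟩ := h.exists_goodSurface_area hd hς hς1 hθ ha hc hε hτ ⟨i₀, hi⟩
    ⟨j₀, hj⟩
  have hir : G.Reachable i₀ i := by simpa [hI] using hiI
  have hjr : ¬G.Reachable i₀ j := by simpa [hI] using hjI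
  refine hjr (hir.trans (SimpleGraph.Adj.reachable ⟨?_, hv.trans hij⟩))
  rintro rfl
  exact hjr hir

lemma norm_sub_le_of_walk {V E : Type*} [NormedAddCommGroup E] {G : SimpleGraph V} (f : V → E)
    {b : ℝ} (hb : ∀ i j, G.Adj i j → ‖f i - f j‖ ≤ b) {i j : V} (w : G.Walk i j) :
    ‖f i - f j‖ ≤ w.length * b := by
  induction w with
  | nil => simp
  | cons hadj w ih =>
    rw [SimpleGraph.Walk.length_cons, ← sub_add_sub_cancel]
    refine (norm_add_le _ _).trans ((add_le_add (hb _ _ hadj) ih).trans_eq ?_)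
    push_cast; ring

/-- Recovery along a spanning tree of neighboring regions. -/
lemma IsRandomInput.measure_not_recovered_le {T : ℕ} {Ω : Type*} [MeasurableSpace Ω]
    {μ : Measure Ω} [IsProbabilityMeasure μ] {c ε v b : ℝ} {a : Vec (d + 1) → Fin N}
    {Z : Fin T → Ω → Vec (d + 1) × Vec (d + 1)} {F : Fin T → ℕ → Ω → Fin (d + 1) → Vec (d + 1)}
    (hZ : IsRandomInput μ c Z F) (h : IsInstance ς θ p cost) (hd : 2 ≤ d) (hς : 0 < ς)
    (hς1 : ς ≤ 1) (hθ : 0 < θ) (ha : IsBestResponse p cost a) (hc : 0 < c) (hε : 0 < ε)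
    (hτ : 0 < tau d ς c ε) (hv0 : 0 < v) (hv : v ≤ (ς ^ 2 / (3 * d)) ^ d) (hb0 : 0 ≤ b)
    (hb : ∀ (z : Vec (d + 1) × Vec (d + 1)) (F : ℕ → Fin (d + 1) → Vec (d + 1))
      (M : Set (Vec (d + 1) × Fin N)) (q : Fin N → Vec (d + 1)) (i j : Fin N), i ≠ j →
      Generic p cost z → Hits p cost (√(d : ℝ) * (c + ε)) i j z →
      (∀ k, IsCenteredSimplex c (F k)) → (∀ w ∈ samplePoints a ε z F, (w, a w) ∈ M) →
      q ∈ feasible cost M → ‖(q i - q j) - (p i - p j)‖ ≤ b) :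
    μ {ω | ¬∀ q ∈ feasible cost (memory a ε (fun t => Z t ω) (fun t k => F t k ω)),
        ∀ i j, ‖(q i - q j) - (p i - p j)‖ ≤ ((N : ℝ) - 1) * b} ≤
      ENNReal.ofReal (N * Real.exp (-(T * surfaceDetection d v))) := by
  classical
  set ρ := √(d : ℝ) * (c + ε) with hρ
  -- On a spanning tree the union bound runs over N − 1 surfaces instead of all pairs.
  obtain ⟨G, hG, htree⟩ :=
    (h.connected_neighborGraph hd hς hς1 hθ ha hc hε hτ hv).exists_isTree_le
  have hN : 1 ≤ N := (Nat.zero_le _).trans_lt (a 0).isLt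
  -- Each edge is oriented by a chosen representative; `goodSurface_comm` makes the choice
  -- immaterial.
  set bad : Sym2 (Fin N) → Set Ω :=
    fun e => {ω | ∀ t, ¬Hits p cost ρ e.out.1 e.out.2 (Z t ω)} with hbad
  have hsub : {ω | ¬∀ q ∈ feasible cost (memory a ε (fun t => Z t ω) (fun t k => F t k ω)),
      ∀ i j, ‖(q i - q j) - (p i - p j)‖ ≤ ((N : ℝ) - 1) * b} ≤ᵐ[μ]
      (⋃ e ∈ G.edgeFinset, bad e : Set Ω) := by
    filter_upwards [hZ.ae_generic h hς hθ] with ω hgen hω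
    by_contra hcon
    apply hω
    intro q hq
    have hadj : ∀ i j, G.Adj i j → ‖(q i - p i) - (q j - p j)‖ ≤ b := by
      intro i j hij
      have hmem : s(i, j) ∈ G.edgeFinset := by
        rw [SimpleGraph.mem_edgeFinset, SimpleGraph.mem_edgeSet]; exact hij
      have hnb : ω ∉ bad s(i, j) := fun hm => hcon (Set.mem_iUnion₂.2 ⟨_, hmem, hm⟩)
      simp only [hbad, Set.mem_ofPred_eq, not_forall, not_not] at hnb
      obtain ⟨t, ht⟩ := hnb
      have ht' : Hits p cost ρ i j (Z t ω) := by
        have hout : s((s(i, j) : Sym2 (Fin N)).out.1, (s(i, j) : Sym2 (Fin N)).out.2) = s(i, j) :=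
          Quot.out_eq _
        rcases Sym2.eq_iff.1 hout with ⟨e1, e2⟩ | ⟨e1, e2⟩
        · rwa [e1, e2] at ht
        · rw [e1, e2] at ht
          rw [Hits, goodSurface_comm]; exact ht
      have := hb (Z t ω) (fun k => F t k ω)
        (memory a ε (fun t => Z t ω) (fun t k => F t k ω)) q i j hij.ne (hgen t) ht'
        (fun k => hZ.shape t k ω) (fun w hw => ⟨t, hw, rfl⟩) hq
      rwa [show (q i - p i) - (q j - p j) = (q i - q j) - (p i - p j) by abel]
    intro i j
    obtain ⟨w, hw⟩ := (htree.connected i j).exists_isPath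
    have h1 := norm_sub_le_of_walk (fun i => q i - p i) hadj w
    rw [show (q i - q j) - (p i - p j) = (q i - p i) - (q j - p j) by abel]
    refine h1.trans ?_
    gcongr
    have h2 := hw.length_lt
    rw [Fintype.card_fin] at h2
    have h3 : ((w.length + 1 : ℕ) : ℝ) ≤ N := by exact_mod_cast h2
    push_cast at h3
    linarith
  refine (measure_mono_ae hsub).trans ((measure_biUnion_finset_le _ _).trans ?_)
  have hcard : G.edgeFinset.card ≤ N := by
    have := htree.card_edgeFinset
    rw [Fintype.card_fin] at this
    omega
  calc ∑ e ∈ G.edgeFinset, μ (bad e)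
      ≤ ∑ _e ∈ G.edgeFinset, ENNReal.ofReal (Real.exp (-(T * surfaceDetection d v))) := by
        refine Finset.sum_le_sum fun e he => ?_
        have hout : s(e.out.1, e.out.2) = e := Quot.out_eq _
        have hadj : G.Adj e.out.1 e.out.2 := by
          rw [← SimpleGraph.mem_edgeSet, ← SimpleGraph.mem_edgeFinset, hout]; exact he
        have hn := hG hadj
        exact hZ.measure_forall_not_hits_le h hd hς hθ hv0 hn.1 hn.2
    _ ≤ N * ENNReal.ofReal (Real.exp (-(T * surfaceDetection d v))) := by
        rw [Finset.sum_const, nsmul_eq_mul]; gcongr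
    _ = _ := by rw [ENNReal.ofReal_mul (Nat.cast_nonneg N), ENNReal.ofReal_natCast]

end SimplexSearch

/-! ### Round bound and choice of parameters. -/

namespace SimplexSearch

variable {d N : ℕ} {p : Fin N → Vec (d + 1)} {cost : Fin N → ℝ} {ς θ : ℝ}

lemma IsRandomInput.ae_rounds_le {T : ℕ} {Ω : Type*} [MeasurableSpace Ω] {μ : Measure Ω}
    {c ε : ℝ} {a : Vec (d + 1) → Fin N}
    {Z : Fin T → Ω → Vec (d + 1) × Vec (d + 1)} {F : Fin T → ℕ → Ω → Fin (d + 1) → Vec (d + 1)}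
    (hZ : IsRandomInput μ c Z F) (h : IsInstance ς θ p cost) (hd : 2 ≤ d) (hς : 0 < ς)
    (hθ : 0 < θ) (ha : IsBestResponse p cost a) (hε : 0 < ε) (hε1 : ε ≤ 1 / 3)
    (hc : √2 * c ≤ 1) :
    ∀ᵐ ω ∂μ, (rounds a ε (fun t => Z t ω) (fun t k => F t k ω) : ℝ) ≤
      16 * (T * N * d ^ 2 * Real.log (1 / ε)) := by
  filter_upwards [hZ.ae_generic h hς hθ] with ω hω
  rw [rounds]
  push_cast
  calc _ ≤ ∑ _t : Fin T, 16 * (N * d ^ 2 * Real.log (1 / ε)) :=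
        Finset.sum_le_sum fun t _ => sampleRounds_le hd ha hε hε1 hc (hω t).1 (hω t).2
          fun k => hZ.shape t k ω
    _ = _ := by simp; ring

lemma tau_pos_small {c ε : ℝ} (hd : 2 ≤ d) (hς : 0 < ς) (hς1 : ς ≤ 1) (hc : 0 < c) (hε : 0 < ε)
    (hτ : 0 < tau d ς c ε) : ε ≤ 1 / 3 ∧ √2 * c ≤ 1 := by
  have hd2 : (2 : ℝ) ≤ d := by exact_mod_cast hd
  have h1 := (tau_pos_bounds hd hς hc hε hτ).1
  have h2 : (ς ^ 2 / (3 * (d : ℝ))) ^ d ≤ 1 := by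
    refine pow_le_one₀ (by positivity) ?_
    rw [div_le_one (by positivity)]
    nlinarith [pow_le_one₀ (n := 2) hς.le hς1]
  have h3 : 4 * (c + ε) ≤ (d : ℝ) ^ 2 * (c + ε) := by gcongr; nlinarith
  have h4 : √2 ≤ 2 := by rw [Real.sqrt_le_left (by norm_num)]; norm_num
  constructor
  · linarith
  · nlinarith

lemma tau_le (hς : 0 < ς) {c ε : ℝ} (hc : 0 < c) (hε : 0 < ε) :
    tau d ς c ε ≤ (ς ^ 2 / (3 * d)) ^ d := by
  have : 0 ≤ (d : ℝ) ^ 2 * (1 + 4 / (d * ς)) * (c + ε) := by positivity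
  rw [tau]; linarith

/-- Each action is a best response somewhere, so its cost exceeds another cost by at most an
expected payment, which is at most 1. -/
lemma IsInstance.theta_le_one (h : IsInstance ς θ p cost) (hς : 0 < ς) {i j : Fin N}
    (hij : i ≠ j) : θ ≤ 1 := by
  have key : ∀ i j : Fin N, cost i - cost j ≤ 1 := by
    intro i j
    obtain ⟨x, hx⟩ := h.region_nonempty hς i
    obtain ⟨hx, hadv⟩ := mem_region_iff.1 hx
    have h1 := hadv j
    rw [adv, inner_sub_right] at h1
    have h2 : inner ℝ x (p i) ≤ 1 :=
      (real_inner_le_norm _ _).trans (mul_le_one₀ (norm_le_one_of_mem_probSimplex hx)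
        (norm_nonneg _) (norm_le_one_of_mem_probSimplex (h.distribution i)))
    have h3 := inner_nonneg_of_mem_probSimplex hx (h.distribution j)
    linarith
  refine (h.abs_cost_sub hij).trans (abs_le.2 ⟨?_, key i j⟩)
  linarith [key j i]

/-- The size of the simplices for a given target accuracy. -/
noncomputable def simplexSize (d : ℕ) (ς : ℝ) : ℝ := ς * (ς ^ 2 / (6 * d)) ^ d / (3 * d ^ 2)

/-- The precision of the binary searches for a given target accuracy. -/
noncomputable def searchPrecision (d N : ℕ) (ς θ η : ℝ) : ℝ :=
  simplexSize d ς * min θ 1 * η / (40 * (N + 1) * (d + 1) ^ 2)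

lemma simplexSize_pos (hd : 2 ≤ d) (hς : 0 < ς) : 0 < simplexSize d ς := by
  have hd2 : (2 : ℝ) ≤ d := by exact_mod_cast hd
  unfold simplexSize; positivity

lemma simplexSize_le_one (hd : 2 ≤ d) (hς : 0 < ς) (hς1 : ς ≤ 1) : simplexSize d ς ≤ 1 := by
  have hd2 : (2 : ℝ) ≤ d := by exact_mod_cast hd
  have h2 : (ς ^ 2 / (6 * (d : ℝ))) ^ d ≤ 1 := by
    refine pow_le_one₀ (by positivity) ?_
    rw [div_le_one (by positivity)]
    nlinarith [pow_le_one₀ (n := 2) hς.le hς1]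
  rw [simplexSize, div_le_one (by positivity)]
  calc _ ≤ (1 : ℝ) := mul_le_one₀ hς1 (by positivity) h2
    _ ≤ _ := by nlinarith

lemma searchPrecision_pos {η : ℝ} (hd : 2 ≤ d) (hς : 0 < ς) (hθ : 0 < θ) (hη : 0 < η) :
    0 < searchPrecision d N ς θ η := by
  have := simplexSize_pos hd hς
  have : 0 < min θ 1 := lt_min hθ one_pos
  unfold searchPrecision; positivity

lemma mul_searchPrecision_le {η : ℝ} (hd : 2 ≤ d) (hς : 0 < ς) (hη : 0 < η) (hη1 : η < 1) :
    40 * ((d : ℝ) + 1) ^ 2 * searchPrecision d N ς θ η ≤ simplexSize d ς := by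
  have h0 := simplexSize_pos hd hς
  rw [searchPrecision]
  have e : 40 * ((d : ℝ) + 1) ^ 2 *
      (simplexSize d ς * min θ 1 * η / (40 * (N + 1) * (d + 1) ^ 2)) =
      simplexSize d ς * (min θ 1 * η) / (N + 1) := by field_simp
  rw [e, div_le_iff₀ (by positivity)]
  have h1 : min θ 1 * η ≤ 1 := by
    nlinarith [min_le_right θ 1]
  calc simplexSize d ς * (min θ 1 * η) ≤ simplexSize d ς * 1 := by gcongr
    _ ≤ simplexSize d ς * (N + 1) := by
        gcongr
        linarith [(Nat.cast_nonneg N : (0 : ℝ) ≤ N)]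

lemma xiSq_pos_of_le {c ε : ℝ} (hd : 2 ≤ d) (hε : 0 < ε)
    (h : ((d : ℝ) + 1) ^ 2 * ε ≤ c) : 0 < xiSq d c ε := by
  have hd2 : (2 : ℝ) ≤ d := by exact_mod_cast hd
  have h1 : (((d : ℝ) + 1) ^ 2 * ε) ^ 2 ≤ c ^ 2 := by gcongr
  have h2 : (d : ℝ) ^ 3 ≤ (((d : ℝ) + 1) ^ 2) ^ 2 := by
    calc (d : ℝ) ^ 3 ≤ d ^ 4 := pow_le_pow_right₀ (by linarith) (by norm_num)
      _ ≤ (d + 1) ^ 4 := by gcongr; linarith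
      _ = _ := by ring
  have h3 : (d : ℝ) ^ 3 * ε ^ 2 ≤ c ^ 2 := by
    refine le_trans ?_ h1
    rw [mul_pow]; gcongr
  have h4 : 0 < (d : ℝ) ^ 3 * ε ^ 2 := by positivity
  rw [xiSq, sub_pos, div_lt_div_iff₀ (by norm_num) (by positivity)]
  have : (d : ℝ) * ε ^ 2 * d ^ 2 = d ^ 3 * ε ^ 2 := by ring
  linarith

/-- Replacing 3d by 6d gains the factor 2^d ≥ 4, while the size is chosen so that the subtrahend is
at most twice the smaller power. -/
lemma tau_pos_of_simplexSize {ε : ℝ} (hd : 2 ≤ d) (hς : 0 < ς) (hς1 : ς ≤ 1)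
    (hε : 0 < ε) (h : ε ≤ simplexSize d ς) : 0 < tau d ς (simplexSize d ς) ε := by
  have hd2 : (2 : ℝ) ≤ d := by exact_mod_cast hd
  have h0 := simplexSize_pos hd hς
  have hA : 0 < (ς ^ 2 / (6 * (d : ℝ))) ^ d := by positivity
  have h1 : (ς ^ 2 / (3 * (d : ℝ))) ^ d = 2 ^ d * (ς ^ 2 / (6 * d)) ^ d := by
    rw [← mul_pow]; congr 1; field_simp; norm_num
  have h2 : (4 : ℝ) ≤ 2 ^ d := by
    calc (4 : ℝ) = 2 ^ 2 := by norm_num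
      _ ≤ 2 ^ d := pow_le_pow_right₀ (by norm_num) hd
  have h3 : (1 + 4 / ((d : ℝ) * ς)) ≤ 3 / ς := by
    rw [show 1 + 4 / ((d : ℝ) * ς) = (ς + 4 / d) / ς by field_simp]
    gcongr
    have : 4 / (d : ℝ) ≤ 2 := by rw [div_le_iff₀ (by positivity)]; linarith
    linarith
  rw [tau, h1, sub_pos]
  calc (d : ℝ) ^ 2 * (1 + 4 / (d * ς)) * (simplexSize d ς + ε)
      ≤ (d : ℝ) ^ 2 * (3 / ς) * (simplexSize d ς + simplexSize d ς) := by gcongr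
    _ = 2 * (ς ^ 2 / (6 * d)) ^ d := by rw [simplexSize]; field_simp; ring
    _ < 4 * (ς ^ 2 / (6 * d)) ^ d := by linarith
    _ ≤ _ := by gcongr

/-- The powers with exponent d contribute d log(6d) ≤ 6d² and d log X. All terms fit into 6d² log X,
as log X ≥ 2 and d ≥ 2. -/
lemma log_polynomial_le {X : ℝ} (hd : 2 ≤ d) (hX : 0 < X) (hL : 2 ≤ Real.log X) :
    Real.log (240 * X * ((d : ℝ) + 1) ^ 2 * d ^ 2 * ((6 * d) ^ d * X ^ d)) ≤
      6 * d ^ 2 * Real.log X := by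
  have hd2 : (2 : ℝ) ≤ d := by exact_mod_cast hd
  rw [Real.log_mul (by positivity) (by positivity), Real.log_mul (by positivity) (by positivity),
    Real.log_mul (by positivity) (by positivity), Real.log_mul (by positivity) (by positivity),
    Real.log_mul (by positivity) (by positivity), Real.log_pow, Real.log_pow, Real.log_pow,
    Real.log_pow]
  have l240 : Real.log 240 ≤ 6 := by
    rw [Real.log_le_iff_le_exp (by norm_num)]
    have h1 : (2.7 : ℝ) ≤ Real.exp 1 := by linarith [Real.exp_one_gt_d9]
    calc (240 : ℝ) ≤ 2.7 ^ 6 := by norm_num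
      _ ≤ Real.exp 1 ^ 6 := by gcongr
      _ = Real.exp 6 := by rw [← Real.exp_nat_mul]; norm_num
  have l1 : Real.log ((d : ℝ) + 1) ≤ d := by
    have := Real.log_le_sub_one_of_pos (show (0 : ℝ) < d + 1 by positivity); linarith
  have l2 : Real.log (d : ℝ) ≤ d - 1 := Real.log_le_sub_one_of_pos (by positivity)
  have l3 : Real.log (6 * (d : ℝ)) ≤ 6 * d := by
    have := Real.log_le_sub_one_of_pos (show (0 : ℝ) < 6 * d by positivity); linarith
  have l4 : (d : ℝ) * Real.log (6 * d) ≤ d * (6 * d) := by gcongr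
  push_cast
  generalize Real.log X = L at *
  have k2 : (d : ℝ) * L ≤ d ^ 2 / 2 * L := by
    apply mul_le_mul_of_nonneg_right _ (by linarith)
    nlinarith
  have k3 : (4 : ℝ) * L ≤ d ^ 2 * L := by
    apply mul_le_mul_of_nonneg_right _ (by linarith)
    nlinarith
  have k4 : (d : ℝ) ^ 2 * 2 ≤ d ^ 2 * L := by gcongr
  have k5 : 2 * (d : ℝ) ≤ d ^ 2 := by nlinarith
  have k6 : (4 : ℝ) ≤ d ^ 2 := by nlinarith
  linarith

/-- 1/ε is polynomial in N, 1/ς, 1/η, 1/θ and d, except for the d-th power of 6d/ς² in the simplex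
size. That power makes the factor d², which together with the d² edges per simplex gives d⁴ in the
claim. -/
lemma log_inv_searchPrecision_le {η : ℝ} (hd : 2 ≤ d) (hN : 2 ≤ N) (hς : 0 < ς)
    (hς1 : ς ≤ 1 / 2) (hθ : 0 < θ) (hθ1 : θ ≤ 1) (hη : 0 < η) (hη1 : η < 1) :
    2 ≤ Real.log (N * ς⁻¹ ^ 2 * η⁻¹ * θ⁻¹) ∧
    Real.log (1 / searchPrecision d N ς θ η) ≤
      6 * d ^ 2 * Real.log (N * ς⁻¹ ^ 2 * η⁻¹ * θ⁻¹) := by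
  have hd2 : (2 : ℝ) ≤ d := by exact_mod_cast hd
  have hN2 : (2 : ℝ) ≤ N := by exact_mod_cast hN
  have hiς : 2 ≤ ς⁻¹ := by rw [le_inv_comm₀ (by norm_num) hς]; linarith
  have hiη : 1 ≤ η⁻¹ := (one_le_inv₀ hη).2 hη1.le
  have hiθ : 1 ≤ θ⁻¹ := (one_le_inv₀ hθ).2 hθ1
  set s := ς⁻¹ with hs
  set e := η⁻¹ with he
  set t := θ⁻¹ with ht
  set X := N * s ^ 2 * e * t with hX
  have hX8 : 8 ≤ X := by
    calc (8 : ℝ) = 2 * 2 ^ 2 * 1 * 1 := by norm_num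
      _ ≤ _ := by rw [hX]; gcongr
  have hL2 : 2 ≤ Real.log X := by
    rw [Real.le_log_iff_exp_le (by linarith)]
    refine le_trans ?_ hX8
    rw [show (2 : ℝ) = 1 + 1 by norm_num, Real.exp_add]
    nlinarith [Real.exp_one_lt_d9, Real.exp_pos 1]
  refine ⟨hL2, ?_⟩
  set L := Real.log X with hL
  have hinv : 1 / searchPrecision d N ς θ η =
      120 * ((N + 1) * s * e * t) * ((d : ℝ) + 1) ^ 2 * d ^ 2 * ((6 * d) ^ d * (s ^ 2) ^ d) := by
    rw [searchPrecision, simplexSize, min_eq_left hθ1, hs, he, ht, ← mul_pow]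
    rw [show 6 * (d : ℝ) * ς⁻¹ ^ 2 = (ς ^ 2 / (6 * d))⁻¹ by field_simp, inv_pow]
    field_simp
    norm_num
  have hs2 : (N + 1) * s * e * t ≤ 2 * X := by
    have h1 : (N : ℝ) + 1 ≤ 2 * N := by linarith
    have h2 : s ≤ s ^ 2 := by nlinarith
    calc (N + 1) * s * e * t ≤ (2 * N) * s ^ 2 * e * t := by gcongr
      _ = 2 * X := by rw [hX]; ring
  have hsX : s ^ 2 ≤ X := by
    calc s ^ 2 = 1 * s ^ 2 * 1 * 1 := by ring
      _ ≤ X := by rw [hX]; gcongr; linarith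
  have hXpos : 0 < X := by linarith
  have hbound : 1 / searchPrecision d N ς θ η ≤
      240 * X * ((d : ℝ) + 1) ^ 2 * d ^ 2 * ((6 * d) ^ d * X ^ d) := by
    rw [hinv]
    calc _ ≤ 120 * (2 * X) * ((d : ℝ) + 1) ^ 2 * d ^ 2 * ((6 * d) ^ d * X ^ d) := by gcongr
      _ = _ := by ring
  have hpos : 0 < 1 / searchPrecision d N ς θ η :=
    one_div_pos.2 (searchPrecision_pos hd hς hθ hη)
  refine (Real.log_le_log hpos hbound).trans ?_
  exact log_polynomial_le hd hXpos hL2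

end SimplexSearch

/-! ### Accuracy and number of samples. -/

namespace SimplexSearch

variable {d N : ℕ} {p : Fin N → Vec (d + 1)} {cost : Fin N → ℝ} {ς θ : ℝ}

lemma surfaceDetection_nonneg (d : ℕ) (v : ℝ) : 0 ≤ surfaceDetection d v :=
  Real.sSup_nonneg fun _ hs => hs.1

/-- 18(2d + 1)√(d + 1) ≤ 36(d + 1)², and the 40 in the precision leaves the slack for a strict
inequality. -/
lemma mul_searchPrecision_accuracy_lt {η : ℝ} (hd : 2 ≤ d) (hN : 1 ≤ N) (hς : 0 < ς)
    (hθ : 0 < θ) (hη : 0 < η) :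
    ((N : ℝ) - 1) * (18 * (2 * d + 1) * √((d : ℝ) + 1) * searchPrecision d N ς θ η /
      (simplexSize d ς * θ)) < η := by
  have h0 := simplexSize_pos hd hς
  have hε : 0 < searchPrecision d N ς θ η := searchPrecision_pos hd hς hθ hη
  have hN1 : (1 : ℝ) ≤ N := by exact_mod_cast hN
  have hs : √((d : ℝ) + 1) ≤ d + 1 := by
    rw [Real.sqrt_le_left (by positivity)]
    nlinarith [(Nat.cast_nonneg d : (0 : ℝ) ≤ d)]
  have hm : 0 < min θ 1 := lt_min hθ one_pos
  rw [mul_div_assoc', div_lt_iff₀ (by positivity)]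
  calc ((N : ℝ) - 1) * (18 * (2 * d + 1) * √((d : ℝ) + 1) * searchPrecision d N ς θ η)
      ≤ ((N : ℝ) + 1) * (18 * (2 * (d + 1)) * (d + 1) * searchPrecision d N ς θ η) := by
        gcongr <;> linarith
    _ = 36 / 40 * (η * (simplexSize d ς * min θ 1)) := by
        rw [searchPrecision]; field_simp; norm_num
    _ < 1 * (η * (simplexSize d ς * min θ 1)) := by gcongr; norm_num
    _ ≤ η * (simplexSize d ς * θ) := by rw [one_mul]; gcongr; exact min_le_left _ _

/-- The estimate linear in ε/c is used, not the one with ξ^(d−1), so that 1/ε contains 1/c only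
once. -/
lemma IsRandomInput.measure_not_accurate_le {T : ℕ} {Ω : Type*} [MeasurableSpace Ω]
    {μ : Measure Ω} [IsProbabilityMeasure μ] {η : ℝ} {a : Vec (d + 1) → Fin N}
    {Z : Fin T → Ω → Vec (d + 1) × Vec (d + 1)} {F : Fin T → ℕ → Ω → Fin (d + 1) → Vec (d + 1)}
    (hZ : IsRandomInput μ (simplexSize d ς) Z F) (h : IsInstance ς θ p cost) (hd : 2 ≤ d)
    (hς : 0 < ς) (hς1 : ς ≤ 1) (hθ : 0 < θ) (hη : 0 < η) (hη1 : η < 1)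
    (ha : IsBestResponse p cost a) :
    μ {ω | ¬∀ q ∈ feasible cost (memory a (searchPrecision d N ς θ η) (fun t => Z t ω)
        (fun t k => F t k ω)), ∀ i j, ‖(q i - q j) - (p i - p j)‖ < η} ≤
      ENNReal.ofReal (N * Real.exp (-(T * surfaceDetection d ((ς ^ 2 / (6 * d)) ^ d)))) := by
  have hN : 1 ≤ N := (Nat.zero_le _).trans_lt (a 0).isLt
  have hd2 : (2 : ℝ) ≤ d := by exact_mod_cast hd
  have h0 := simplexSize_pos hd hς
  have hε : 0 < searchPrecision d N ς θ η := searchPrecision_pos hd hς hθ hη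
  have h40 := mul_searchPrecision_le (N := N) (θ := θ) hd hς hη hη1
  have hmul : 0 < ((d : ℝ) + 1) ^ 2 * searchPrecision d N ς θ η := by positivity
  have hεc : ((d : ℝ) + 1) ^ 2 * searchPrecision d N ς θ η ≤ simplexSize d ς := by linarith
  have hεc' : searchPrecision d N ς θ η ≤ simplexSize d ς :=
    (le_mul_of_one_le_left hε.le (by nlinarith)).trans hεc
  refine le_trans (measure_mono ?_) (hZ.measure_not_recovered_le (v := (ς ^ 2 / (6 * d)) ^ d) h hd
    hς hς1 hθ ha h0 hε (tau_pos_of_simplexSize hd hς hς1 hε hεc') (by positivity)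
    (by gcongr; norm_num) (by positivity)
    fun z F M q i j hij hz hit hF hM hq => norm_sub_sub_le_of_hits hd h ha hς hθ hij h0
      (simplexSize_le_one hd hς hς1) hε hεc hz hit hF hM hq)
  exact fun ω hω hall => hω fun q hq i j => (hall q hq i j).trans_lt
    (mul_searchPrecision_accuracy_lt hd hN hς hθ hη)

/-- Rounding down loses at most a factor 2 when there is at least one sample. Without samples n < R,
so the exponential on the right is at least 1/2 and the bound exceeds 1, as N ≥ 2. -/
lemma mul_exp_neg_samples_le {n : ℕ} {R A σ : ℝ} (hN : 2 ≤ N) (hR : 0 < R) (hRA : 2 * R ≤ A)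
    (hσ : 0 ≤ σ) (hσ1 : σ ≤ 1) :
    min 1 (N * Real.exp (-(⌊n / R⌋₊ * σ))) ≤ N * Real.exp (-(n * σ / A)) := by
  have hA : 0 < A := by linarith
  have hn : (n : ℝ) < (⌊n / R⌋₊ + 1) * R := by
    rw [← div_lt_iff₀ hR]; exact Nat.lt_floor_add_one _
  rcases Nat.eq_zero_or_pos ⌊n / R⌋₊ with h0 | h1
  · refine (min_le_left _ _).trans ?_
    rw [h0] at hn
    have h2 : (n : ℝ) * σ / A ≤ 1 / 2 := by
      rw [div_le_iff₀ hA]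
      have : (n : ℝ) * σ ≤ n * 1 := by gcongr
      push_cast at hn; linarith
    have h3 : (2 : ℝ) ≤ N := by exact_mod_cast hN
    have h4 : 1 / 2 ≤ Real.exp (-(n * σ / A)) := by
      linarith [Real.add_one_le_exp (-(n * σ / A))]
    nlinarith
  · refine (min_le_right _ _).trans ?_
    have h2 : (1 : ℝ) ≤ ⌊n / R⌋₊ := by exact_mod_cast h1
    gcongr
    rw [div_le_iff₀ hA]
    calc (n : ℝ) * σ ≤ ⌊n / R⌋₊ * (2 * R) * σ := by gcongr; nlinarith
      _ ≤ ⌊n / R⌋₊ * A * σ := by gcongr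
      _ = _ := by ring

end SimplexSearch

/-! ### Assembly of the two parts. -/

theorem mainTheorem6 :
    (∃ K : ℝ, 0 < K ∧ ∀ (d N : ℕ) (ς θ c ε : ℝ),
      2 ≤ d → 0 < ς → ς ≤ 1 → 0 < θ → 0 < c → 0 < ε →
      0 < xiSq d c ε → 0 < tau d ς c ε →
      ∀ (p : Fin N → Vec (d + 1)) (cost : Fin N → ℝ) (a : Vec (d + 1) → Fin N),
      IsInstance ς θ p cost → IsBestResponse p cost a →
      ∀ (T : ℕ) (Ω : Type*) [MeasurableSpace Ω] (μ : MeasureTheory.Measure Ω)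
        [MeasureTheory.IsProbabilityMeasure μ]
        (Z : Fin T → Ω → Vec (d + 1) × Vec (d + 1))
        (F : Fin T → ℕ → Ω → Fin (d + 1) → Vec (d + 1)),
      IsRandomInput μ c Z F →
        (∀ᵐ ω ∂μ, (rounds a ε (fun t => Z t ω) (fun t k => F t k ω) : ℝ) ≤
          K * (T * N * d ^ 2 * Real.log (1 / ε))) ∧
        μ {ω | ¬ ∀ q ∈ feasible cost (memory a ε (fun t => Z t ω) (fun t k => F t k ω)),
            ∀ i j, ‖(q i - q j) - (p i - p j)‖ ≤
              2 * ((N : ℝ) - 1) * √(d : ℝ) * ε / (xi d c ε ^ (d - 1) * θ)} ≤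
          ENNReal.ofReal (N * Real.exp (-(T * surfaceDetection d (tau d ς c ε))))) ∧
    (∃ K : ℝ, 0 < K ∧ ∀ (d N : ℕ) (ς θ η : ℝ),
      2 ≤ d → 0 < ς → ς ≤ 1 → 0 < θ → 0 < η → η < 1 →
      ∃ c ε : ℝ, 0 < c ∧ 0 < ε ∧ 0 < xiSq d c ε ∧ 0 < tau d ς c ε ∧
      ∀ n : ℕ, ∃ T : ℕ,
      ∀ (p : Fin N → Vec (d + 1)) (cost : Fin N → ℝ) (a : Vec (d + 1) → Fin N),
      IsInstance ς θ p cost → IsBestResponse p cost a →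
      ∀ (Ω : Type*) [MeasurableSpace Ω] (μ : MeasureTheory.Measure Ω)
        [MeasureTheory.IsProbabilityMeasure μ]
        (Z : Fin T → Ω → Vec (d + 1) × Vec (d + 1))
        (F : Fin T → ℕ → Ω → Fin (d + 1) → Vec (d + 1)),
      IsRandomInput μ c Z F →
        (∀ᵐ ω ∂μ, rounds a ε (fun t => Z t ω) (fun t k => F t k ω) ≤ n) ∧
        μ {ω | ¬ ∀ q ∈ feasible cost (memory a ε (fun t => Z t ω) (fun t k => F t k ω)),
            ∀ i j, ‖(q i - q j) - (p i - p j)‖ < η} ≤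
          ENNReal.ofReal (N * Real.exp (-(n * surfaceDetection d ((ς ^ 2 / (6 * d)) ^ d) /
            (K * (N * d ^ 4 * Real.log (N * ς⁻¹ ^ 2 * η⁻¹ * θ⁻¹))))))) := by
  -- 192 = 2 · 16 · 6: rounding of T, rounds per sample, and log(1/ε).
  refine ⟨⟨16, by norm_num, ?_⟩, 192, by norm_num, ?_⟩
  · intro d N ς θ c ε hd hς hς1 hθ hc hε hξ hτ p cost a h ha T Ω _ μ _ Z F hZ
    obtain ⟨hε1, hc1⟩ := tau_pos_small hd hς hς1 hc hε hτ
    refine ⟨hZ.ae_rounds_le h hd hς hθ ha hε hε1 hc1, ?_⟩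
    have hb : 0 ≤ 2 * √(d : ℝ) * ε / (xi d c ε ^ (d - 1) * θ) := by
      have : 0 ≤ xi d c ε := Real.sqrt_nonneg _
      positivity
    have e : 2 * ((N : ℝ) - 1) * √(d : ℝ) * ε / (xi d c ε ^ (d - 1) * θ) =
        ((N : ℝ) - 1) * (2 * √(d : ℝ) * ε / (xi d c ε ^ (d - 1) * θ)) := by ring
    rw [e]
    exact hZ.measure_not_recovered_le h hd hς hς1 hθ ha hc hε hτ hτ (tau_le hς hc hε) hb
      fun z F M q i j hij hz hit hF hM hq =>
        norm_sub_sub_le_of_hits' hd h ha hς hς1 hθ hij hc hε hξ hτ hz hit hF hM hq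
  · intro d N ς θ η hd hς hς1 hθ hη hη1
    have hd2 : (2 : ℝ) ≤ d := by exact_mod_cast hd
    have hc := simplexSize_pos hd hς
    have hε : 0 < searchPrecision d N ς θ η := searchPrecision_pos hd hς hθ hη
    have h40 := mul_searchPrecision_le (N := N) (θ := θ) hd hς hη hη1
    have hmul : 0 < ((d : ℝ) + 1) ^ 2 * searchPrecision d N ς θ η := by positivity
    have hεc : ((d : ℝ) + 1) ^ 2 * searchPrecision d N ς θ η ≤ simplexSize d ς := by linarith
    have hεc' : searchPrecision d N ς θ η ≤ simplexSize d ς :=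
      (le_mul_of_one_le_left hε.le (by nlinarith)).trans hεc
    have hτ := tau_pos_of_simplexSize hd hς hς1 hε hεc'
    obtain ⟨hε1, hc1⟩ := tau_pos_small hd hς hς1 hc hε hτ
    refine ⟨_, _, hc, hε, xiSq_pos_of_le hd hε hεc, hτ, fun n => ?_⟩
    by_cases hcase : 2 ≤ N ∧ θ ≤ 1 ∧ ς ≤ 1 / 2
    · obtain ⟨hN, hθ1, hς2⟩ := hcase
      have hN2 : (2 : ℝ) ≤ N := by exact_mod_cast hN
      obtain ⟨-, hlog⟩ := log_inv_searchPrecision_le hd hN hς hς2 hθ hθ1 hη hη1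
      have hlog0 : 0 < Real.log (1 / searchPrecision d N ς θ η) :=
        Real.log_pos ((one_lt_div hε).2 (by linarith))
      set R : ℝ := 16 * (N * d ^ 2 * Real.log (1 / searchPrecision d N ς θ η)) with hR
      have hR0 : 0 < R := by positivity
      have hRA : 2 * R ≤ 192 * (N * d ^ 4 * Real.log (N * ς⁻¹ ^ 2 * η⁻¹ * θ⁻¹)) := by
        calc 2 * R = 32 * (N * d ^ 2 * Real.log (1 / searchPrecision d N ς θ η)) := by
              rw [hR]; ring
          _ ≤ 32 * (N * d ^ 2 * (6 * d ^ 2 * Real.log (N * ς⁻¹ ^ 2 * η⁻¹ * θ⁻¹))) := by gcongr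
          _ = _ := by ring
      refine ⟨⌊n / R⌋₊, fun p cost a h ha Ω _ μ _ Z F hZ => ⟨?_, ?_⟩⟩
      · filter_upwards [hZ.ae_rounds_le h hd hς hθ ha hε hε1 hc1] with ω hω
        have hfl : (⌊n / R⌋₊ : ℝ) * R ≤ n := by
          rw [← le_div_iff₀ hR0]; exact Nat.floor_le (by positivity)
        have : (rounds a (searchPrecision d N ς θ η) (fun t => Z t ω)
            (fun t k => F t k ω) : ℝ) ≤ n := by
          refine hω.trans (le_trans (le_of_eq ?_) hfl)
          rw [hR]; ring
        exact_mod_cast this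
      · refine le_trans (le_min prob_le_one
          (hZ.measure_not_accurate_le h hd hς hς1 hθ hη hη1 ha)) ?_
        rw [← ENNReal.ofReal_one, ← ENNReal.ofReal_min]
        exact ENNReal.ofReal_le_ofReal (mul_exp_neg_samples_le hN hR0 hRA
          (surfaceDetection_nonneg d _) (surfaceDetection_le_one d _))
    -- No instance has two different actions here, so all differences vanish and no sample is
    -- needed.
    · refine ⟨0, fun p cost a h ha Ω _ μ _ Z F hZ => ⟨by simp [rounds], ?_⟩⟩
      have hone : ∀ i j : Fin N, i = j := by
        by_contra! hne
        obtain ⟨i, j, hij⟩ := hne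
        have hN : 2 ≤ N := by
          have := i.isLt; have := j.isLt; have := Fin.val_ne_of_ne hij; omega
        refine hcase ⟨hN, h.theta_le_one hς hij, ?_⟩
        have hN2 : (2 : ℝ) ≤ N := by exact_mod_cast hN
        nlinarith [h.card_mul_le_one hς hθ]
      refine le_trans (le_of_eq ?_) zero_le
      convert measure_empty (μ := μ)
      refine Set.eq_empty_iff_forall_notMem.2 fun ω hω => hω fun q _ i j => ?_
      rw [hone i j]; simpa using hη
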